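/- Let $\mathbb F$ be a field of characteristic zero, $H$ a finite-dimensional semisimple Hopf algebra over $\mathbb F$ with antipode $S$, $H^*$ its dual Hopf algebra, $\{x_i\}$ a basis of $H$ and $\{\alpha^i\}$ the dual basis of $H^*$. Write $\langle\alpha,h\rangle=\alpha(h)$ and use Sweedler notation. On the vector space $H\otimes H^*$ consider two structures. * The Heisenberg double $\mathcal H(H)$: the algebra with unit $1\otimes 1$ and $(h\otimes\alpha)\cdot(h'\otimes\alpha')=\langle\alpha_{(1)},h'_{(2)}\rangle\,hh'_{(1)}\otimes\alpha_{(2)}\alpha'$. * The Hopf algebra $K^*=D(H)^*$ dual to the Drinfeld double $K=D(H)=H^*\otimes H$ (with pairing $\langle y\otimes\gamma,\alpha\otimes h\rangle=\alpha(y)\gamma(h)$): $(y\otimes\gamma)(z\otimes\delta)=zy\otimes\gamma\delta$, $\Delta(y\otimes\gamma)=\sum_{i,j}(y_{(1)}\otimes\alpha^i\gamma_{(1)}\alpha^j)\otimes(S(x_j)y_{(2)}x_i\otimes\gamma_{(2)})$, $\epsilon(y\otimes\gamma)=\epsilon(y)\epsilon(\gamma)$, with antipode $S_D(y\otimes\gamma)=\sum_{i,j}x_iS^{-1}(y)x_j\otimes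 S(\alpha^j)S(\gamma)\alpha^i$. Let $R=\sum_i(1\otimes x_i)\otimes(\alpha^i\otimes 1)\in D(H)\otimes D(H)$ be the universal $R$-matrix. For $a\in H\otimes H^*$ let $(a)_i\in(H\otimes H^*)^{\otimes n}$ be the pure tensor with entry $a$ in the $i$th factor and $1\otimes 1$ elsewhere, and similarly $(a\otimes b)_{ij}$. Let $v$ be a ciliated vertex with $n\ge 0$ incident edges $e_1,\dots,e_n$ (no loops), numbered by the linear ordering at $v$. Set $\tau_i=0$, $\epsilon_i=1$ if $e_i$ is incoming at $v$ and $\tau_i=1$, $\epsilon_i=-1$ if it is outgoing, and let $\sigma_1,\dots,\sigma_n\in\{0,1\}$ be arbitrary. **The algebra $\mathcal A^*_v$.** On $(K^*)^{\otimes n}$ let $\cdot_\sigma$ be the associative multiplication with unit $(1\otimes1)^{\otimes n}$, with $a^1\otimes\dots\otimes a^n=(a^1)_1\cdot_\sigma\cdots\cdot_\sigma(a^n)_n$ and $$(a)_i\cdot_\sigma(b)_i=\begin{cases}\langle b_{(1)}\otimes a_{(1)},R\rangle\,(b_{(2)}a_{(2)})_i&\sigma_i=0\\(ab)_i&\sigma_i=1,\end{cases}\qquad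 (a)_i\cdot_\sigma(b)_j=\begin{cases}\langle b_{(1)}\otimes a_{(1)},R\rangle\,(a_{(2)}\otimes b_{(2)})_{ij}&i>j\\(a\otimes b)_{ij}&i<j.\end{cases}$$ $\mathcal A^*_v$ is the vector space $(K^*)^{\otimes n}$ with the multiplication for which the involution $S_D^{\tau_1}\otimes\dots\otimes S_D^{\tau_n}:((K^*)^{\otimes n},\cdot_\sigma)\to\mathcal A^*_v$ is an algebra morphism. **Holonomies.** To each edge $e=e_i$ belong four edges $r(e),l(e),r(\bar e),l(\bar e)$ of the thickened graph; for the reversed edge put $r(e^{-1})=l(e)^{-1}$, $l(e^{-1})=r(e)^{-1}$, $r(\bar e^{-1})=l(\bar e)^{-1}$. Their holonomies are the linear maps $H\otimes H^*\to(H\otimes H^*)^{\otimes n}$ given by $\mathrm{Hol}_{r(e_i)}(y\otimes\gamma)=\epsilon(y)(1\otimes\gamma)_i$, $\mathrm{Hol}_{r(\bar e_i)}(y\otimes\gamma)=\epsilon(\gamma)(y\otimes 1)_i$, $\mathrm{Hol}_{l(e_i)}=(S_D)_i\circ\mathrm{Hol}_{r(e_i)}\circ S_D$, $\mathrm{Hol}_{l(\bar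 e_i)}=(S_D)_i\circ\mathrm{Hol}_{r(\bar e_i)}\circ S_D$ (where $(S_D)_i$ is $S_D$ acting on the $i$th factor), $\mathrm{Hol}_{x^{-1}}=\mathrm{Hol}_x\circ S_D$ for every such edge $x$, and $\mathrm{Hol}_{p\circ q}(a)=\mathrm{Hol}_p(a_{(1)})\,\mathrm{Hol}_q(a_{(2)})$ for the coproduct of $D(H)^*$ and the product of $(D(H)^*)^{\otimes n}$. Consider the paths from the far end of $e_i$ to the cilium at $v$ $$q_{i,0}=r(\bar e_1^{\epsilon_1})\circ\dots\circ r(\bar e_{i-1}^{\epsilon_{i-1}})\circ r(\bar e_i^{\epsilon_i})\circ r(e_i^{\epsilon_i}),\qquad q_{i,1}=r(\bar e_1^{\epsilon_1})\circ\dots\circ r(\bar e_{i-1}^{\epsilon_{i-1}})\circ l(e_i^{\epsilon_i}),$$ and let $p_{e_i,s}=q_{i,s}^{\,\epsilon_i}$, so that $p_{e_i,s}$ follows $e_i$ in the direction of $e_i$. **Statement.** There is a unique linear map $\chi_{\tau,\sigma}:\mathcal A^*_v\to\mathcal H(H)^{op\otimes n}$ with $$\chi_{\tau,\sigma}((a)_i)=\mathrm{Hol}_{p_{e_i,\sigma_i}}(a),\qquad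 \chi_{\tau,\sigma}(a^1\otimes\dots\otimes a^n)=\chi_{\tau,\sigma}((a^n)_n)\cdots\chi_{\tau,\sigma}((a^1)_1)$$ for all $i$ and $a,a^1,\dots,a^n\in H\otimes H^*$, where the product on the right is that of $\mathcal H(H)^{\otimes n}$. It is a homomorphism of unital algebras, and it is an isomorphism if and only if $\sigma_i=0$ for all $i\in\{1,\dots,n\}$ or $\dim_{\mathbb F}H=1$. -/

import Mathlib

open scoped TensorProduct

noncomputable section

namespace HopfGauge

/-! ### The dual Hopf algebra `H^*` of a finite-dimensional Hopf algebra `H` -/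

section Dual

variable (F : Type*) (H : Type*) [Field F] [Ring H] [HopfAlgebra F H]

/-- Multiplication of `H^*`: `(α β)(h) = α(h₁) β(h₂)`. Its unit is the counit of `H`. -/
def dualMul : Module.Dual F H →ₗ[F] Module.Dual F H →ₗ[F] Module.Dual F H :=
  TensorProduct.curry
    ((Coalgebra.comul (R := F) (A := H)).dualMap ∘ₗ TensorProduct.dualDistrib F H H)

/-- Comultiplication of `H^*`: `⟨α₁, h⟩ ⟨α₂, k⟩ = α (h k)`. -/
def dualComul [FiniteDimensional F H] :
    Module.Dual F H →ₗ[F] Module.Dual F H ⊗[F] Module.Dual F H :=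
  (TensorProduct.dualDistribEquiv F H H).symm.toLinearMap ∘ₗ (LinearMap.mul' F H).dualMap

/-- Counit of `H^*`: `α ↦ α 1`. -/
def dualCounit : Module.Dual F H →ₗ[F] F := Module.Dual.eval F H 1

/-- Antipode of `H^*`: `α ↦ α ∘ S`. -/
def dualAntipode : Module.Dual F H →ₗ[F] Module.Dual F H :=
  (HopfAlgebra.antipode F (A := H)).dualMap

/-- The inverse `S⁻¹` of the antipode of `H`
(the antipode of a finite-dimensional Hopf algebra is bijective). -/
def antipodeInv : H →ₗ[F] H :=
  Ring.inverse (HopfAlgebra.antipode F (A := H) : Module.End F H)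

/-- Right regular action of `H` on `H^*`: `α ◁ h = ⟨α₁, h⟩ α₂`, that is `(α ◁ h)(k) = α (h k)`. -/
def dualReg : Module.Dual F H →ₗ[F] H →ₗ[F] Module.Dual F H :=
  LinearMap.mk₂ F (fun α h => α ∘ₗ LinearMap.mulLeft F h)
    (by intros; ext; simp) (by intros; ext; simp)
    (by intros; ext; simp [add_mul]) (by intros; ext; simp)

end Dual

/-! ### The vector space `H ⊗ H^*`, the Heisenberg double and the dual of the Drinfeld double -/

section Double

variable (F : Type*) (H : Type*) [Field F] [Ring H] [HopfAlgebra F H]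

/-- The vector space `H ⊗ H^*`, which underlies both `𝓗(H)` and `D(H)^*`. -/
abbrev HH := H ⊗[F] Module.Dual F H

/-- The element `1 ⊗ 1` of `H ⊗ H^*`, the unit of both `𝓗(H)` and `D(H)^*`. -/
def ddOne : HH F H := (1 : H) ⊗ₜ[F] (Coalgebra.counit : Module.Dual F H)

/-- Multiplication of the Heisenberg double `𝓗(H)`, the right smash product `H # H^*` for the right
regular action of `H` on `H^*`:
`(h ⊗ α) (h' ⊗ α') = h h'₁ ⊗ (α ◁ h'₂) α' = ⟨α₁, h'₂⟩ h h'₁ ⊗ α₂ α'`. -/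
def heisMul : HH F H →ₗ[F] HH F H →ₗ[F] HH F H :=
  TensorProduct.lift <| LinearMap.mk₂ F
    (fun h α =>
      TensorProduct.map (LinearMap.mulLeft F h)
          (TensorProduct.lift (dualMul F H ∘ₗ dualReg F H α)) ∘ₗ
        (TensorProduct.assoc F H H (Module.Dual F H)).toLinearMap ∘ₗ
        TensorProduct.map (Coalgebra.comul (R := F) (A := H)) LinearMap.id)
    (by
      intro h h' α
      rw [show LinearMap.mulLeft F (h + h') = LinearMap.mulLeft F h + LinearMap.mulLeft F h' by
        ext; simp [add_mul], TensorProduct.map_add_left, LinearMap.add_comp])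
    (by
      intro c h α
      rw [show LinearMap.mulLeft F (c • h) = c • LinearMap.mulLeft F h by ext; simp,
        TensorProduct.map_smul_left, LinearMap.smul_comp])
    (by
      intro h α α'
      rw [show TensorProduct.lift (dualMul F H ∘ₗ dualReg F H (α + α')) =
          TensorProduct.lift (dualMul F H ∘ₗ dualReg F H α) +
            TensorProduct.lift (dualMul F H ∘ₗ dualReg F H α') by
          apply TensorProduct.ext'; intros; simp,
        TensorProduct.map_add_right, LinearMap.add_comp])
    (by
      intro c h α
      rw [show TensorProduct.lift (dualMul F H ∘ₗ dualReg F H (c • α)) =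
          c • TensorProduct.lift (dualMul F H ∘ₗ dualReg F H α) by
          apply TensorProduct.ext'; intros; simp,
        TensorProduct.map_smul_right, LinearMap.smul_comp])

/-- Multiplication of `D(H)^* = H^{op} ⊗ H^*`: `(y ⊗ γ) (z ⊗ δ) = z y ⊗ γ δ`. -/
def ddMul : HH F H →ₗ[F] HH F H →ₗ[F] HH F H :=
  TensorProduct.map₂ (LinearMap.mul F H).flip (dualMul F H)

/-- Counit of `D(H)^*`: `y ⊗ γ ↦ ε(y) γ(1)`. -/
def ddCounit : HH F H →ₗ[F] F :=
  LinearMap.mul' F F ∘ₗ TensorProduct.map (Coalgebra.counit (R := F) (A := H)) (dualCounit F H)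

/-- The pairing of `D(H)^* = H ⊗ H^*` with `D(H) = H^* ⊗ H`: `⟨y ⊗ γ, α ⊗ h⟩ = α(y) γ(h)`. -/
def doublePairing : HH F H →ₗ[F] (Module.Dual F H ⊗[F] H) →ₗ[F] F :=
  (TensorProduct.map₂ (Module.Dual.eval F H) (LinearMap.id : Module.Dual F H →ₗ[F] H →ₗ[F] F)).compr₂
    (LinearMap.mul' F F)

variable [FiniteDimensional F H]

/-- Comultiplication of `D(H)^*`, for a basis `xᵢ` of `H` with dual basis `αⁱ` of `H^*`:
`Δ(y ⊗ γ) = ∑ᵢⱼ (y₁ ⊗ αⁱ γ₁ αʲ) ⊗ (S(xⱼ) y₂ xᵢ ⊗ γ₂)`. -/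
def ddComul : HH F H →ₗ[F] HH F H ⊗[F] HH F H :=
  let x := Module.finBasis F H
  ∑ i, ∑ j,
    (TensorProduct.tensorTensorTensorComm F H H (Module.Dual F H) (Module.Dual F H)).toLinearMap ∘ₗ
      TensorProduct.map
        (TensorProduct.map LinearMap.id
            (LinearMap.mulLeft F (HopfAlgebra.antipode F (x j)) ∘ₗ LinearMap.mulRight F (x i)) ∘ₗ
          Coalgebra.comul)
        (TensorProduct.map (dualMul F H (x.coord i) ∘ₗ (dualMul F H).flip (x.coord j))
            LinearMap.id ∘ₗ
          dualComul F H)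

/-- Antipode `S_D` of `D(H)^*`:
`S_D(y ⊗ γ) = ∑ᵢⱼ xᵢ S⁻¹(y) xⱼ ⊗ S(αʲ) S(γ) αⁱ`. -/
def ddAntipode : HH F H →ₗ[F] HH F H :=
  let x := Module.finBasis F H
  ∑ i, ∑ j,
    TensorProduct.map
      (LinearMap.mulLeft F (x i) ∘ₗ LinearMap.mulRight F (x j) ∘ₗ antipodeInv F H)
      (dualMul F H (dualAntipode F H (x.coord j)) ∘ₗ (dualMul F H).flip (x.coord i) ∘ₗ
        dualAntipode F H)

/-- The universal `R`-matrix `R = ∑ᵢ (1 ⊗ xᵢ) ⊗ (αⁱ ⊗ 1)` of the Drinfeld double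
`D(H) = H^* ⊗ H`. -/
def doubleR : (Module.Dual F H ⊗[F] H) ⊗[F] (Module.Dual F H ⊗[F] H) :=
  let x := Module.finBasis F H
  ∑ i, ((Coalgebra.counit : Module.Dual F H) ⊗ₜ[F] x i) ⊗ₜ[F] (x.coord i ⊗ₜ[F] (1 : H))

/-- The bilinear form `(a, b) ↦ ⟨a ⊗ b, R⟩` on `D(H)^*`. -/
def rForm : HH F H →ₗ[F] HH F H →ₗ[F] F :=
  LinearMap.mk₂ F
    (fun a b => LinearMap.mul' F F
      (TensorProduct.map (doublePairing F H a) (doublePairing F H b) (doubleR F H)))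
    (by intros; simp [TensorProduct.map_add_left])
    (by intros; simp [TensorProduct.map_smul_left])
    (by intros; simp [TensorProduct.map_add_right])
    (by intros; simp [TensorProduct.map_smul_right])

end Double

/-! ### Tensor powers of `H ⊗ H^*` -/

section Power

variable (F : Type*) (H : Type*) [Field F] [Ring H] [HopfAlgebra F H]

/-- The vector space `(H ⊗ H^*)^{⊗ n}`. -/
abbrev HHPow (n : ℕ) := ⨂[F] _ : Fin n, HH F H

/-- The element `(1 ⊗ 1)^{⊗ n}`, the unit of all the algebra structures below. -/
def powOne (n : ℕ) : HHPow F H n := PiTensorProduct.tprod F fun _ => ddOne F H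

/-- The inclusion `d ↦ (d)_i`: the pure tensor with entry `d` in the `i`th factor and `1 ⊗ 1` in all
other factors. -/
def single {n : ℕ} (i : Fin n) : HH F H →ₗ[F] HHPow F H n :=
  (PiTensorProduct.tprod F).toLinearMap (fun _ => ddOne F H) i

/-- Componentwise multiplication of `𝓗(H)^{⊗ n}`. -/
def heisPowMul (n : ℕ) : HHPow F H n →ₗ[F] HHPow F H n →ₗ[F] HHPow F H n :=
  PiTensorProduct.map₂ fun _ => heisMul F H

/-- Componentwise multiplication of `(D(H)^*)^{⊗ n}`. -/
def ddPowMul (n : ℕ) : HHPow F H n →ₗ[F] HHPow F H n →ₗ[F] HHPow F H n :=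
  PiTensorProduct.map₂ fun _ => ddMul F H

/-- The identification `V ⊗ V^{⊗ n} ≃ V^{⊗ (n + 1)}`, `a ⊗ (a¹ ⊗ ⋯ ⊗ aⁿ) ↦ a ⊗ a¹ ⊗ ⋯ ⊗ aⁿ`,
for `V = H ⊗ H^*`. -/
def consEquiv (n : ℕ) : HH F H ⊗[F] HHPow F H n ≃ₗ[F] HHPow F H (n + 1) :=
  (TensorProduct.congr
      (PiTensorProduct.subsingletonEquiv (R := F) (s := fun _ : Fin 1 => HH F H) 0).symm
      (LinearEquiv.refl F (HHPow F H n))).trans <|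
    (PiTensorProduct.tmulEquiv F (HH F H)).trans <|
      PiTensorProduct.reindex F (fun _ => HH F H)
        (finSumFinEquiv.trans (finCongr (Nat.add_comm 1 n)))

theorem consEquiv_tmul_tprod (n : ℕ) (d : HH F H) (f : Fin n → HH F H) :
    consEquiv F H n (d ⊗ₜ[F] PiTensorProduct.tprod F f) =
      PiTensorProduct.tprod F (Fin.cons d f : Fin (n + 1) → HH F H) := by
  simp only [consEquiv, LinearEquiv.trans_apply, TensorProduct.congr_tmul, LinearEquiv.refl_apply,
    PiTensorProduct.subsingletonEquiv_symm_apply, PiTensorProduct.tmulEquiv_apply]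
  erw [PiTensorProduct.reindex_tprod]
  congr 1
  funext k
  refine Fin.cases ?_ (fun j => ?_) k
  · rfl
  · have : (finSumFinEquiv.trans (finCongr (Nat.add_comm 1 n))).symm j.succ = Sum.inr j := by
      rw [Equiv.symm_apply_eq]
      ext
      simp
    rw [this]
    rfl

end Power

/-! ### The algebra `𝓐*_v` of functions on a vertex neighbourhood, for `K = D(H)` -/

section VertexAlgebra

variable (F : Type*) (H : Type*) [Field F] [Ring H] [HopfAlgebra F H] [FiniteDimensional F H]

/-- The multiplication law on a single copy of `K^*` with parameter `s`:
`a · b = ⟨b₁ ⊗ a₁, R⟩ b₂ a₂` if `s = 0` and `a · b = a b` if `s = 1`,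
with the products on the right taken in `K^*`. -/
def localMul (s : Fin 2) : HH F H →ₗ[F] HH F H →ₗ[F] HH F H :=
  if s = 0 then
    TensorProduct.curry <|
      (TensorProduct.lid F (HH F H)).toLinearMap ∘ₗ
        TensorProduct.map (TensorProduct.lift (rForm F H).flip)
          (TensorProduct.lift (ddMul F H).flip) ∘ₗ
        (TensorProduct.tensorTensorTensorComm F (HH F H) (HH F H) (HH F H) (HH F H)).toLinearMap ∘ₗ
        TensorProduct.map (ddComul F H) (ddComul F H)
  else ddMul F H

/-- The left `K^*`-coaction `a¹ ⊗ ⋯ ⊗ aⁿ ↦ (a¹₁ ⋯ aⁿ₁) ⊗ (a¹₂ ⊗ ⋯ ⊗ aⁿ₂)` on `(K^*)^{⊗ n}`, dual to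
the right action `(a¹ ⊗ ⋯ ⊗ aⁿ) ◁ h = ⟨a¹₁ ⋯ aⁿ₁, h⟩ a¹₂ ⊗ ⋯ ⊗ aⁿ₂` of `K`. -/
def coaction : (n : ℕ) → HHPow F H n →ₗ[F] HH F H ⊗[F] HHPow F H n
  | 0 => TensorProduct.mk F (HH F H) (HHPow F H 0) (ddOne F H)
  | n + 1 =>
    TensorProduct.map (TensorProduct.lift (ddMul F H)) (consEquiv F H n).toLinearMap ∘ₗ
      (TensorProduct.tensorTensorTensorComm F (HH F H) (HH F H) (HH F H)
        (HHPow F H n)).toLinearMap ∘ₗ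
      TensorProduct.map (ddComul F H) (coaction n) ∘ₗ
      (consEquiv F H n).symm.toLinearMap

/-- The braiding `t ⊗ b ↦ (b ◁ R₍₁₎) ⊗ (t ◁ R₍₂₎) = ⟨b₁ ⊗ (a¹₁ ⋯ aⁿ₁), R⟩ b₂ ⊗ (a¹₂ ⊗ ⋯ ⊗ aⁿ₂)`, where
`t = a¹ ⊗ ⋯ ⊗ aⁿ`. -/
def braiding (n : ℕ) : HHPow F H n ⊗[F] HH F H →ₗ[F] HH F H ⊗[F] HHPow F H n :=
  (TensorProduct.lid F (HH F H ⊗[F] HHPow F H n)).toLinearMap ∘ₗ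
    TensorProduct.map (TensorProduct.lift (rForm F H)) LinearMap.id ∘ₗ
    (TensorProduct.tensorTensorTensorComm F (HH F H) (HH F H) (HH F H)
      (HHPow F H n)).toLinearMap ∘ₗ
    TensorProduct.map (ddComul F H) (coaction F H n) ∘ₗ
    (TensorProduct.comm F (HHPow F H n) (HH F H)).toLinearMap

/-- The multiplication on `(K^*)^{⊗ n}` for a vertex all of whose edge ends are incoming, the
`n`-fold braided tensor product of the algebras `(K^*, localMul (σ i))`:
`(a ⊗ t) · (b ⊗ u) = (a · (b ◁ R₍₁₎)) ⊗ ((t ◁ R₍₂₎) · u)` for `a`, `b` in the first factor.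
On generators it is the multiplication law
* `(a)_i · (b)_i = ⟨b₁ ⊗ a₁, R⟩ (b₂ a₂)_i` if `σ i = 0` and `(a)_i · (b)_i = (a b)_i` if `σ i = 1`,
* `(a)_i · (b)_j = (a ⊗ b)_{ij}` if `i < j`,
* `(a)_i · (b)_j = ⟨b₁ ⊗ a₁, R⟩ (a₂ ⊗ b₂)_{ij}` if `i > j`,
and `a¹ ⊗ ⋯ ⊗ aⁿ = (a¹)_1 · ⋯ · (aⁿ)_n`. -/
def incomingMul : (n : ℕ) → (Fin n → Fin 2) → HHPow F H n →ₗ[F] HHPow F H n →ₗ[F] HHPow F H n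
  | 0, _ => ddPowMul F H 0
  | n + 1, σ =>
    (TensorProduct.curry <|
      (consEquiv F H n).toLinearMap ∘ₗ
        TensorProduct.map (TensorProduct.lift (localMul F H (σ 0)))
          (TensorProduct.lift (incomingMul n (Fin.tail σ))) ∘ₗ
        (TensorProduct.assoc F (HH F H) (HH F H) (HHPow F H n ⊗[F] HHPow F H n)).symm.toLinearMap ∘ₗ
        TensorProduct.map LinearMap.id
          ((TensorProduct.assoc F (HH F H) (HHPow F H n) (HHPow F H n)).toLinearMap ∘ₗ
            TensorProduct.map (braiding F H n) LinearMap.id ∘ₗ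
            (TensorProduct.assoc F (HHPow F H n) (HH F H) (HHPow F H n)).symm.toLinearMap) ∘ₗ
        (TensorProduct.assoc F (HH F H) (HHPow F H n) (HH F H ⊗[F] HHPow F H n)).toLinearMap).compl₁₂
      (consEquiv F H n).symm.toLinearMap (consEquiv F H n).symm.toLinearMap

/-- The involution `S^{τ₁} ⊗ ⋯ ⊗ S^{τₙ}` of `(K^*)^{⊗ n}`, with `S = S_D` the antipode of `K^*`. -/
def orientationFlip {n : ℕ} (τ : Fin n → Fin 2) : HHPow F H n →ₗ[F] HHPow F H n :=
  PiTensorProduct.map fun i => ((ddAntipode F H : Module.End F (HH F H)) ^ (τ i : ℕ))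

/-- The multiplication of `𝓐*_v` for a ciliated vertex `v` with `n` incident edge ends, where
`τ i = 0` if the `i`th edge end is incoming and `τ i = 1` if it is outgoing: the multiplication for
which the involution `S^{τ₁} ⊗ ⋯ ⊗ S^{τₙ}` is an algebra morphism from `(K^*)^{⊗ n}`, with the
multiplication for incoming edge ends, to `𝓐*_v`. -/
def vertexMul {n : ℕ} (τ σ : Fin n → Fin 2) : HHPow F H n →ₗ[F] HHPow F H n →ₗ[F] HHPow F H n :=
  ((incomingMul F H n σ).compl₁₂ (orientationFlip F H τ) (orientationFlip F H τ)).compr₂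
    (orientationFlip F H τ)

end VertexAlgebra

/-! ### Holonomies in the thickening of a vertex neighbourhood -/

/-- The edges of the thickening of a vertex neighbourhood with edges `e_1, …, e_n`: the edges
`r(e_i)` and `l(e_i)` to the right and left of `e_i`, and the edges `r(ē_i)` and `l(ē_i)` that cross
`e_i` at its target and starting end. -/
inductive ThickEdge (n : ℕ)
  | r (i : Fin n)
  | l (i : Fin n)
  | rbar (i : Fin n)
  | lbar (i : Fin n)

/-- Words in the edges of the thickening and their inverses. The word `x_1^{δ_1} ∘ ⋯ ∘ x_m^{δ_m}`, in
which `x_m^{δ_m}` is traversed first, is the list of the pairs `(x_k, b_k)` in this order, with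
`b_k = false` if `δ_k = 1` and `b_k = true` if `δ_k = -1`. -/
abbrev ThickWord (n : ℕ) := List (ThickEdge n × Bool)

/-- The word of the reversed path. -/
def ThickWord.inv {n : ℕ} (w : ThickWord n) : ThickWord n :=
  (w.map fun p => (p.1, !p.2)).reverse

section Holonomy

variable (F : Type*) (H : Type*) [Field F] [Ring H] [HopfAlgebra F H] [FiniteDimensional F H]

/-- `y ⊗ γ ↦ ε(y) 1 ⊗ γ`. -/
def holR : HH F H →ₗ[F] HH F H :=
  TensorProduct.map (Algebra.linearMap F H ∘ₗ Coalgebra.counit) LinearMap.id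

/-- `y ⊗ γ ↦ ε(γ) y ⊗ 1`. -/
def holRbar : HH F H →ₗ[F] HH F H :=
  TensorProduct.map LinearMap.id
    (LinearMap.toSpanSingleton F (Module.Dual F H) Coalgebra.counit ∘ₗ dualCounit F H)

/-- Holonomies of the edges of the thickening:
`Hol_{r(e)}(y ⊗ γ) = ε(y) (1 ⊗ γ)_e`, `Hol_{r(ē)}(y ⊗ γ) = ε(γ) (y ⊗ 1)_e`,
`Hol_{l(e)} = S_D ∘ Hol_{r(e)} ∘ S_D`, `Hol_{l(ē)} = S_D ∘ Hol_{r(ē)} ∘ S_D`. -/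
def edgeHol {n : ℕ} : ThickEdge n → (HH F H →ₗ[F] HHPow F H n)
  | .r i => single F H i ∘ₗ holR F H
  | .l i => single F H i ∘ₗ ddAntipode F H ∘ₗ holR F H ∘ₗ ddAntipode F H
  | .rbar i => single F H i ∘ₗ holRbar F H
  | .lbar i => single F H i ∘ₗ ddAntipode F H ∘ₗ holRbar F H ∘ₗ ddAntipode F H

/-- Holonomy of an edge `x` or of its inverse: `Hol_{x⁻¹} = Hol_x ∘ S_D`. -/
def letterHol {n : ℕ} (p : ThickEdge n × Bool) : HH F H →ₗ[F] HHPow F H n :=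
  if p.2 then edgeHol F H p.1 ∘ₗ ddAntipode F H else edgeHol F H p.1

/-- The holonomy functor, on words: the empty word has holonomy `a ↦ ε(a) 1`, and composition of
paths corresponds to the convolution product
`Hol_{p ∘ q}(a) = Hol_p(a₁) Hol_q(a₂)` for the comultiplication of `D(H)^*` and the componentwise
multiplication of `(D(H)^*)^{⊗ n}`. -/
def hol {n : ℕ} : ThickWord n → (HH F H →ₗ[F] HHPow F H n)
  | [] => LinearMap.toSpanSingleton F (HHPow F H n) (powOne F H n) ∘ₗ ddCounit F H
  | p :: w =>
    TensorProduct.lift (ddPowMul F H n) ∘ₗ TensorProduct.map (letterHol F H p) (hol w) ∘ₗ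
      ddComul F H

end Holonomy

/-! ### The paths in a vertex neighbourhood

The edges are numbered by the linear ordering at the vertex, and `e_i^{ε_i}` is incoming, where
`ε_i = 1` if `τ i = 0` and `ε_i = -1` if `τ i = 1`. For the reversed edge one has
`r(e⁻¹) = l(e)⁻¹`, `l(e⁻¹) = r(e)⁻¹` and `r(ē⁻¹) = l(ē)⁻¹`. -/

/-- `r(e_i^{ε_i})`. -/
def rStep {n : ℕ} (τ : Fin n → Fin 2) (i : Fin n) : ThickEdge n × Bool :=
  if τ i = 0 then (.r i, false) else (.l i, true)

/-- `l(e_i^{ε_i})`. -/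
def lStep {n : ℕ} (τ : Fin n → Fin 2) (i : Fin n) : ThickEdge n × Bool :=
  if τ i = 0 then (.l i, false) else (.r i, true)

/-- `r(ē_i^{ε_i})`. -/
def rbarStep {n : ℕ} (τ : Fin n → Fin 2) (i : Fin n) : ThickEdge n × Bool :=
  if τ i = 0 then (.rbar i, false) else (.lbar i, true)

/-- The path from the univalent end of `e_i` along `e_i^{ε_i}` to the cilium at the vertex:
`r(ē_1^{ε_1}) ∘ ⋯ ∘ r(ē_{i-1}^{ε_{i-1}}) ∘ r(ē_i^{ε_i}) ∘ r(e_i^{ε_i})` if `s = 0`, and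
`r(ē_1^{ε_1}) ∘ ⋯ ∘ r(ē_{i-1}^{ε_{i-1}}) ∘ l(e_i^{ε_i})` if `s = 1`. -/
def incomingPath {n : ℕ} (τ : Fin n → Fin 2) (s : Fin 2) (i : Fin n) : ThickWord n :=
  ((List.finRange n).filter (· < i)).map (rbarStep τ) ++
    if s = 0 then [rbarStep τ i, rStep τ i] else [lStep τ i]

/-- The path `p_{e_i, s}`, which follows `e_i` in the direction of `e_i`: the path above if `e_i` is
incoming, and its reverse, from the cilium to the univalent end of `e_i`, if `e_i` is outgoing. -/
def nbPath {n : ℕ} (τ : Fin n → Fin 2) (s : Fin 2) (i : Fin n) : ThickWord n :=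
  if τ i = 0 then incomingPath τ s i else (incomingPath τ s i).inv

/-- `χ` is the linear map `χ_{τ,σ}`: it is given by `χ((a)_i) = Hol_{p_{e_i, σ_i}}(a)` and
`χ(a¹ ⊗ ⋯ ⊗ aⁿ) = χ((aⁿ)_n) ⋯ χ((a¹)_1)`, with the product of `𝓗(H)^{⊗ n}`. -/
structure IsChi {F H : Type*} [Field F] [Ring H] [HopfAlgebra F H] [FiniteDimensional F H] {n : ℕ}
    (τ σ : Fin n → Fin 2) (χ : HHPow F H n →ₗ[F] HHPow F H n) : Prop where
  map_single : ∀ (i : Fin n) (a : HH F H), χ (single F H i a) = hol F H (nbPath τ (σ i) i) a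
  map_tprod : ∀ a : Fin n → HH F H,
    χ (PiTensorProduct.tprod F a) =
      ((List.finRange n).map fun i => χ (single F H i (a i))).foldl
        (fun x y => heisPowMul F H n y x) (powOne F H n)

end HopfGauge

end

/-!
The proof rests on the fact that the antipode `S` of `H` is an involution (`antipode_antipode`), a
theorem of Larson and Radford. A semisimple `H` has a two-sided integral `Λ` with `ε(Λ) = 1`, and
`α ↦ Λ₁ α(Λ₂)` is a bijection `H^* → H`, so that `S` is bijective and there is a cointegral `λ` with
`Λ₁ λ(Λ₂) = 1`. The cointegral is a Frobenius form with Nakayama automorphism `S²`, and it is the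
functional `h ↦ Tr(x ↦ h S²(x))`. By Radford's formula `S⁴` is conjugation with a grouplike element,
so `S²` has finite order. Over an algebraically closed field `Tr(S²)` is then a sum of squares of
absolute values over the matrix blocks of `H`, not all of them zero. Finally `Tr(S²) ≠ 0` forces
`S⁴ = id`, and since the character of the regular comodule is an idempotent up to the factor `dim H`,
it even forces `S² = id`.

The vector space `H ⊗ H^*` is described in two ways. As an algebra `D(H)^*` is the convolution algebra
`Hom(H, H^{op})`, and `𝓗(H)` acts on `H` by `(y ⊗ γ) x = y x₁ γ(x₂)`. The two are related by
convolution with the invertible element `id`, and the antipode `S_D` becomes conjugation with `S` in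
the second one. As `S² = id`, this shows that the representation is faithful, and that `S_D` is an
involution, an antihomomorphism of `D(H)^*` and a homomorphism of `𝓗(H)`.

The `R`-matrix sees an element `y ⊗ γ` in its second argument only through `γ(1) y`. The
multiplication laws of the vertex algebra are therefore governed by the coaction
`y ⊗ γ ↦ y₁ ⊗ (y₂ ⊗ γ)` of `H` and the action `b ◁ h = S(h₂) b h₁` of `H`, with products in `𝓗(H)`.
In particular the law on a single edge end with `σ = 0` is the opposite of the multiplication of
`𝓗(H)` (`localMul_zero`).

For incoming edge ends the map `χ` is defined by the recursion `χ(a ⊗ t) = (t₋₁ ⊗ 1) φ(a) ⊗ χ(t₀)`,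
where `φ` is the identity if `σ₁ = 0` and the antimultiplicative map `y ⊗ γ ↦ ε(y) S_D(1 ⊗ S(γ))` if
`σ₁ = 1`. The elements `a₋₁ ⊗ φ(a₀)` and `y₁ ⊗ (y₂ ⊗ 1)` of `H ⊗ 𝓗(H)` satisfy an exchange relation
(`siteCo_mul_delta`) that matches the braiding of the vertex algebra. By induction over the number of
edge ends, `t ↦ t₋₁ ⊗ χ(t₀)` is antimultiplicative (`chiCo_incomingMul`), and so is `χ`.

Arbitrary orientations are reduced to this case by conjugation with `S_D^{τ₁} ⊗ ⋯ ⊗ S_D^{τₙ}`, which is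
an automorphism of `𝓗(H)^{⊗ n}`. That the resulting map has the prescribed values on generators is a
computation of path holonomies (`orientationFlip_chi_single`, `hol_incomingPath`); the paths along
outgoing edges are reversed by `hol_incomingPath_inv`.

The twist `a ⊗ t ↦ (t₋₁ ⊗ 1) a ⊗ t₀` has the inverse `a ⊗ t ↦ (S(t₋₁) ⊗ 1) a ⊗ t₀`, so `χ` is bijective
if and only if the maps `φ` are bijective for all edge ends (`bijective_chi`). For `σᵢ = 0` this always
holds; for `σᵢ = 1` the map annihilates `y ⊗ 1` for all `y` in the kernel of the counit, and it is
bijective only if `H` is one-dimensional.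
-/

noncomputable section

namespace HopfGauge

open Coalgebra HopfAlgebra WithConv

/-! ### The antipode and the comultiplication -/

section Shortcuts

variable {R V W : Type*} [CommSemiring R] [AddCommMonoid V] [AddCommMonoid W] [Module R V] [Module R W]

-- Shortcuts for type class inference on the carriers below, which otherwise tries the classes of ring
-- morphisms before it finds these instances.

instance linearMap_zeroHomClass : ZeroHomClass (V →ₗ[R] W) V W := inferInstance

instance linearMap_addHomClass : AddHomClass (V →ₗ[R] W) V W := inferInstance

instance linearEquiv_zeroHomClass : ZeroHomClass (V ≃ₗ[R] W) V W := inferInstance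

instance linearEquiv_addHomClass : AddHomClass (V ≃ₗ[R] W) V W := inferInstance

end Shortcuts

section Antipode

variable {F H : Type*} [Field F] [Ring H] [HopfAlgebra F H]

/-- The map `a ↦ a ⊗ 1`. -/
abbrev inl : H →ₗ[F] H ⊗[F] H := (TensorProduct.mk F H H).flip 1

/-- The map `a ↦ 1 ⊗ a`. -/
abbrev inr : H →ₗ[F] H ⊗[F] H := TensorProduct.mk F H H 1

/-- The comultiplication is the convolution product of the two inclusions `H → H ⊗ H`, each of which
has a convolution inverse. The identities for the antipode below follow by solving for one of the
three. -/
theorem inl_convMul_inr :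
    toConv (inl (F := F) (H := H)) * toConv inr = toConv (comul (R := F) (A := H)) := by
  ext a
  rw [(ℛ F a).convMul_apply]
  simp [← (ℛ F a).eq]

theorem inl_antipode_convMul_inl :
    toConv (inl (F := F) (H := H) ∘ₗ antipode F) * toConv inl = 1 := by
  ext a
  rw [(ℛ F a).convMul_apply]
  simp [← TensorProduct.sum_tmul, sum_antipode_mul_eq_algebraMap_counit]

theorem inr_antipode_convMul_inr :
    toConv (inr (F := F) (H := H) ∘ₗ antipode F) * toConv inr = 1 := by
  ext a
  rw [(ℛ F a).convMul_apply]
  simp [← TensorProduct.tmul_sum, sum_antipode_mul_eq_algebraMap_counit,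
    Algebra.algebraMap_eq_smul_one, Algebra.TensorProduct.one_def]

theorem inr_convMul_inr_antipode :
    toConv (inr (F := F) (H := H)) * toConv (inr ∘ₗ antipode F) = 1 := by
  ext a
  rw [(ℛ F a).convMul_apply]
  simp [← TensorProduct.tmul_sum, sum_mul_antipode_eq_algebraMap_counit,
    Algebra.algebraMap_eq_smul_one, Algebra.TensorProduct.one_def]

/-- The antipode reverses the comultiplication. -/
theorem comul_antipode (a : H) :
    comul (R := F) (antipode F a) =
      TensorProduct.map (antipode F) (antipode F) (TensorProduct.comm F H H (comul a)) := by
  have h1 : toConv (inr (F := F) (H := H) ∘ₗ antipode F) * toConv (inl ∘ₗ antipode F) =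
      toConv (TensorProduct.map (antipode F) (antipode F) ∘ₗ
        (TensorProduct.comm F H H).toLinearMap ∘ₗ comul) := by
    ext a
    rw [(ℛ F a).convMul_apply]
    simp [← (ℛ F a).eq]
  have h2 : toConv (TensorProduct.map (antipode F) (antipode F) ∘ₗ
        (TensorProduct.comm F H H).toLinearMap ∘ₗ comul) * toConv (comul (R := F) (A := H)) = 1 := by
    rw [← h1, ← inl_convMul_inr, mul_assoc, ← mul_assoc (toConv (inl ∘ₗ antipode F)),
      inl_antipode_convMul_inl, one_mul, inr_antipode_convMul_inr]
  have h3 := left_inv_eq_right_inv h2 LinearMap.comul_right_inv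
  exact congr($h3.symm a)

/-- `∑ (S(a₁) ⊗ 1) Δ(a₂) = 1 ⊗ a`. -/
theorem sum_antipode_tmul_one_mul_comul {a : H} {ι : Type*} (r : Repr F a ι) :
    ∑ i ∈ r.index, (antipode F (r.left i) ⊗ₜ[F] (1 : H)) * comul (R := F) (r.right i) =
      1 ⊗ₜ[F] a := by
  have : toConv (inl (F := F) (H := H) ∘ₗ antipode F) * toConv (comul (R := F) (A := H)) =
      toConv inr := by
    rw [← inl_convMul_inr, ← mul_assoc, inl_antipode_convMul_inl, one_mul]
  have := congr($this a)
  rw [r.convMul_apply] at this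
  simpa using this

/-- `∑ Δ(a₁) (1 ⊗ S(a₂)) = a ⊗ 1`. -/
theorem sum_comul_mul_one_tmul_antipode {a : H} {ι : Type*} (r : Repr F a ι) :
    ∑ i ∈ r.index, comul (R := F) (r.left i) * ((1 : H) ⊗ₜ[F] antipode F (r.right i)) =
      a ⊗ₜ[F] 1 := by
  have : toConv (comul (R := F) (A := H)) * toConv (inr (F := F) (H := H) ∘ₗ antipode F) =
      toConv inl := by
    rw [← inl_convMul_inr, mul_assoc, inr_convMul_inr_antipode, mul_one]
  have := congr($this a)
  rw [r.convMul_apply] at this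
  simpa using this

/-- The square of the antipode as an algebra endomorphism. -/
def antipodeSq (F H : Type*) [Field F] [Ring H] [HopfAlgebra F H] : H →ₐ[F] H :=
  .ofLinearMap (antipode F ∘ₗ antipode F) (by simp) (by simp [antipode_mul_antidistrib])

@[simp] theorem antipodeSq_apply (a : H) : antipodeSq F H a = antipode F (antipode F a) := rfl

theorem comul_antipodeSq (a : H) :
    comul (R := F) (antipodeSq F H a) =
      TensorProduct.map (antipodeSq F H).toLinearMap (antipodeSq F H).toLinearMap (comul a) := by
  simp only [antipodeSq_apply, comul_antipode]
  generalize comul (R := F) a = t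
  induction t with
  | zero => simp
  | tmul x y => simp
  | add x y hx hy => simp only [map_add, hx, hy]

end Antipode

/-! ### Integrals -/

section Integral

variable {F H : Type*} [Field F] [Ring H] [HopfAlgebra F H]

/-- A two-sided integral `Λ` of `H`, normalized by `ε(Λ) = 1`. -/
structure IsNormalizedIntegral (F : Type*) {H : Type*} [Field F] [Ring H] [HopfAlgebra F H]
    (Λ : H) : Prop where
  mul_left : ∀ h : H, h * Λ = counit (R := F) h • Λ
  mul_right : ∀ h : H, Λ * h = counit (R := F) h • Λ
  counit_eq : counit (R := F) Λ = 1

/-- The complement of the ideal `ker ε` in a semisimple algebra contains an integral. -/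
theorem exists_left_integral [IsSemisimpleRing H] :
    ∃ Λ : H, (∀ h : H, h * Λ = counit (R := F) h • Λ) ∧ counit (R := F) Λ = 1 := by
  let ε := Bialgebra.counitAlgHom F H
  obtain ⟨I, hI⟩ := exists_isCompl (RingHom.ker ε)
  obtain ⟨b, hb, a, ha, hab⟩ := Submodule.mem_sup.1 (hI.sup_eq_top ▸ Submodule.mem_top (x := (1 : H)))
  have hεa : ε a = 1 := by
    have := congr(ε $hab)
    rwa [map_add, (RingHom.mem_ker).1 hb, zero_add, map_one] at this
  refine ⟨a, fun h => ?_, hεa⟩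
  have h1 : h * a - ε h • a ∈ I := by
    refine I.sub_mem (I.mul_mem_left h ha) ?_
    rw [Algebra.smul_def]
    exact I.mul_mem_left _ ha
  have h2 : h * a - ε h • a ∈ RingHom.ker ε := by
    rw [RingHom.mem_ker]
    simp [hεa]
  exact sub_eq_zero.1 (hI.disjoint.le_bot (Submodule.mem_inf.2 ⟨h2, h1⟩))

theorem exists_right_integral [IsSemisimpleRing H] :
    ∃ Λ : H, (∀ h : H, Λ * h = counit (R := F) h • Λ) ∧ counit (R := F) Λ = 1 := by
  let ε : Hᵐᵒᵖ →ₐ[F] F := (Bialgebra.counitAlgHom F H).fromOpposite fun x y => mul_comm _ _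
  obtain ⟨I, hI⟩ := exists_isCompl (RingHom.ker ε)
  obtain ⟨b, hb, a, ha, hab⟩ :=
    Submodule.mem_sup.1 (hI.sup_eq_top ▸ Submodule.mem_top (x := (1 : Hᵐᵒᵖ)))
  have hεa : ε a = 1 := by
    have := congr(ε $hab)
    rwa [map_add, (RingHom.mem_ker).1 hb, zero_add, map_one] at this
  refine ⟨a.unop, fun h => ?_, hεa⟩
  have h1 : .op h * a - ε (.op h) • a ∈ I := by
    refine I.sub_mem (I.mul_mem_left _ ha) ?_
    rw [Algebra.smul_def]
    exact I.mul_mem_left _ ha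
  have h2 : .op h * a - ε (.op h) • a ∈ RingHom.ker ε := by
    rw [RingHom.mem_ker]
    simp [hεa]
  have := congr(MulOpposite.unop $(sub_eq_zero.1 (hI.disjoint.le_bot (Submodule.mem_inf.2 ⟨h2, h1⟩))))
  exact this

/-- A left and a right integral that are both normalized coincide. -/
theorem exists_isNormalizedIntegral (F H : Type*) [Field F] [Ring H] [HopfAlgebra F H]
    [IsSemisimpleRing H] :
    ∃ Λ : H, IsNormalizedIntegral F Λ := by
  obtain ⟨a, ha, ha'⟩ := exists_left_integral (F := F) (H := H)
  obtain ⟨b, hb, hb'⟩ := exists_right_integral (F := F) (H := H)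
  have : a = b := by rw [← one_smul F a, ← hb', ← ha, hb, ha', one_smul]
  subst this
  exact ⟨a, ha, hb, ha'⟩

/-- The linear map `a ⊗ b ↦ α(b) a`. -/
def contractRight (α : Module.Dual F H) : H ⊗[F] H →ₗ[F] H :=
  (TensorProduct.rid F H).toLinearMap ∘ₗ LinearMap.lTensor H α

@[simp] theorem contractRight_tmul (α : Module.Dual F H) (a b : H) :
    contractRight α (a ⊗ₜ b) = α b • a := by simp [contractRight]

/-- The linear map `a ⊗ b ↦ α(a) b`. -/
def contractLeft (α : Module.Dual F H) : H ⊗[F] H →ₗ[F] H :=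
  (TensorProduct.lid F H).toLinearMap ∘ₗ LinearMap.rTensor H α

@[simp] theorem contractLeft_tmul (α : Module.Dual F H) (a b : H) :
    contractLeft α (a ⊗ₜ b) = α a • b := by simp [contractLeft]

/-- Invariance of the canonical element `∑ᵢ xᵢ ⊗ αⁱ` under moving a linear map across. -/
theorem sum_coord_comp {V W M ι κ : Type*} [AddCommGroup V] [Module F V] [AddCommGroup W]
    [Module F W] [AddCommGroup M] [Module F M] [Fintype ι] [Fintype κ]
    (b : Module.Basis ι F V) (c : Module.Basis κ F W) (f : V →ₗ[F] W)
    (B : W →ₗ[F] Module.Dual F V →ₗ[F] M) :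
    ∑ i, B (f (b i)) (b.coord i) = ∑ k, B (c k) (c.coord k ∘ₗ f) := by
  have h1 : ∀ k, c.coord k ∘ₗ f = ∑ i, c.coord k (f (b i)) • b.coord i := fun k =>
    b.ext fun j => by
      classical simp [Finsupp.single_apply]
  have h2 : ∀ i, f (b i) = ∑ k, c.coord k (f (b i)) • c k := fun i => (c.sum_repr _).symm
  simp_rw [h1, map_sum, map_smul]
  rw [Finset.sum_comm]
  refine Finset.sum_congr rfl fun i _ => ?_
  conv_lhs => rw [h2 i]
  simp only [map_sum, map_smul, LinearMap.sum_apply, LinearMap.smul_apply]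

/-- `∑ k₁ ⊗ S(k₃) S²(k₂) = k ⊗ 1`. -/
theorem sum_map_antipodeSq_comul_antipode {k : H} {ι : Type*} (r : Repr F k ι) :
    ∑ i ∈ r.index, ((1 : H) ⊗ₜ[F] antipode F (r.right i)) *
      LinearMap.lTensor H (antipodeSq F H).toLinearMap (comul (R := F) (r.left i)) = k ⊗ₜ[F] 1 := by
  let O := (MulOpposite.opLinearEquiv F (M := H)).toLinearMap
  let p : H →ₗ[F] H ⊗[F] Hᵐᵒᵖ := (TensorProduct.mk F H Hᵐᵒᵖ).flip 1
  let j : H →ₗ[F] H ⊗[F] Hᵐᵒᵖ :=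
    TensorProduct.mk F H Hᵐᵒᵖ 1 ∘ₗ O ∘ₗ (antipodeSq F H).toLinearMap
  let s : H →ₗ[F] H ⊗[F] Hᵐᵒᵖ := TensorProduct.mk F H Hᵐᵒᵖ 1 ∘ₗ O ∘ₗ antipode F
  have hjs : toConv j * toConv s = 1 := by
    ext a
    rw [(ℛ F a).convMul_apply]
    change ∑ i ∈ (ℛ F a).index, j _ * s _ = _
    simp only [j, s, O, LinearMap.comp_apply, TensorProduct.mk_apply,
      Algebra.TensorProduct.tmul_mul_tmul, mul_one, AlgHom.toLinearMap_apply, antipodeSq_apply,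
      LinearEquiv.coe_coe, MulOpposite.coe_opLinearEquiv, ← MulOpposite.op_mul,
      ← antipode_mul_antidistrib, ← TensorProduct.tmul_sum]
    rw [← Finset.op_sum, ← map_sum, sum_antipode_mul_eq_algebraMap_counit]
    simp [Algebra.TensorProduct.one_def, Algebra.algebraMap_eq_smul_one]
  have hpj : toConv p * toConv j =
      toConv (LinearMap.lTensor H (O ∘ₗ (antipodeSq F H).toLinearMap) ∘ₗ comul) := by
    ext a
    rw [(ℛ F a).convMul_apply]
    simp [p, j, ← (ℛ F a).eq]
  have h : toConv (LinearMap.lTensor H (O ∘ₗ (antipodeSq F H).toLinearMap) ∘ₗ comul) * toConv s =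
      toConv p := by
    rw [← hpj]
    exact (mul_assoc (toConv p) (toConv j) (toConv s)).trans
      ((congrArg (toConv p * ·) hjs).trans (mul_one (toConv p)))
  have h2 := congr($h k)
  rw [r.convMul_apply] at h2
  apply (TensorProduct.congr (LinearEquiv.refl F H) (MulOpposite.opLinearEquiv F)).injective
  rw [map_sum]
  refine Eq.trans ?_ h2
  refine Finset.sum_congr rfl fun i _ => ?_
  change _ = (LinearMap.lTensor H (O ∘ₗ (antipodeSq F H).toLinearMap) (comul (R := F) (r.left i))) *
    s (r.right i)
  generalize comul (R := F) (r.left i) = t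
  induction t with
  | zero => simp
  | tmul x y => simp [s, O]
  | add x y hx hy => simp only [map_add, mul_add, add_mul, hx, hy]

end Integral

/-! ### Bijectivity of the antipode -/

section Bijectivity

variable {F H : Type*} [Field F] [Ring H] [HopfAlgebra F H]

theorem contractRight_comp_mulLeft (α : Module.Dual F H) (s : H) (t : H ⊗[F] H) :
    contractRight (α ∘ₗ LinearMap.mulLeft F s) t = contractRight α ((1 ⊗ₜ s) * t) := by
  induction t with
  | zero => simp
  | tmul x y => simp
  | add x y hx hy => simp only [map_add, mul_add, hx, hy]

theorem contractRight_tmul_one_mul (α : Module.Dual F H) (k : H) (t : H ⊗[F] H) :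
    contractRight α ((k ⊗ₜ 1) * t) = k * contractRight α t := by
  induction t with
  | zero => simp
  | tmul x y => simp
  | add x y hx hy => simp only [map_add, mul_add, hx, hy]

theorem contractRight_comp (α : Module.Dual F H) (f : H →ₗ[F] H) (t : H ⊗[F] H) :
    contractRight (α ∘ₗ f) t = contractRight α (LinearMap.lTensor H f t) := by
  induction t with
  | zero => simp
  | tmul x y => simp
  | add x y hx hy => simp only [map_add, hx, hy]

/-- `contractRight` as a bilinear map. -/
def contractRightₗ (F H : Type*) [Field F] [Ring H] [HopfAlgebra F H] :
    Module.Dual F H →ₗ[F] H ⊗[F] H →ₗ[F] H :=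
  LinearMap.mk₂ F (fun α t => contractRight α t)
    (fun α β t => by
      induction t with
      | zero => simp
      | tmul x y => simp [add_smul]
      | add x y hx hy => simp only [map_add, hx, hy]; abel)
    (fun c α t => by
      induction t with
      | zero => simp
      | tmul x y => simp [mul_smul]
      | add x y hx hy => simp only [map_add, smul_add, hx, hy])
    (by simp) (by simp)

@[simp] theorem contractRightₗ_apply (α : Module.Dual F H) (t : H ⊗[F] H) :
    contractRightₗ F H α t = contractRight α t := rfl

variable (F) in
/-- Twisting with `S²` compensates for the noncommutativity when a factor `k` is moved out of a
contraction. -/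
theorem sum_contractRight_comul_mul {k : H} {ι : Type*} (r : Repr F k ι) (α : Module.Dual F H)
    (w : H ⊗[F] H) :
    ∑ i ∈ r.index, contractRight
        (α ∘ₗ LinearMap.mulLeft F (antipode F (r.right i)) ∘ₗ (antipodeSq F H).toLinearMap)
        (comul (R := F) (r.left i) * w) =
      k * contractRight (α ∘ₗ (antipodeSq F H).toLinearMap) w := by
  let Q := Algebra.TensorProduct.map (AlgHom.id F H) (antipodeSq F H)
  have hQ : ∀ t, LinearMap.lTensor H (antipodeSq F H).toLinearMap t = Q t := fun t => rfl
  have h := sum_map_antipodeSq_comul_antipode r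
  simp_rw [hQ] at h
  simp_rw [← LinearMap.comp_assoc, contractRight_comp _ (antipodeSq F H).toLinearMap, hQ, map_mul,
    contractRight_comp_mulLeft, ← mul_assoc, ← map_sum, ← Finset.sum_mul, h,
    contractRight_tmul_one_mul]

/-- The linear map `a ⊗ t ↦ Φ(t) a`. -/
def contractRightPair (Φ : Module.Dual F (H ⊗[F] H)) : H ⊗[F] (H ⊗[F] H) →ₗ[F] H :=
  (TensorProduct.rid F H).toLinearMap ∘ₗ LinearMap.lTensor H Φ

@[simp] theorem contractRightPair_tmul (Φ : Module.Dual F (H ⊗[F] H)) (a : H) (t : H ⊗[F] H) :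
    contractRightPair Φ (a ⊗ₜ t) = Φ t • a := by simp [contractRightPair]

/-- The linear map `b ⊗ c ↦ S²(c) ⊗ S(b)`. -/
def antipodeTwist (F H : Type*) [Field F] [Ring H] [HopfAlgebra F H] :
    H ⊗[F] H →ₗ[F] H ⊗[F] H :=
  TensorProduct.map (antipodeSq F H).toLinearMap (antipode F) ∘ₗ
    (TensorProduct.comm F H H).toLinearMap

theorem mul'_antipodeTwist_comul (y : H) :
    LinearMap.mul' F H (antipodeTwist F H (comul (R := F) y)) =
      algebraMap F H (counit (R := F) y) := by
  rw [← (ℛ F y).eq]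
  simp only [antipodeTwist, map_sum, LinearMap.comp_apply, LinearEquiv.coe_coe,
    TensorProduct.comm_tmul, TensorProduct.map_tmul, AlgHom.toLinearMap_apply, antipodeSq_apply,
    LinearMap.mul'_apply, ← antipode_mul_antidistrib]
  rw [← map_sum, sum_mul_antipode_eq_smul, map_smul, antipode_one, Algebra.smul_def, mul_one]

/-- The bilinear map `(y, Φ) ↦ y₁ Φ(S²(y₃) ⊗ S(y₂))`. -/
def twistedContraction (F H : Type*) [Field F] [Ring H] [HopfAlgebra F H] :
    H →ₗ[F] Module.Dual F (H ⊗[F] H) →ₗ[F] H :=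
  LinearMap.mk₂ F
    (fun y Φ => contractRightPair (Φ ∘ₗ antipodeTwist F H)
      (LinearMap.lTensor H comul (comul (R := F) y)))
    (by simp) (by simp)
    (fun y Φ Ψ => by
      generalize LinearMap.lTensor H (comul (R := F)) (comul (R := F) y) = t
      induction t with
      | zero => simp
      | tmul x y => simp [add_smul]
      | add x y hx hy => simp only [map_add, hx, hy]; abel)
    (fun c y Φ => by
      generalize LinearMap.lTensor H (comul (R := F)) (comul (R := F) y) = t
      induction t with
      | zero => simp
      | tmul x y => simp [mul_smul]
      | add x y hx hy => simp only [map_add, smul_add, hx, hy])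

theorem twistedContraction_mul' (y : H) (α : Module.Dual F H) :
    twistedContraction F H y (α ∘ₗ LinearMap.mul' F H) = α 1 • y := by
  change contractRightPair _ _ = _
  have h : ∀ t : H ⊗[F] H, contractRightPair ((α ∘ₗ LinearMap.mul' F H) ∘ₗ antipodeTwist F H)
      (LinearMap.lTensor H (comul (R := F)) t) = α 1 • contractRight counit t := by
    intro t
    induction t with
    | zero => simp
    | tmul a b =>
      simp [mul'_antipodeTwist_comul, Algebra.algebraMap_eq_smul_one, smul_smul, mul_comm]
    | add x y hx hy => simp only [map_add, smul_add, hx, hy]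
  rw [h, contractRight, LinearMap.comp_apply, lTensor_counit_comul]
  simp

theorem contractRight_comul_contractRight_comul (β γ : Module.Dual F H) (y : H) :
    contractRight (β ∘ₗ antipode F)
      (comul (R := F) (contractRight (γ ∘ₗ (antipodeSq F H).toLinearMap) (comul (R := F) y))) =
    twistedContraction F H y (TensorProduct.dualDistrib F H H (γ ⊗ₜ β)) := by
  change _ = contractRightPair _ _
  rw [← coassoc_apply]
  generalize comul (R := F) y = t
  induction t with
  | zero => simp
  | add x y hx hy => simp only [map_add, hx, hy]
  | tmul a b =>
    simp only [contractRight_tmul, map_smul, LinearMap.rTensor_tmul]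
    generalize comul (R := F) a = s
    induction s with
    | zero => simp
    | add x y hx hy => simp only [map_add, smul_add, TensorProduct.add_tmul, hx, hy]
    | tmul c d => simp [antipodeTwist, smul_smul]

/-- The map `α ↦ Λ₁ α(Λ₂)`. -/
def integralMap (F : Type*) {H : Type*} [Field F] [Ring H] [HopfAlgebra F H] (Λ : H) :
    Module.Dual F H →ₗ[F] H :=
  (contractRightₗ F H).flip (comul (R := F) Λ)

theorem integralMap_apply (Λ : H) (α : Module.Dual F H) :
    integralMap F Λ α = contractRight α (comul (R := F) Λ) := rfl

variable [FiniteDimensional F H]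

/-- The element `∑ᵢ xᵢ₁ b₁ αⁱ(S²(xᵢ₂ b₂))`; it is a left integral. -/
def integralOf (F : Type*) {H : Type*} [Field F] [Ring H] [HopfAlgebra F H]
    [FiniteDimensional F H] (b : H) : H :=
  ∑ i, contractRight ((Module.finBasis F H).coord i ∘ₗ (antipodeSq F H).toLinearMap)
    (comul (R := F) (Module.finBasis F H i * b))

theorem mul_integralOf (k b : H) :
    k * integralOf F b = counit (R := F) k • integralOf F b := by
  let r := ℛ F k
  let x := Module.finBasis F H
  let B : H → H → H →ₗ[F] Module.Dual F H →ₗ[F] H := fun u v =>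
    (((contractRightₗ F H).flip ∘ₗ comul) ∘ₗ LinearMap.mulRight F b).compl₂
      ((LinearMap.mulLeft F v ∘ₗ (antipodeSq F H).toLinearMap).lcomp F F)
  have hB : ∀ u v y α, B u v y α = contractRight (α ∘ₗ LinearMap.mulLeft F v ∘ₗ
      (antipodeSq F H).toLinearMap) (comul (R := F) (y * b)) := fun _ _ _ _ => rfl
  have h1 : ∀ i, k * contractRight (x.coord i ∘ₗ (antipodeSq F H).toLinearMap)
      (comul (R := F) (x i * b)) = ∑ j ∈ r.index,
        B (r.left j) (antipode F (r.right j)) (LinearMap.mulLeft F (r.left j) (x i)) (x.coord i) := by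
    intro i
    rw [← sum_contractRight_comul_mul F r]
    simp_rw [hB, LinearMap.mulLeft_apply, mul_assoc, Bialgebra.comul_mul]
  rw [integralOf, Finset.mul_sum]
  simp_rw [show Module.finBasis F H = x from rfl, h1]
  rw [Finset.sum_comm]
  simp_rw [sum_coord_comp x x, hB]
  rw [Finset.sum_comm, Finset.smul_sum]
  refine Finset.sum_congr rfl fun i _ => ?_
  have h2 : ∀ j, (x.coord i ∘ₗ LinearMap.mulLeft F (r.left j)) ∘ₗ
      LinearMap.mulLeft F (antipode F (r.right j)) ∘ₗ (antipodeSq F H).toLinearMap =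
      x.coord i ∘ₗ LinearMap.mulLeft F (r.left j * antipode F (r.right j)) ∘ₗ
        (antipodeSq F H).toLinearMap := by
    intro j; ext; simp
  simp_rw [h2, ← LinearMap.comp_assoc, contractRight_comp _ (antipodeSq F H).toLinearMap,
    contractRight_comp_mulLeft]
  rw [← map_sum, ← Finset.sum_mul, ← TensorProduct.tmul_sum, sum_mul_antipode_eq_smul,
    TensorProduct.tmul_smul, ← Algebra.TensorProduct.one_def, smul_mul_assoc, one_mul, map_smul]

theorem integralOf_eq_smul {Λ : H} (hΛ : IsNormalizedIntegral F Λ) (b : H) :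
    integralOf F b = counit (R := F) (integralOf F b) • Λ := by
  rw [← hΛ.mul_right, mul_integralOf, hΛ.counit_eq, one_smul]

/-- Reconstruction of an element from the integrals attached to its multiples. -/
theorem sum_contractRight_comul_integralOf (h : H) :
    ∑ j, contractRight ((Module.finBasis F H).coord j ∘ₗ antipode F)
      (comul (R := F) (integralOf F (Module.finBasis F H j * h))) = h := by
  let x := Module.finBasis F H
  have h1 : ∀ i j, TensorProduct.dualDistrib F H H (x.coord i ⊗ₜ x.coord j) =
      (x.tensorProduct x).coord (i, j) := by
    intro i j
    ext a b
    simp [mul_comm]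
  simp_rw [integralOf, map_sum, contractRight_comul_contractRight_comul,
    show Module.finBasis F H = x from rfl, h1]
  rw [Finset.sum_comm, ← Finset.sum_product', Finset.univ_product_univ]
  have h2 := sum_coord_comp (x.tensorProduct x) x (LinearMap.mul' F H)
    (twistedContraction F H ∘ₗ LinearMap.mulRight F h)
  simp only [LinearMap.comp_apply, LinearMap.mulRight_apply, twistedContraction_mul'] at h2
  have h3 : ∑ k, x.coord k 1 • (x k * h) = h := by
    simp_rw [← smul_mul_assoc, ← Finset.sum_mul]
    rw [show ∑ k, x.coord k 1 • x k = 1 from x.sum_repr 1, one_mul]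
  rw [h3] at h2
  refine Eq.trans (Finset.sum_congr rfl fun p _ => ?_) h2
  rw [Module.Basis.tensorProduct_apply', LinearMap.mul'_apply, mul_assoc]

variable {Λ : H}

/-- By `sum_contractRight_comul_integralOf` every `h` is a combination of images of integrals, and
all integrals are multiples of `Λ`. -/
theorem surjective_integralMap_comp (hΛ : IsNormalizedIntegral F Λ) :
    Function.Surjective fun α : Module.Dual F H => integralMap F Λ (α ∘ₗ antipode F) := by
  intro h
  refine ⟨∑ j, counit (R := F) (integralOf F (Module.finBasis F H j * h)) •
    (Module.finBasis F H).coord j, ?_⟩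
  conv_rhs => rw [← sum_contractRight_comul_integralOf (F := F) h]
  have h1 : ∀ β : Module.Dual F H, β ∘ₗ antipode F = (antipode F).dualMap β := fun _ => rfl
  simp only [h1, map_sum, map_smul]
  refine Finset.sum_congr rfl fun j _ => ?_
  rw [integralOf_eq_smul hΛ]
  simp only [← h1, map_smul, hΛ.counit_eq, integralMap_apply, smul_eq_mul, mul_one]

theorem bijective_integralMap (hΛ : IsNormalizedIntegral F Λ) :
    Function.Bijective (integralMap F Λ) := by
  have hs : Function.Surjective (integralMap F Λ) := fun h =>
    let ⟨α, hα⟩ := surjective_integralMap_comp hΛ h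
    ⟨_, hα⟩
  exact ⟨(LinearMap.injective_iff_surjective_of_finrank_eq_finrank
    (Subspace.dual_finrank_eq)).2 hs, hs⟩

/-- `α ↦ Λ₁ α(S(Λ₂))` is bijective, hence so is the transpose of `S`. -/
theorem bijective_antipode (hΛ : IsNormalizedIntegral F Λ) :
    Function.Bijective (antipode F (A := H)) := by
  have hs := surjective_integralMap_comp hΛ
  have hi : Function.Injective (integralMap F Λ ∘ₗ (antipode F (A := H)).dualMap) :=
    (LinearMap.injective_iff_surjective_of_finrank_eq_finrank
      (Subspace.dual_finrank_eq)).2 hs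
  have h1 : Function.Injective (antipode F (A := H)).dualMap :=
    Function.Injective.of_comp (f := integralMap F Λ) hi
  have h2 := LinearMap.dualMap_injective_iff.1 h1
  exact ⟨LinearMap.injective_iff_surjective.2 h2, h2⟩

end Bijectivity

/-! ### Cointegrals, Radford's formula and the trace formula -/

section Contractions

variable {F H : Type*} [Field F] [Ring H] [HopfAlgebra F H]

theorem contractLeft_tmul_one_mul (α : Module.Dual F H) (k : H) (t : H ⊗[F] H) :
    contractLeft α ((k ⊗ₜ 1) * t) = contractLeft (α ∘ₗ LinearMap.mulLeft F k) t := by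
  induction t with
  | zero => simp
  | tmul x y => simp
  | add x y hx hy => simp only [map_add, mul_add, hx, hy]

theorem contractLeft_mul_tmul_one (α : Module.Dual F H) (k : H) (t : H ⊗[F] H) :
    contractLeft α (t * (k ⊗ₜ 1)) = contractLeft (α ∘ₗ LinearMap.mulRight F k) t := by
  induction t with
  | zero => simp
  | tmul x y => simp
  | add x y hx hy => simp only [map_add, add_mul, hx, hy]

theorem contractLeft_one_tmul_mul (α : Module.Dual F H) (k : H) (t : H ⊗[F] H) :
    contractLeft α ((1 ⊗ₜ k) * t) = k * contractLeft α t := by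
  induction t with
  | zero => simp
  | tmul x y => simp
  | add x y hx hy => simp only [map_add, mul_add, hx, hy]

theorem contractLeft_mul_one_tmul (α : Module.Dual F H) (k : H) (t : H ⊗[F] H) :
    contractLeft α (t * (1 ⊗ₜ k)) = contractLeft α t * k := by
  induction t with
  | zero => simp
  | tmul x y => simp
  | add x y hx hy => simp only [map_add, add_mul, hx, hy]

theorem contractRight_mul_tmul_one (α : Module.Dual F H) (k : H) (t : H ⊗[F] H) :
    contractRight α (t * (k ⊗ₜ 1)) = contractRight α t * k := by
  induction t with
  | zero => simp
  | tmul x y => simp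
  | add x y hx hy => simp only [map_add, add_mul, hx, hy]

theorem contractRight_mul_one_tmul (α : Module.Dual F H) (k : H) (t : H ⊗[F] H) :
    contractRight α (t * (1 ⊗ₜ k)) = contractRight (α ∘ₗ LinearMap.mulRight F k) t := by
  induction t with
  | zero => simp
  | tmul x y => simp
  | add x y hx hy => simp only [map_add, add_mul, hx, hy]

theorem convMul_apply_eq_contractRight (α β : Module.Dual F H) (y : H) :
    (toConv α * toConv β) y = α (contractRight β (comul (R := F) y)) := by
  rw [(ℛ F y).convMul_apply, ← (ℛ F y).eq]
  simp [mul_comm]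

theorem convMul_apply_eq_contractLeft (α β : Module.Dual F H) (y : H) :
    (toConv α * toConv β) y = β (contractLeft α (comul (R := F) y)) := by
  rw [(ℛ F y).convMul_apply, ← (ℛ F y).eq]
  simp

variable (F) in
theorem eq_of_forall_dual {V : Type*} [AddCommGroup V] [Module F V] {x y : V}
    (h : ∀ α : Module.Dual F V, α x = α y) : x = y := by
  rw [← sub_eq_zero, ← Module.forall_dual_apply_eq_zero_iff F]
  intro α
  rw [map_sub, h, sub_self]

theorem contractRight_counit_comul (a : H) : contractRight counit (comul (R := F) a) = a := by
  rw [contractRight, LinearMap.comp_apply, lTensor_counit_comul]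
  simp

theorem contractRight_convMul (α β : Module.Dual F H) (y : H) :
    contractRight (toConv α * toConv β).ofConv (comul (R := F) y) =
      contractRight α (comul (R := F) (contractRight β (comul (R := F) y))) := by
  refine eq_of_forall_dual F fun γ => ?_
  have h1 := convMul_apply_eq_contractRight γ (toConv α * toConv β).ofConv y
  have h2 := convMul_apply_eq_contractRight (toConv γ * toConv α).ofConv β y
  rw [← h1, ← convMul_apply_eq_contractRight]
  exact (congr($(mul_assoc (toConv γ) (toConv α) (toConv β)) y)).symm.trans h2

theorem tensor_ext_dual [FiniteDimensional F H] {s t : H ⊗[F] H}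
    (h : ∀ α β : Module.Dual F H,
      TensorProduct.dualDistrib F H H (α ⊗ₜ β) s = TensorProduct.dualDistrib F H H (α ⊗ₜ β) t) :
    s = t := by
  refine eq_of_forall_dual F fun Φ => ?_
  obtain ⟨p, rfl⟩ := (TensorProduct.dualDistribEquiv F H H).surjective Φ
  change TensorProduct.dualDistrib F H H p s = TensorProduct.dualDistrib F H H p t
  induction p with
  | zero => simp
  | tmul α β => exact h α β
  | add x y hx hy => simp only [map_add, LinearMap.add_apply, hx, hy]

theorem dualDistrib_comul (α β : Module.Dual F H) (y : H) :
    TensorProduct.dualDistrib F H H (α ⊗ₜ β) (comul (R := F) y) = (toConv α * toConv β) y := by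
  rw [(ℛ F y).convMul_apply, ← (ℛ F y).eq]
  simp

end Contractions

section Cointegral

variable {F H : Type*} [Field F] [Ring H] [HopfAlgebra F H] {Λ : H}

theorem IsNormalizedIntegral.one_tmul_mul_comul (hΛ : IsNormalizedIntegral F Λ) (a : H) :
    ((1 : H) ⊗ₜ[F] a) * comul (R := F) Λ = (antipode F a ⊗ₜ 1) * comul (R := F) Λ := by
  rw [← sum_antipode_tmul_one_mul_comul (ℛ F a), Finset.sum_mul]
  simp_rw [mul_assoc, ← Bialgebra.comul_mul, hΛ.mul_left, map_smul, mul_smul_comm,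
    ← smul_mul_assoc, TensorProduct.smul_tmul', ← map_smul]
  rw [← Finset.sum_mul, ← TensorProduct.sum_tmul, ← map_sum]
  congr 3
  have h := contractRight_counit_comul (F := F) a
  rw [← (ℛ F a).eq] at h
  simpa using h

theorem IsNormalizedIntegral.comul_mul_tmul_one (hΛ : IsNormalizedIntegral F Λ) (a : H) :
    comul (R := F) Λ * (a ⊗ₜ[F] (1 : H)) = comul (R := F) Λ * (1 ⊗ₜ antipode F a) := by
  rw [← sum_comul_mul_one_tmul_antipode (ℛ F a), Finset.mul_sum]
  simp_rw [← mul_assoc, ← Bialgebra.comul_mul, hΛ.mul_right, map_smul, smul_mul_assoc,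
    ← mul_smul_comm, ← TensorProduct.tmul_smul, ← map_smul]
  rw [← Finset.mul_sum, ← TensorProduct.tmul_sum, ← map_sum, sum_counit_smul]

variable {l : Module.Dual F H}

theorem cointegral_apply (hl : integralMap F Λ l = 1) : l Λ = 1 := by
  have h1 := convMul_apply_eq_contractRight (F := F) counit l Λ
  rw [← integralMap_apply, hl, Bialgebra.counit_one] at h1
  rw [← h1]
  exact (congr($(one_mul (toConv l)) Λ)).symm

/-- The distinguished grouplike element `λ(Λ₁) Λ₂` of `H`. -/
def distinguished (Λ : H) (l : Module.Dual F H) : H := contractLeft l (comul (R := F) Λ)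

theorem distinguished_def (Λ : H) (l : Module.Dual F H) :
    distinguished Λ l = contractLeft l (comul (R := F) Λ) := rfl

variable [FiniteDimensional F H]

/-- The functional `λ` with `Λ₁ λ(Λ₂) = 1` is a left integral of `H^*`. -/
theorem IsNormalizedIntegral.cointegral_convMul (hΛ : IsNormalizedIntegral F Λ)
    (hl : integralMap F Λ l = 1) (α : Module.Dual F H) :
    toConv α * toConv l = α 1 • toConv l := by
  apply WithConv.ofConv_injective
  apply (bijective_integralMap hΛ).1
  rw [integralMap_apply, contractRight_convMul, ← integralMap_apply Λ l, hl]
  change _ = integralMap F Λ (α 1 • l)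
  rw [map_smul, hl]
  simp [Algebra.TensorProduct.one_def]

theorem IsNormalizedIntegral.cointegral_unique (hΛ : IsNormalizedIntegral F Λ)
    (hl : integralMap F Λ l = 1) {m : Module.Dual F H}
    (hm : ∀ α : Module.Dual F H, toConv α * toConv m = α 1 • toConv m) : m = m Λ • l := by
  apply (bijective_integralMap hΛ).1
  rw [map_smul, hl]
  refine eq_of_forall_dual F fun α => ?_
  rw [integralMap_apply, ← convMul_apply_eq_contractRight, hm]
  change α 1 * m Λ = _
  simp [mul_comm]

/-- The cointegral is a Frobenius form with Nakayama automorphism `S²`. -/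
theorem IsNormalizedIntegral.cointegral_mul (hΛ : IsNormalizedIntegral F Λ)
    (hl : integralMap F Λ l = 1) (a b : H) :
    l (a * b) = l (b * antipode F (antipode F a)) := by
  have h1 : integralMap F Λ (l ∘ₗ LinearMap.mulLeft F a) = antipode F a := by
    rw [integralMap_apply, contractRight_comp_mulLeft, hΛ.one_tmul_mul_comul,
      contractRight_tmul_one_mul, ← integralMap_apply, hl, mul_one]
  have h2 : integralMap F Λ (l ∘ₗ LinearMap.mulRight F (antipode F (antipode F a))) =
      antipode F a := by
    rw [integralMap_apply, ← contractRight_mul_one_tmul, ← hΛ.comul_mul_tmul_one,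
      contractRight_mul_tmul_one, ← integralMap_apply, hl, one_mul]
  exact congr($((bijective_integralMap hΛ).1 (h1.trans h2.symm)) b)

/-- The cointegral is nondegenerate. -/
theorem IsNormalizedIntegral.eq_zero_of_cointegral_mul (hΛ : IsNormalizedIntegral F Λ)
    (hl : integralMap F Λ l = 1) {a : H} (ha : ∀ b, l (a * b) = 0) : a = 0 := by
  have h1 : integralMap F Λ (l ∘ₗ LinearMap.mulLeft F a) = antipode F a := by
    rw [integralMap_apply, contractRight_comp_mulLeft, hΛ.one_tmul_mul_comul,
      contractRight_tmul_one_mul, ← integralMap_apply, hl, mul_one]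
  have h2 : l ∘ₗ LinearMap.mulLeft F a = 0 := by ext b; simpa using ha b
  rw [h2, map_zero] at h1
  exact (bijective_antipode hΛ).1 (by rw [← h1, map_zero])

/-- Uniqueness of left integrals makes `λ α` a multiple of `λ`; the distinguished grouplike element
records the factor. -/
theorem IsNormalizedIntegral.convMul_cointegral (hΛ : IsNormalizedIntegral F Λ)
    (hl : integralMap F Λ l = 1) (α : Module.Dual F H) :
    toConv l * toConv α = α (distinguished Λ l) • toConv l := by
  have h := hΛ.cointegral_unique hl (m := (toConv l * toConv α).ofConv) (fun β => by
    change toConv β * (toConv l * toConv α) = β 1 • (toConv l * toConv α)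
    rw [← mul_assoc, hΛ.cointegral_convMul hl, smul_mul_assoc])
  have h2 : (toConv l * toConv α).ofConv Λ = α (distinguished Λ l) :=
    convMul_apply_eq_contractLeft l α Λ
  rw [h2] at h
  exact WithConv.ofConv_injective h

theorem IsNormalizedIntegral.isGroupLikeElem_distinguished (hΛ : IsNormalizedIntegral F Λ)
    (hl : integralMap F Λ l = 1) : IsGroupLikeElem F (distinguished Λ l) where
  counit_eq_one := by
    have h := congr($(hΛ.convMul_cointegral hl counit) Λ)
    have h2 : (toConv l * toConv (counit : Module.Dual F H)) = toConv l := mul_one (toConv l)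
    rw [h2] at h
    change l Λ = counit (R := F) (distinguished Λ l) * l Λ at h
    rw [cointegral_apply hl, mul_one] at h
    exact h.symm
  comul_eq_tmul_self := by
    refine tensor_ext_dual fun α β => ?_
    rw [dualDistrib_comul, TensorProduct.dualDistrib_apply]
    have h := hΛ.convMul_cointegral hl (toConv α * toConv β).ofConv
    have h2 : toConv l * toConv (toConv α * toConv β).ofConv =
        α (distinguished Λ l) • (β (distinguished Λ l) • toConv l) := by
      rw [← hΛ.convMul_cointegral hl β, ← smul_mul_assoc, ← hΛ.convMul_cointegral hl α]
      exact (mul_assoc _ _ _).symm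
    rw [h2] at h
    have h3 := congr($h Λ)
    change α _ * (β _ * l Λ) = (toConv α * toConv β) _ * l Λ at h3
    rw [cointegral_apply hl] at h3
    simpa using h3.symm

/-- **Radford's formula** for the fourth power of the antipode, in the unimodular case. -/
theorem IsNormalizedIntegral.mul_distinguished (hΛ : IsNormalizedIntegral F Λ)
    (hl : integralMap F Λ l = 1) (a : H) :
    a * distinguished Λ l =
      distinguished Λ l * antipode F (antipode F (antipode F (antipode F a))) := by
  have h : l ∘ₗ LinearMap.mulLeft F (antipode F a) =
      l ∘ₗ LinearMap.mulRight F (antipode F (antipode F (antipode F a))) := by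
    ext b
    exact hΛ.cointegral_mul hl _ _
  rw [distinguished_def, ← contractLeft_one_tmul_mul, hΛ.one_tmul_mul_comul,
    contractLeft_tmul_one_mul, h, ← contractLeft_mul_tmul_one, hΛ.comul_mul_tmul_one,
    contractLeft_mul_one_tmul]

/-- Trace formula: the cointegral is `h ↦ Tr(x ↦ h S²(x))`. -/
theorem IsNormalizedIntegral.trace_mulLeft_comp_antipode (hΛ : IsNormalizedIntegral F Λ)
    (hl : integralMap F Λ l = 1) (h : H) :
    LinearMap.trace F H (LinearMap.mulLeft F h ∘ₗ antipode F ∘ₗ antipode F) = l h := by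
  let r := ℛ F Λ
  have h1 : LinearMap.mulLeft F h ∘ₗ antipode F ∘ₗ antipode F =
      ∑ i ∈ r.index, (l ∘ₗ LinearMap.mulRight F (r.right i)).smulRight
        (h * antipode F (r.left i)) := by
    ext a
    have : antipode F a = contractRight (l ∘ₗ LinearMap.mulLeft F a) (comul (R := F) Λ) := by
      rw [contractRight_comp_mulLeft, hΛ.one_tmul_mul_comul,
        contractRight_tmul_one_mul, ← integralMap_apply, hl, mul_one]
    rw [LinearMap.comp_apply, LinearMap.comp_apply, this, ← r.eq]
    simp
  rw [h1, map_sum]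
  simp_rw [LinearMap.trace_smulRight]
  simp only [LinearMap.comp_apply, LinearMap.mulRight_apply, mul_assoc]
  rw [← map_sum, ← Finset.mul_sum, sum_antipode_mul_eq_smul, hΛ.counit_eq, one_smul, mul_one]

/-- If `Tr(S²) ≠ 0`, then `S⁴ = id`. -/
theorem IsNormalizedIntegral.antipode_pow_four (hΛ : IsNormalizedIntegral F Λ)
    (hT : LinearMap.trace F H (antipode F ∘ₗ antipode F) ≠ 0) (a : H) :
    antipode F (antipode F (antipode F (antipode F a))) = a := by
  obtain ⟨l, hl⟩ := (bijective_integralMap hΛ).2 1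
  have hT2 : l 1 ≠ 0 := by
    rw [← hΛ.trace_mulLeft_comp_antipode hl]
    rwa [LinearMap.mulLeft_one, LinearMap.id_comp]
  have hg : distinguished Λ l = 1 := by
    refine eq_of_forall_dual F fun α => ?_
    have h := congr($(hΛ.convMul_cointegral hl α) 1)
    rw [convMul_apply_eq_contractLeft, Bialgebra.comul_one, Algebra.TensorProduct.one_def,
      contractLeft_tmul] at h
    change α (l 1 • 1) = α _ * l 1 at h
    rw [map_smul, smul_eq_mul, mul_comm] at h
    exact (mul_right_cancel₀ hT2 h).symm
  have h := hΛ.mul_distinguished hl a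
  rwa [hg, one_mul, mul_one, eq_comm] at h

end Cointegral

/-! ### The regular character and the trace of the square of the antipode -/

section RegularCharacter

variable {F H : Type*} [Field F] [Ring H] [HopfAlgebra F H]

/-- The operator `y ↦ y₁ α(y₂)`. -/
def rightRegular (α : Module.Dual F H) : H →ₗ[F] H := contractRight α ∘ₗ comul

theorem rightRegular_apply (α : Module.Dual F H) (y : H) :
    rightRegular α y = contractRight α (comul (R := F) y) := rfl

/-- The operator `y ⊗ z ↦ y₁ ⊗ z₁ α(y₂ z₂)` on `H ⊗ H`. -/
def diagonalRegular (α : Module.Dual F H) : H ⊗[F] H →ₗ[F] H ⊗[F] H :=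
  (TensorProduct.rid F (H ⊗[F] H)).toLinearMap ∘ₗ
    TensorProduct.map LinearMap.id (α ∘ₗ LinearMap.mul' F H) ∘ₗ
    (TensorProduct.tensorTensorTensorComm F H H H H).toLinearMap ∘ₗ
    TensorProduct.map comul comul

/-- The map `y ⊗ z ↦ y₁ ⊗ y₂ z`, which intertwines `diagonalRegular` with the operator that acts on
the second factor only. -/
def untwist (F H : Type*) [Field F] [Ring H] [HopfAlgebra F H] : H ⊗[F] H →ₗ[F] H ⊗[F] H :=
  LinearMap.lTensor H (LinearMap.mul' F H) ∘ₗ (TensorProduct.assoc F H H H).toLinearMap ∘ₗ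
    LinearMap.rTensor H comul

theorem untwist_tmul (y z : H) : untwist F H (y ⊗ₜ z) = comul (R := F) y * (1 ⊗ₜ z) := by
  simp only [untwist, LinearMap.comp_apply, LinearMap.rTensor_tmul, LinearEquiv.coe_coe]
  generalize comul (R := F) y = t
  induction t with
  | zero => simp
  | tmul a b => simp
  | add a b ha hb => simp only [map_add, TensorProduct.add_tmul, add_mul, ha, hb]

/-- Absorption property of the regular comodule: `diagonalRegular` is isomorphic to a multiple of
`rightRegular`. -/
theorem lTensor_rightRegular_comp_untwist (α : Module.Dual F H) :
    LinearMap.lTensor H (rightRegular α) ∘ₗ untwist F H = untwist F H ∘ₗ diagonalRegular α := by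
  ext y z
  simp only [TensorProduct.AlgebraTensorModule.curry_apply, LinearMap.restrictScalars_self,
    TensorProduct.curry_apply, LinearMap.comp_apply]
  let Ψ : H ⊗[F] (H ⊗[F] H) →ₗ[F] H ⊗[F] H :=
    LinearMap.lTensor H (contractRight α ∘ₗ LinearMap.mulRight F (comul (R := F) z))
  have h1 : LinearMap.lTensor H (rightRegular α) (untwist F H (y ⊗ₜ z)) =
      Ψ (LinearMap.lTensor H comul (comul (R := F) y)) := by
    rw [untwist_tmul]
    generalize comul (R := F) y = t
    induction t with
    | zero => simp
    | tmul a b => simp [Ψ, rightRegular]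
    | add a b ha hb => simp only [map_add, add_mul, ha, hb]
  rw [h1, ← coassoc_apply]
  have h2 : diagonalRegular α (y ⊗ₜ z) = (TensorProduct.rid F (H ⊗[F] H))
    (TensorProduct.map LinearMap.id (α ∘ₗ LinearMap.mul' F H)
      (TensorProduct.tensorTensorTensorComm F H H H H
        (comul (R := F) y ⊗ₜ comul (R := F) z))) := rfl
  rw [h2]
  simp only [Ψ]
  generalize comul (R := F) z = u
  generalize comul (R := F) y = t
  induction t with
  | zero => simp
  | add a b ha hb => simp only [map_add, TensorProduct.add_tmul, ha, hb]
  | tmul a b =>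
    induction u with
    | zero => simp
    | add c d hc hd =>
      simp only [map_add, TensorProduct.tmul_add, ← hc, ← hd, LinearMap.rTensor_tmul]
      generalize comul (R := F) a = s
      induction s with
      | zero => simp
      | tmul p q => simp [mul_add, TensorProduct.tmul_add]
      | add p q hp hq =>
        simp only [map_add, TensorProduct.add_tmul, hp, hq]
        abel
    | tmul c d =>
      simp only [LinearMap.rTensor_tmul, TensorProduct.tensorTensorTensorComm_tmul,
        TensorProduct.map_tmul, TensorProduct.rid_tmul, LinearMap.id_apply, map_smul,
        untwist_tmul]
      generalize comul (R := F) a = s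
      induction s with
      | zero => simp
      | tmul p q => simp
      | add p q hp hq => simp only [map_add, TensorProduct.add_tmul, add_mul, smul_add, hp, hq]

theorem exists_untwist_leftInverse :
    ∃ v : H ⊗[F] H →ₗ[F] H ⊗[F] H, v ∘ₗ untwist F H = LinearMap.id := by
  refine ⟨LinearMap.lTensor H (LinearMap.mul' F H ∘ₗ LinearMap.rTensor H (antipode F)) ∘ₗ
    (TensorProduct.assoc F H H H).toLinearMap ∘ₗ LinearMap.rTensor H comul, ?_⟩
  ext y z
  simp only [TensorProduct.AlgebraTensorModule.curry_apply, LinearMap.restrictScalars_self,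
    TensorProduct.curry_apply, LinearMap.comp_apply, LinearMap.id_apply, LinearEquiv.coe_coe]
  let Ψ : H ⊗[F] (H ⊗[F] H) →ₗ[F] H ⊗[F] H :=
    LinearMap.lTensor H (LinearMap.mulRight F z ∘ₗ LinearMap.mul' F H ∘ₗ
      LinearMap.rTensor H (antipode F))
  have h1 : (LinearMap.lTensor H (LinearMap.mul' F H ∘ₗ LinearMap.rTensor H (antipode F)))
      (TensorProduct.assoc F H H H (LinearMap.rTensor H comul (untwist F H (y ⊗ₜ z)))) =
      Ψ (LinearMap.lTensor H comul (comul (R := F) y)) := by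
    rw [untwist_tmul, ← coassoc_apply]
    generalize comul (R := F) y = t
    induction t with
    | zero => simp
    | add a b ha hb => simp only [map_add, add_mul, ha, hb]
    | tmul a b =>
      simp only [Algebra.TensorProduct.tmul_mul_tmul, mul_one, LinearMap.rTensor_tmul]
      generalize comul (R := F) a = s
      induction s with
      | zero => simp
      | tmul p q => simp [Ψ, mul_assoc]
      | add p q hp hq => simp only [map_add, TensorProduct.add_tmul, hp, hq]
  rw [h1]
  have h2 : ∀ t : H ⊗[F] H, Ψ (LinearMap.lTensor H comul t) =
      contractRight counit t ⊗ₜ z := by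
    intro t
    induction t with
    | zero => simp
    | add a b ha hb => simp only [map_add, TensorProduct.add_tmul, ha, hb]
    | tmul a b => simp [Ψ, Algebra.algebraMap_eq_smul_one, TensorProduct.smul_tmul]
  rw [h2, contractRight_counit_comul]

variable [FiniteDimensional F H]

/-- The trace on the tensor square of the regular comodule is `dim H` times the trace on the regular
comodule. -/
theorem trace_diagonalRegular (α : Module.Dual F H) :
    LinearMap.trace F (H ⊗[F] H) (diagonalRegular α) =
      Module.finrank F H * LinearMap.trace F H (rightRegular α) := by
  obtain ⟨v, hv⟩ := exists_untwist_leftInverse (F := F) (H := H)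
  have hv' : untwist F H ∘ₗ v = LinearMap.id :=
    mul_eq_one_comm.1 (show v * untwist F H = 1 from hv)
  have h : diagonalRegular α = v ∘ₗ (LinearMap.lTensor H (rightRegular α) ∘ₗ untwist F H) := by
    rw [lTensor_rightRegular_comp_untwist, ← LinearMap.comp_assoc, hv, LinearMap.id_comp]
  rw [h, LinearMap.trace_comp_comm', LinearMap.comp_assoc, hv', LinearMap.comp_id,
    LinearMap.lTensor, LinearMap.trace_tensorProduct', LinearMap.trace_id]

/-- The character `∑ᵢ αⁱ(xᵢ₁) xᵢ₂` of the regular comodule. -/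
def regularCharacter (F H : Type*) [Field F] [Ring H] [HopfAlgebra F H] [FiniteDimensional F H] :
    H :=
  ∑ i, contractLeft ((Module.finBasis F H).coord i) (comul (R := F) (Module.finBasis F H i))

theorem trace_eq_sum_coord {V ι : Type*} [AddCommGroup V] [Module F V] [Fintype ι]
    (b : Module.Basis ι F V) (f : V →ₗ[F] V) :
    LinearMap.trace F V f = ∑ i, b.coord i (f (b i)) := by
  classical
  rw [LinearMap.trace_eq_matrix_trace F b, Matrix.trace]
  simp [LinearMap.toMatrix_apply]

/-- The regular character represents the trace of the regular coaction. -/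
theorem apply_regularCharacter (α : Module.Dual F H) :
    α (regularCharacter F H) = LinearMap.trace F H (rightRegular α) := by
  rw [trace_eq_sum_coord (Module.finBasis F H), regularCharacter, map_sum]
  refine Finset.sum_congr rfl fun i _ => ?_
  rw [rightRegular_apply, ← convMul_apply_eq_contractLeft, convMul_apply_eq_contractRight]

/-- Up to the factor `dim H`, the regular character is an idempotent. -/
theorem regularCharacter_mul_self :
    regularCharacter F H * regularCharacter F H =
      (Module.finrank F H : F) • regularCharacter F H := by
  refine eq_of_forall_dual F fun α => ?_
  rw [map_smul, apply_regularCharacter, smul_eq_mul, ← trace_diagonalRegular]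
  let x := Module.finBasis F H
  rw [trace_eq_sum_coord (x.tensorProduct x), ← Finset.univ_product_univ, Finset.sum_product,
    regularCharacter, Finset.sum_mul_sum, map_sum]
  simp_rw [map_sum]
  refine Finset.sum_congr rfl fun i _ => Finset.sum_congr rfl fun j _ => ?_
  have h : (x.tensorProduct x).coord (i, j) =
      TensorProduct.dualDistrib F H H (x.coord i ⊗ₜ x.coord j) := by
    ext a b
    simp [mul_comm]
  rw [Module.Basis.tensorProduct_apply, h]
  simp only [diagonalRegular, LinearMap.comp_apply, TensorProduct.map_tmul, LinearEquiv.coe_coe]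
  change α (contractLeft (x.coord i) (comul (R := F) (x i)) *
    contractLeft (x.coord j) (comul (R := F) (x j))) = _
  generalize comul (R := F) (x i) = s
  generalize comul (R := F) (x j) = t
  induction s with
  | zero => simp
  | add a b ha hb => simp only [map_add, TensorProduct.add_tmul, add_mul, ha, hb]
  | tmul a b =>
    induction t with
    | zero => simp
    | add c d hc hd => simp only [map_add, TensorProduct.tmul_add, mul_add, hc, hd]
    | tmul c d => simp; ring

theorem antipodeSq_regularCharacter
    (h4 : ∀ a : H, antipode F (antipode F (antipode F (antipode F a))) = a) :
    antipodeSq F H (regularCharacter F H) = regularCharacter F H := by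
  refine eq_of_forall_dual F fun α => ?_
  let σ := (antipodeSq F H).toLinearMap
  have hσ : σ ∘ₗ σ = LinearMap.id := by ext a; exact h4 a
  have h1 : rightRegular α ∘ₗ σ = σ ∘ₗ rightRegular (α ∘ₗ σ) := by
    ext a
    simp only [LinearMap.comp_apply, rightRegular_apply, σ, AlgHom.toLinearMap_apply,
      comul_antipodeSq]
    generalize comul (R := F) a = t
    induction t with
    | zero => simp
    | add a b ha hb => simp only [map_add, ha, hb]
    | tmul a b => simp
  have h2 : rightRegular (α ∘ₗ σ) = σ ∘ₗ (rightRegular α ∘ₗ σ) := by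
    rw [h1, ← LinearMap.comp_assoc, hσ, LinearMap.id_comp]
  have h3 := apply_regularCharacter (α ∘ₗ σ)
  rw [h2, LinearMap.trace_comp_comm', LinearMap.comp_assoc, hσ, LinearMap.comp_id,
    ← apply_regularCharacter] at h3
  exact h3

end RegularCharacter

section Involution

variable {F V : Type*} [Field F] [AddCommGroup V] [Module F V] [FiniteDimensional F V]

theorem trace_eq_finrank_range {p : V →ₗ[F] V} (hp : p ∘ₗ p = p) :
    LinearMap.trace F V p = (Module.finrank F (LinearMap.range p) : F) :=
  (LinearMap.IsIdempotentElem.isProj_range p hp).trace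

/-- A commuting pair of an idempotent `e` and an involution `s`: the trace of `e s` is an integer,
and the trace of `s` determines whether `s = 1`. -/
theorem eq_one_of_trace_eq_mul_trace [CharZero F] {s e : V →ₗ[F] V} (hs : s ∘ₗ s = LinearMap.id)
    (he : e ∘ₗ e = e) (hse : s ∘ₗ e = e ∘ₗ s) {v : V} (hv : v ≠ 0) (hsv : s v = v)
    (h0 : LinearMap.trace F V s ≠ 0)
    (htr : LinearMap.trace F V s = Module.finrank F V * LinearMap.trace F V (e ∘ₗ s)) :
    s = LinearMap.id := by
  let p : V →ₗ[F] V := (2⁻¹ : F) • (LinearMap.id + s)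
  have h2 : (2 : F) ≠ 0 := two_ne_zero
  have hsp : s = (2 : F) • p - LinearMap.id := by
    simp only [p, smul_smul, mul_inv_cancel₀ h2, one_smul]
    abel
  have hss : ∀ x, s (s x) = x := fun x => congr($hs x)
  have hee : ∀ x, e (e x) = e x := fun x => congr($he x)
  have hses : ∀ x, s (e x) = e (s x) := fun x => congr($hse x)
  have hp : p ∘ₗ p = p := by
    ext x
    simp only [p, LinearMap.comp_apply, LinearMap.smul_apply, LinearMap.add_apply,
      LinearMap.id_apply, map_smul, map_add, hss]
    rw [add_comm (s x) x, ← smul_add, ← two_smul F (x + s x), smul_smul _ _ (x + s x),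
      inv_mul_cancel₀ h2, one_smul]
  have hep : (e ∘ₗ p) ∘ₗ (e ∘ₗ p) = e ∘ₗ p := by
    have hpe : ∀ x, p (e x) = e (p x) := fun x => by simp [p, hses]
    ext x
    simp only [LinearMap.comp_apply]
    rw [hpe, hee]
    exact congr(e ($hp x))
  have t1 : LinearMap.trace F V s =
      2 * (Module.finrank F (LinearMap.range p) : F) - Module.finrank F V := by
    conv_lhs => rw [hsp]
    rw [map_sub, map_smul, LinearMap.trace_id, trace_eq_finrank_range hp, smul_eq_mul]
  have t2 : LinearMap.trace F V (e ∘ₗ s) =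
      2 * (Module.finrank F (LinearMap.range (e ∘ₗ p)) : F) -
        Module.finrank F (LinearMap.range e) := by
    conv_lhs => rw [hsp]
    rw [LinearMap.comp_sub, LinearMap.comp_smul, LinearMap.comp_id, map_sub, map_smul,
      trace_eq_finrank_range he, trace_eq_finrank_range hep, smul_eq_mul]
  set c := Module.finrank F (LinearMap.range p)
  set d := Module.finrank F V
  have hcd : c ≤ d := Submodule.finrank_le _
  have hpv : p v = v := by
    simp only [p, LinearMap.smul_apply, LinearMap.add_apply, LinearMap.id_apply, hsv]
    rw [← two_smul F v, smul_smul, inv_mul_cancel₀ h2, one_smul]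
  have hc : 0 < c := by
    rw [Module.finrank_pos_iff_exists_ne_zero]
    exact ⟨⟨v, ⟨v, hpv⟩⟩, fun h => hv (congrArg Subtype.val h)⟩
  obtain ⟨k, hk⟩ : ∃ k : ℤ, LinearMap.trace F V (e ∘ₗ s) = k :=
    ⟨2 * Module.finrank F (LinearMap.range (e ∘ₗ p)) - Module.finrank F (LinearMap.range e), by
      rw [t2]; push_cast; ring⟩
  have hZ : (2 * c - d : ℤ) = d * k := by
    have : ((2 * c - d : ℤ) : F) = ((d * k : ℤ) : F) := by
      push_cast
      rw [← t1, htr, hk]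
    exact_mod_cast this
  have hk0 : k ≠ 0 := by
    rintro rfl
    rw [htr, hk] at h0
    simp at h0
  have hkpos : 0 < k := by
    by_contra hneg
    have : k ≤ -1 := by omega
    have : (d : ℤ) * k ≤ d * (-1) := by gcongr
    omega
  have hcd' : c = d := by
    have : (d : ℤ) * 1 ≤ d * k := by gcongr; omega
    omega
  have hrange : LinearMap.range p = ⊤ := Submodule.eq_top_of_finrank_eq hcd'
  have hp1 : p = LinearMap.id := by
    ext x
    obtain ⟨y, rfl⟩ : x ∈ LinearMap.range p := hrange ▸ Submodule.mem_top
    exact congr($hp y)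
  rw [hsp, hp1, two_smul]
  abel

end Involution

section AntipodeInvolutive

variable {F H : Type*} [Field F] [CharZero F] [Ring H] [HopfAlgebra F H] [FiniteDimensional F H]

/-- If `Tr(S²) ≠ 0`, then the antipode of a semisimple Hopf algebra is an involution. -/
theorem IsNormalizedIntegral.antipode_antipode_of_trace_ne_zero {Λ : H}
    (hΛ : IsNormalizedIntegral F Λ)
    (hT : LinearMap.trace F H (antipode F ∘ₗ antipode F) ≠ 0) (a : H) :
    antipode F (antipode F a) = a := by
  have h4 := hΛ.antipode_pow_four hT
  obtain ⟨l, hl⟩ := (bijective_integralMap hΛ).2 1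
  have hnt : Nontrivial H := by
    refine ⟨⟨1, 0, fun h => ?_⟩⟩
    have := congr(counit (R := F) $h)
    simp at this
  let d : F := Module.finrank F H
  have hd : d ≠ 0 := Nat.cast_ne_zero.2 Module.finrank_pos.ne'
  let x := regularCharacter F H
  let e : H := d⁻¹ • x
  have hee : e * e = e := by
    simp only [e, x, smul_mul_smul_comm, regularCharacter_mul_self, smul_smul]
    congr 1
    field_simp
    rfl
  have hSe : antipode F (antipode F e) = e := by
    change antipodeSq F H (d⁻¹ • x) = d⁻¹ • x
    rw [map_smul, antipodeSq_regularCharacter h4]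
  have hlx : l x = l 1 := by
    have h1 : rightRegular l = l.smulRight (1 : H) := by
      ext y
      refine eq_of_forall_dual F fun α => ?_
      rw [rightRegular_apply, ← convMul_apply_eq_contractRight, hΛ.cointegral_convMul hl]
      change α 1 * l y = α (l y • 1)
      simp [mul_comm]
    rw [apply_regularCharacter, h1, LinearMap.trace_smulRight]
  have hT1 : LinearMap.trace F H (antipode F ∘ₗ antipode F) = l 1 := by
    rw [← hΛ.trace_mulLeft_comp_antipode hl, LinearMap.mulLeft_one, LinearMap.id_comp]
  have key := eq_one_of_trace_eq_mul_trace (F := F) (V := H) (s := antipode F ∘ₗ antipode F)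
    (e := LinearMap.mulLeft F e) (v := 1) (by ext a; exact h4 a)
    (by ext a; simp [← mul_assoc, hee])
    (by ext a; simp [antipode_mul_antidistrib, hSe]) one_ne_zero (by simp) hT (by
      rw [hΛ.trace_mulLeft_comp_antipode hl, hT1, map_smul, smul_eq_mul, hlx, ← mul_assoc]
      change _ = d * d⁻¹ * _
      rw [mul_inv_cancel₀ hd, one_mul])
  exact congr($key a)

end AntipodeInvolutive

/-! ### Traces of operators of finite order and of matrices -/

section FiniteOrder

/-- A nontrivial root of unity has vanishing power sum. -/
theorem geom_sum_of_pow_eq_one {K : Type*} [Field K] {m : ℕ} {a : K} (ha : a ^ m = 1) (h1 : a ≠ 1) :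
    ∑ j ∈ Finset.range m, a ^ j = 0 := by
  have := mul_geom_sum a m
  rw [ha, sub_self] at this
  exact (mul_eq_zero.1 this).resolve_left (sub_ne_zero.2 h1)

variable {K V : Type*} [Field K] [CharZero K] [AddCommGroup V] [Module K V]
  [FiniteDimensional K V]

/-- The eigenvalues of an operator of order dividing `m` are powers of a primitive `m`th root of
unity, and those of its inverse are their inverses. -/
theorem exists_trace_eq_sum_of_pow_eq_one {m : ℕ} {ζ : K} (hζ : IsPrimitiveRoot ζ m) (hm : 0 < m)
    {u v : Module.End K V} (huv : u * v = 1) (hu : u ^ m = 1) :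
    ∃ N : ℕ → ℕ, LinearMap.trace K V u = ∑ j ∈ Finset.range m, (N j : K) * ζ ^ j ∧
      LinearMap.trace K V v = ∑ j ∈ Finset.range m, (N j : K) * (ζ ^ j)⁻¹ := by
  have hm' : (m : K) ≠ 0 := Nat.cast_ne_zero.2 hm.ne'
  have hζ0 : ζ ≠ 0 := hζ.ne_zero hm.ne'
  let p : ℕ → Module.End K V := fun j =>
    (m : K)⁻¹ • ∑ k ∈ Finset.range m, ((ζ ^ j)⁻¹ ^ k) • u ^ k
  have hpu : ∀ j, p j * u = ζ ^ j • p j := by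
    intro j
    have hz : (ζ ^ j)⁻¹ ^ m = 1 := by
      rw [inv_pow, ← pow_mul, mul_comm, pow_mul, hζ.pow_eq_one, one_pow, inv_one]
    simp only [p, smul_mul_assoc, Finset.sum_mul]
    rw [smul_comm]
    congr 1
    rw [Finset.smul_sum]
    have e1 : ∀ k, ((ζ ^ j)⁻¹ ^ k) • u ^ k * u =
        (ζ ^ j) • (((ζ ^ j)⁻¹ ^ (k + 1)) • u ^ (k + 1)) := by
      intro k
      rw [smul_smul, pow_succ (ζ ^ j)⁻¹, pow_succ u, smul_mul_assoc]
      congr 1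
      field_simp
    simp_rw [smul_mul_assoc] at e1
    simp_rw [e1]
    rw [← Finset.smul_sum, ← Finset.smul_sum]
    congr 1
    have h1 := Finset.sum_range_succ (fun k => ((ζ ^ j)⁻¹ ^ k) • u ^ k) m
    rw [Finset.sum_range_succ'] at h1
    simp only [pow_zero, hz, hu] at h1
    exact add_right_cancel h1
  have hpuk : ∀ j k, p j * u ^ k = (ζ ^ j) ^ k • p j := by
    intro j k
    induction k with
    | zero => simp
    | succ k ih => rw [pow_succ, ← mul_assoc, ih, smul_mul_assoc, hpu, smul_smul, pow_succ]
  have hpv : ∀ j, p j * v = (ζ ^ j)⁻¹ • p j := by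
    intro j
    have hj : ζ ^ j ≠ 0 := pow_ne_zero _ hζ0
    have : p j = ζ ^ j • (p j * v) := by
      rw [← smul_mul_assoc, ← hpu, mul_assoc, huv, mul_one]
    conv_rhs => rw [this]
    rw [smul_smul, inv_mul_cancel₀ hj, one_smul]
  have hpp : ∀ j, p j * p j = p j := by
    intro j
    have hj : ζ ^ j ≠ 0 := pow_ne_zero _ hζ0
    conv_lhs => rhs; simp only [p]
    simp only [mul_smul_comm, Finset.mul_sum, hpuk, smul_smul]
    have : ∀ k, (ζ ^ j)⁻¹ ^ k * (ζ ^ j) ^ k = 1 := fun k => by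
      rw [← mul_pow, inv_mul_cancel₀ hj, one_pow]
    simp only [this, one_smul, Finset.sum_const, Finset.card_range]
    rw [← Nat.cast_smul_eq_nsmul K, smul_smul, inv_mul_cancel₀ hm', one_smul]
  have hsum : ∑ j ∈ Finset.range m, p j = 1 := by
    simp only [p]
    rw [← Finset.smul_sum, Finset.sum_comm]
    simp_rw [← Finset.sum_smul]
    rw [Finset.sum_eq_single_of_mem 0 (Finset.mem_range.2 hm)]
    · simp [hm']
    · intro k hk hk0
      have hk' : k < m := Finset.mem_range.1 hk
      have : ∀ j, (ζ ^ j)⁻¹ ^ k = ((ζ ^ k)⁻¹) ^ j := fun j => by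
        rw [inv_pow, inv_pow, ← pow_mul, ← pow_mul, mul_comm]
      simp_rw [this]
      rw [geom_sum_of_pow_eq_one, zero_smul]
      · rw [inv_pow, ← pow_mul, mul_comm, pow_mul, hζ.pow_eq_one, one_pow, inv_one]
      · intro h
        exact hζ.pow_ne_one_of_pos_of_lt hk0 hk' (inv_eq_one.1 h)
  refine ⟨fun j => Module.finrank K (LinearMap.range (p j)), ?_, ?_⟩
  · conv_lhs => rw [← one_mul u, ← hsum, Finset.sum_mul, map_sum]
    refine Finset.sum_congr rfl fun j _ => ?_
    rw [hpu, map_smul, trace_eq_finrank_range (hpp j), smul_eq_mul, mul_comm]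
  · conv_lhs => rw [← one_mul v, ← hsum, Finset.sum_mul, map_sum]
    refine Finset.sum_congr rfl fun j _ => ?_
    rw [hpv, map_smul, trace_eq_finrank_range (hpp j), smul_eq_mul, mul_comm]

/-- If `u` has finite order up to a scalar, then `Tr(u) Tr(u⁻¹)` is an algebraic number that every
embedding into `ℂ` sends to the square of an absolute value. -/
theorem exists_trace_mul_trace_eq [IsAlgClosed K] {m : ℕ} (hm : 0 < m) {c : K} (hc : c ≠ 0)
    {u v : Module.End K V} (huv : u * v = 1) (hu : u ^ m = c • 1)
    (f : algebraicClosure ℚ K →+* ℂ) :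
    ∃ z : algebraicClosure ℚ K, (z : K) = LinearMap.trace K V u * LinearMap.trace K V v ∧
      ∃ w : ℂ, f z = w * (starRingEnd ℂ) w ∧ (w = 0 → LinearMap.trace K V v = 0) := by
  have : NeZero (m : K) := ⟨Nat.cast_ne_zero.2 hm.ne'⟩
  obtain ⟨ζ, hζ⟩ := HasEnoughRootsOfUnity.exists_primitiveRoot K m
  obtain ⟨d, hd⟩ := IsAlgClosed.exists_pow_nat_eq c hm
  have hd0 : d ≠ 0 := by
    rintro rfl
    rw [zero_pow hm.ne'] at hd
    exact hc hd.symm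
  have h1 : (d⁻¹ • u) * (d • v) = 1 := by
    rw [smul_mul_smul_comm, inv_mul_cancel₀ hd0, one_smul, huv]
  have h2 : (d⁻¹ • u) ^ m = 1 := by
    rw [smul_pow, hu, smul_smul, inv_pow, hd, inv_mul_cancel₀ hc, one_smul]
  obtain ⟨N, hN1, hN2⟩ := exists_trace_eq_sum_of_pow_eq_one hζ hm h1 h2
  have hζi : ζ ∈ algebraicClosure ℚ K := by
    rw [mem_algebraicClosure_iff]
    exact IsIntegral.isAlgebraic (IsIntegral.of_pow hm (by rw [hζ.pow_eq_one]; exact isIntegral_one))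
  let ξ : algebraicClosure ℚ K := ⟨ζ, hζi⟩
  have hξm : ξ ^ m = 1 := Subtype.ext hζ.pow_eq_one
  let a : algebraicClosure ℚ K := ∑ j ∈ Finset.range m, (N j : algebraicClosure ℚ K) * ξ ^ j
  let b : algebraicClosure ℚ K := ∑ j ∈ Finset.range m, (N j : algebraicClosure ℚ K) * (ξ ^ j)⁻¹
  have ha : (a : K) = d⁻¹ * LinearMap.trace K V u := by
    rw [← smul_eq_mul, ← map_smul, hN1]
    simp [a, ξ]
  have hb : (b : K) = d * LinearMap.trace K V v := by
    rw [← smul_eq_mul, ← map_smul, hN2]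
    simp [b, ξ]
  have hab : f b = (starRingEnd ℂ) (f a) := by
    simp only [a, b, map_sum, map_mul, map_inv₀, map_pow, map_natCast]
    refine Finset.sum_congr rfl fun j _ => ?_
    have : ‖f ξ‖ = 1 := by
      refine Complex.norm_eq_one_of_pow_eq_one ?_ hm.ne'
      rw [← map_pow, hξm, map_one]
    rw [← map_pow (starRingEnd ℂ), ← RCLike.inv_eq_conj (by rw [norm_pow, this, one_pow])]
  refine ⟨a * b, ?_, f a, by rw [map_mul, hab], fun h0 => ?_⟩
  · push_cast
    rw [ha, hb]
    field_simp
  · rw [h0, map_zero] at hab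
    have hb0 : b = 0 := by simpa using hab
    rw [hb0] at hb
    simpa [hd0] using hb.symm

end FiniteOrder

section Matrices

variable {K : Type*} [Field K] {ι : Type*} [Fintype ι] {d : ι → ℕ}

/-- The sum of the matrix traces of the components. -/
def sumTrace (d : ι → ℕ) : (Π i, Matrix (Fin (d i)) (Fin (d i)) K) →ₗ[K] K :=
  ∑ i, Matrix.traceLinearMap (Fin (d i)) K K ∘ₗ LinearMap.proj i

theorem sumTrace_apply (a : Π i, Matrix (Fin (d i)) (Fin (d i)) K) :
    sumTrace d a = ∑ i, (a i).trace := by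
  simp [sumTrace]

theorem sumTrace_mul_comm (a b : Π i, Matrix (Fin (d i)) (Fin (d i)) K) :
    sumTrace d (a * b) = sumTrace d (b * a) := by
  simp only [sumTrace_apply, Pi.mul_apply]
  exact Finset.sum_congr rfl fun i _ => Matrix.trace_mul_comm _ _

variable [DecidableEq ι]

theorem sumTrace_mul_single (a : Π i, Matrix (Fin (d i)) (Fin (d i)) K) (i : ι)
    (b : Matrix (Fin (d i)) (Fin (d i)) K) :
    sumTrace d (a * Pi.single i b) = (a i * b).trace := by
  rw [sumTrace_apply, Finset.sum_eq_single i]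
  · simp
  · intro j _ hj
    simp [Pi.single_eq_of_ne hj]
  · simp

theorem ext_sumTrace {a b : Π i, Matrix (Fin (d i)) (Fin (d i)) K}
    (h : ∀ c, sumTrace d (a * c) = sumTrace d (b * c)) : a = b := by
  funext i
  refine Matrix.ext_iff_trace_mul_right.2 fun c => ?_
  rw [← sumTrace_mul_single, ← sumTrace_mul_single, h]

/-- Every functional on a product of matrix algebras is `a ↦ Tr(u a)` for some `u`. -/
theorem exists_eq_sumTrace_mul (l : (Π i, Matrix (Fin (d i)) (Fin (d i)) K) →ₗ[K] K) :
    ∃ u, ∀ a, l a = sumTrace d (u * a) := by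
  let u : Π i, Matrix (Fin (d i)) (Fin (d i)) K := fun i =>
    Matrix.of fun r s => l (Pi.single i (Matrix.single s r 1))
  refine ⟨u, fun a => ?_⟩
  have : l = sumTrace d ∘ₗ LinearMap.mulLeft K u := by
    refine LinearMap.pi_ext' fun i => ?_
    refine Matrix.ext_linearMap _ fun r s => ?_
    ext
    simp [sumTrace_mul_single, u, Matrix.trace_mul_single]
  exact congr($this a)

/-- The trace of `x ↦ a x b` on a product of matrix algebras is the sum of the products of the
traces in the blocks. -/
theorem trace_mulLeft_comp_mulRight (a b : Π i, Matrix (Fin (d i)) (Fin (d i)) K) :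
    LinearMap.trace K _ (LinearMap.mulLeft K a ∘ₗ LinearMap.mulRight K b) =
      ∑ i, (a i).trace * (b i).trace := by
  rw [trace_eq_sum_coord (Pi.basis fun i => Matrix.stdBasis K (Fin (d i)) (Fin (d i))),
    Fintype.sum_sigma]
  refine Finset.sum_congr rfl fun i _ => ?_
  rw [Fintype.sum_prod_type, Matrix.trace, Matrix.trace, Finset.sum_mul_sum]
  refine Finset.sum_congr rfl fun r _ => Finset.sum_congr rfl fun s _ => ?_
  simp only [Pi.basis_apply, Matrix.stdBasis_eq_single, LinearMap.comp_apply,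
    LinearMap.mulRight_apply, LinearMap.mulLeft_apply, Module.Basis.coord_apply, Pi.basis_repr,
    Pi.mul_apply, Pi.single_eq_same]
  simp [Matrix.stdBasis, Matrix.mul_apply, Matrix.single_apply, ite_and]

end Matrices

/-! ### The antipode of a semisimple Hopf algebra is an involution -/

section FrobeniusTrace

variable {K : Type*} [Field K] [CharZero K] [IsAlgClosed K]

/-- Write `l = Tr(u ·)`; then `φ` is conjugation with `u`, so that `Tr(φ)` is the sum over the
blocks of `Tr(uᵢ) Tr(uᵢ⁻¹)`. As `φ` has finite order, each of these is a square of an absolute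
value. If their sum vanishes, then so does every summand, and the formula `l h = Tr(h φ)` gives `l =
0`. -/
theorem trace_ne_zero_of_pi_matrix {ι : Type*} [Fintype ι] [DecidableEq ι] {d : ι → ℕ}
    [∀ i, NeZero (d i)] (i₀ : ι)
    (φ : (Π i, Matrix (Fin (d i)) (Fin (d i)) K) →ₗ[K] Π i, Matrix (Fin (d i)) (Fin (d i)) K)
    {m : ℕ} (hm : 0 < m) (hφ : φ ^ m = 1)
    (l : (Π i, Matrix (Fin (d i)) (Fin (d i)) K) →ₗ[K] K)
    (hl : ∀ a b, l (a * b) = l (b * φ a)) (hnd : ∀ a, (∀ b, l (a * b) = 0) → a = 0)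
    (htr : ∀ h, LinearMap.trace K _ (LinearMap.mulLeft K h ∘ₗ φ) = l h) :
    LinearMap.trace K _ φ ≠ 0 := by
  obtain ⟨u, hu⟩ := exists_eq_sumTrace_mul l
  have hφu : ∀ a, u * a = φ a * u := fun a => ext_sumTrace fun c => by
    rw [mul_assoc, ← hu, hl, hu, ← mul_assoc, sumTrace_mul_comm, ← mul_assoc]
  have hinj : Function.Injective (LinearMap.mulLeft K u) := by
    rw [← LinearMap.ker_eq_bot, LinearMap.ker_eq_bot']
    intro x hx
    refine hnd x fun b => ?_
    rw [LinearMap.mulLeft_apply] at hx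
    rw [hu, ← mul_assoc, hx, zero_mul, map_zero]
  obtain ⟨v, huv⟩ := LinearMap.surjective_of_injective hinj 1
  rw [LinearMap.mulLeft_apply] at huv
  have hφv : ∀ a, φ a = u * a * v := fun a => by rw [hφu, mul_assoc, huv, mul_one]
  have hupow : ∀ k a, (φ ^ k) a * u ^ k = u ^ k * a := by
    intro k
    induction k with
    | zero => simp
    | succ k ih =>
      intro a
      rw [pow_succ φ, pow_succ u, Module.End.mul_apply, ← mul_assoc, ih, mul_assoc, ← hφu, mul_assoc]
  have hcomm : ∀ a, u ^ m * a = a * u ^ m := fun a => by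
    rw [← hupow, hφ, Module.End.one_apply]
  have hscalar : ∀ i, ∃ c : K, c ≠ 0 ∧ u i ^ m = c • 1 := by
    intro i
    have hci : ∀ M : Matrix (Fin (d i)) (Fin (d i)) K, Commute M (u i ^ m) := fun M => by
      have := congr($(hcomm (Pi.single i M)) i)
      have h2 : M * u i ^ m = u i ^ m * M := by simpa using this.symm
      exact h2
    obtain ⟨c, hc⟩ : u i ^ m ∈ Set.range (Matrix.scalar (Fin (d i))) :=
      Matrix.mem_range_scalar_of_commute_transvectionStruct fun t => hci _
    refine ⟨c, ?_, ?_⟩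
    · rintro rfl
      have h1 : u i * v i = 1 := congr($huv i)
      have h2 : IsUnit (u i ^ m) := (IsUnit.of_mul_eq_one _ h1).pow m
      rw [← hc, map_zero] at h2
      exact not_isUnit_zero h2
    · rw [← hc, Matrix.smul_one_eq_diagonal]
      rfl
  have htrace : ∀ h, l h = ∑ i, ((h * u) i).trace * (v i).trace := by
    intro h
    rw [← htr, ← trace_mulLeft_comp_mulRight]
    congr 1
    refine LinearMap.ext fun a => ?_
    simp [hφv, mul_assoc]
  have hT : LinearMap.trace K _ φ = l 1 := by
    rw [← htr]
    congr 1
    refine LinearMap.ext fun a => ?_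
    simp
  intro h0
  rw [hT, htrace] at h0
  have : Algebra.IsAlgebraic ℚ (algebraicClosure ℚ K) := algebraicClosure.isAlgebraic ℚ K
  let f : algebraicClosure ℚ K →+* ℂ :=
    (IsAlgClosed.lift : algebraicClosure ℚ K →ₐ[ℚ] ℂ).toRingHom
  have key : ∀ i, ∃ z : algebraicClosure ℚ K, (z : K) = (u i).trace * (v i).trace ∧
      ∃ w : ℂ, f z = w * (starRingEnd ℂ) w ∧ (w = 0 → (v i).trace = 0) := by
    intro i
    obtain ⟨c, hc, huc⟩ := hscalar i
    have h1 : Matrix.toLinAlgEquiv' (u i) * Matrix.toLinAlgEquiv' (v i) = 1 := by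
      rw [← map_mul, show u i * v i = 1 from congr($huv i), map_one]
    have h2 : Matrix.toLinAlgEquiv' (u i) ^ m = c • 1 := by
      rw [← map_pow, huc, map_smul, map_one]
    have ht : ∀ M : Matrix (Fin (d i)) (Fin (d i)) K,
        LinearMap.trace K _ (Matrix.toLinAlgEquiv' M) = M.trace := Matrix.trace_toLin'_eq
    have := exists_trace_mul_trace_eq hm hc h1 h2 f
    rwa [ht, ht] at this
  choose z hz w hw hw0 using key
  have hsum : ∑ i, z i = 0 := by
    refine Subtype.ext ?_
    simp only [one_mul] at h0
    push_cast
    rw [← h0]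
    exact Finset.sum_congr rfl fun i _ => hz i
  have hnorm : ∑ i, Complex.normSq (w i) = 0 := by
    have := congr(f $hsum)
    rw [map_sum, map_zero] at this
    simp_rw [hw, Complex.mul_conj] at this
    exact_mod_cast this
  have hv : ∀ i, (v i).trace = 0 := fun i => by
    refine hw0 i ?_
    have := (Finset.sum_eq_zero_iff_of_nonneg fun i _ => Complex.normSq_nonneg (w i)).1 hnorm i
      (Finset.mem_univ i)
    exact Complex.normSq_eq_zero.1 this
  have hl0 : ∀ h, l h = 0 := fun h => by simp [htrace, hv]
  have h10 := hnd 1 fun b => hl0 _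
  have := congr($h10 i₀)
  simp at this

/-- On a semisimple algebra over an algebraically closed field of characteristic zero, let `l` be a
nondegenerate form with Nakayama automorphism `φ` of finite order such that `l h = Tr(h φ)`. Then
the trace of `φ` does not vanish: it is the sum of the squares of the absolute values of the traces
of the (normalized) matrices that represent `l` in the matrix blocks. -/
theorem trace_ne_zero_of_isSemisimpleRing {A : Type*} [Ring A] [Nontrivial A] [Algebra K A]
    [FiniteDimensional K A] [IsSemisimpleRing A] (φ : A →ₗ[K] A) {m : ℕ} (hm : 0 < m)
    (hφ : φ ^ m = 1) (l : A →ₗ[K] K)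
    (hl : ∀ a b, l (a * b) = l (b * φ a)) (hnd : ∀ a, (∀ b, l (a * b) = 0) → a = 0)
    (htr : ∀ h, LinearMap.trace K _ (LinearMap.mulLeft K h ∘ₗ φ) = l h) :
    LinearMap.trace K _ φ ≠ 0 := by
  obtain ⟨n, d, hd, ⟨e⟩⟩ := IsSemisimpleRing.exists_algEquiv_pi_matrix_of_isAlgClosed K A
  let e' := e.toLinearEquiv
  have hconj : ∀ ψ : A →ₗ[K] A, LinearMap.trace K _ (e'.conj ψ) = LinearMap.trace K _ ψ :=
    fun ψ => LinearMap.trace_conj' ψ e'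
  have hpow : ∀ k, e'.conj φ ^ k = e'.conj (φ ^ k) := by
    intro k
    induction k with
    | zero => refine LinearMap.ext fun a => ?_; simp [LinearEquiv.conj_apply]
    | succ k ih =>
      rw [pow_succ, pow_succ, ih]
      refine LinearMap.ext fun a => ?_
      simp [LinearEquiv.conj_apply]
  have hn : Nonempty (Fin n) := by
    by_contra hne
    rw [not_nonempty_iff] at hne
    exact (not_subsingleton A) e.toEquiv.subsingleton
  rw [← hconj]
  refine trace_ne_zero_of_pi_matrix hn.some (e'.conj φ) hm ?_ (l ∘ₗ e'.symm.toLinearMap) ?_ ?_ ?_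
  · rw [hpow, hφ]
    refine LinearMap.ext fun a => ?_
    simp [LinearEquiv.conj_apply]
  · intro a b
    have := hl (e.symm a) (e.symm b)
    simpa [e', LinearEquiv.conj_apply] using this
  · intro a ha
    have := hnd (e.symm a) fun b => by simpa [e'] using ha (e b)
    simpa using this
  · intro h
    rw [LinearMap.comp_apply, ← htr, ← hconj]
    congr 1
    refine LinearMap.ext fun a => ?_
    simp [e', LinearEquiv.conj_apply]

end FrobeniusTrace

section Involutive

variable {F H : Type*} [Field F] [Ring H] [HopfAlgebra F H]

/-- Unlike semisimplicity, the existence of a normalized integral is visibly stable under field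
extensions. -/
theorem IsNormalizedIntegral.baseChange {Λ : H}
    (hΛ : IsNormalizedIntegral F Λ) (K : Type*) [Field K] [Algebra F K] : IsNormalizedIntegral K ((1 : K) ⊗ₜ[F] Λ) where
  mul_left a := by
    induction a with
    | zero => simp
    | add a b ha hb => simp only [map_add, add_mul, add_smul, ha, hb]
    | tmul k h =>
      rw [Algebra.TensorProduct.tmul_mul_tmul, hΛ.mul_left, mul_one, TensorProduct.counit_tmul,
        TensorProduct.tmul_smul, TensorProduct.smul_tmul', TensorProduct.smul_tmul']
      simp [Algebra.smul_def, mul_comm]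
  mul_right a := by
    induction a with
    | zero => simp
    | add a b ha hb => simp only [map_add, mul_add, add_smul, ha, hb]
    | tmul k h =>
      rw [Algebra.TensorProduct.tmul_mul_tmul, hΛ.mul_right, one_mul, TensorProduct.counit_tmul,
        TensorProduct.tmul_smul, TensorProduct.smul_tmul', TensorProduct.smul_tmul']
      simp [Algebra.smul_def, mul_comm]
  counit_eq := by
    simp [hΛ.counit_eq]

variable [FiniteDimensional F H]

instance finite_groupLike : Finite (GroupLike F H) :=
  (linearIndep_groupLikeVal (R := F) (A := H)).finite

/-- Grouplike elements are linearly independent, so there are finitely many of them, and each has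
finite order. -/
theorem exists_pow_eq_one_of_isGroupLikeElem {g : H} (hg : IsGroupLikeElem F g) :
    ∃ N, 0 < N ∧ g ^ N = 1 := by
  obtain ⟨N, hN, h⟩ := isOfFinOrder_iff_pow_eq_one.1
    (isOfFinOrder_of_finite (⟨g, hg⟩ : GroupLike F H))
  exact ⟨N, hN, by simpa using congr(GroupLike.val $h)⟩

/-- By Radford's formula `S⁴` is conjugation with a grouplike element, and grouplike elements have
finite order. -/
theorem IsNormalizedIntegral.exists_antipodeSq_pow_eq_one {Λ : H}
    (hΛ : IsNormalizedIntegral F Λ) :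
    ∃ m, 0 < m ∧ (antipode F ∘ₗ antipode F : Module.End F H) ^ m = 1 := by
  obtain ⟨l, hl⟩ := (bijective_integralMap hΛ).2 1
  obtain ⟨N, hN, hg⟩ := exists_pow_eq_one_of_isGroupLikeElem (hΛ.isGroupLikeElem_distinguished hl)
  set g := distinguished Λ l
  have h4 : ∀ a : H, a * g = g * ((antipode F ∘ₗ antipode F : Module.End F H) ^ 2) a :=
    hΛ.mul_distinguished hl
  set φ := (antipode F ∘ₗ antipode F : Module.End F H)
  have hk : ∀ k (a : H), a * g ^ k = g ^ k * ((φ ^ 2) ^ k) a := by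
    intro k
    induction k with
    | zero => simp
    | succ k ih =>
      intro a
      rw [pow_succ g, ← mul_assoc, ih, mul_assoc, h4, pow_succ' (φ ^ 2), Module.End.mul_apply, mul_assoc]
  refine ⟨2 * N, by omega, ?_⟩
  ext a
  have := hk N a
  rw [hg, mul_one, one_mul] at this
  rw [pow_mul, Module.End.one_apply]
  exact this.symm

/-- Maschke's theorem: a Hopf algebra with a normalized integral is semisimple. This is used to pass
to an algebraic closure of the field. -/
theorem IsNormalizedIntegral.isSemisimpleRing {Λ : H} (hΛ : IsNormalizedIntegral F Λ) :
    IsSemisimpleRing H := by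
  refine (isSemisimpleModule_iff H H).2 ⟨fun I => ?_⟩
  obtain ⟨p, hp⟩ := (I.restrictScalars F).subtype.exists_leftInverse_of_injective
    (LinearMap.ker_eq_bot.2 Subtype.val_injective)
  let p' : H →ₗ[F] H := (I.restrictScalars F).subtype ∘ₗ p
  have hpI : ∀ x, p' x ∈ I := fun x => (p x).2
  have hpid : ∀ x ∈ I, p' x = x := fun x hx => congrArg Subtype.val congr($hp ⟨x, hx⟩)
  -- Average `p'` over the separability element `Λ₁ ⊗ S(Λ₂)`.
  let φ : H → H ⊗[F] H →ₗ[F] H := fun x =>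
    LinearMap.mul' F H ∘ₗ LinearMap.lTensor H (p' ∘ₗ LinearMap.mulRight F x ∘ₗ antipode F)
  have hφI : ∀ x t, φ x t ∈ I := by
    intro x t
    induction t with
    | zero => simp
    | add s t hs ht => rw [map_add]; exact I.add_mem hs ht
    | tmul a b => exact I.smul_mem a (hpI _)
  have hφ1 : ∀ x a t, φ x ((1 ⊗ₜ a) * t) = φ (antipode F a * x) t := by
    intro x a t
    induction t with
    | zero => simp
    | add s t hs ht => simp only [mul_add, map_add, hs, ht]
    | tmul b c => simp [φ, antipode_mul_antidistrib, mul_assoc]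
  have hφ2 : ∀ x a t, φ x ((a ⊗ₜ 1) * t) = a * φ x t := by
    intro x a t
    induction t with
    | zero => simp
    | add s t hs ht => simp only [mul_add, map_add, hs, ht]
    | tmul b c => simp [φ, mul_assoc]
  have hφid : ∀ x ∈ I, ∀ t, φ x t = LinearMap.mul' F H (LinearMap.lTensor H (antipode F) t) * x := by
    intro x hx t
    induction t with
    | zero => simp
    | add s t hs ht => simp only [add_mul, map_add, hs, ht]
    | tmul b c =>
      simp only [φ, LinearMap.comp_apply, LinearMap.lTensor_tmul, LinearMap.mul'_apply,
        LinearMap.mulRight_apply]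
      rw [hpid _ (show antipode F c * x ∈ I from I.smul_mem _ hx), mul_assoc]
  have hadd : ∀ x y t, φ (x + y) t = φ x t + φ y t := by
    intro x y t
    induction t with
    | zero => simp
    | add s t hs ht => simp only [map_add, hs, ht]; abel
    | tmul b c => simp [φ, mul_add]
  let q : H →ₗ[H] I :=
    { toFun := fun x => ⟨φ x (comul Λ), hφI _ _⟩
      map_add' := fun x y => Subtype.ext (hadd x y _)
      map_smul' := fun a x => Subtype.ext <| by
        obtain ⟨b, rfl⟩ := (bijective_antipode hΛ).2 a
        change φ (antipode F b * x) _ = antipode F b * φ x _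
        rw [← hφ1, hΛ.one_tmul_mul_comul, hφ2] }
  refine ⟨_, LinearMap.isCompl_of_proj (f := q) fun x => Subtype.ext ?_⟩
  change φ x (comul Λ) = x
  rw [hφid x x.2, mul_antipode_lTensor_comul_apply, hΛ.counit_eq, map_one, one_mul]

theorem trace_antipodeSq_ne_zero_of_isAlgClosed [CharZero F] [IsAlgClosed F] {Λ : H}
    (hΛ : IsNormalizedIntegral F Λ) :
    LinearMap.trace F H (antipode F ∘ₗ antipode F) ≠ 0 := by
  obtain ⟨l, hl⟩ := (bijective_integralMap hΛ).2 1
  have := hΛ.isSemisimpleRing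
  have hnt : Nontrivial H := by
    refine ⟨⟨1, 0, fun h => ?_⟩⟩
    have := congr(counit (R := F) $h)
    simp at this
  obtain ⟨m, hm, h⟩ := hΛ.exists_antipodeSq_pow_eq_one
  exact trace_ne_zero_of_isSemisimpleRing _ hm h l (hΛ.cointegral_mul hl)
    (fun a => hΛ.eq_zero_of_cointegral_mul hl) (hΛ.trace_mulLeft_comp_antipode hl)

/-- The antipode of a finite-dimensional semisimple Hopf algebra over a field of characteristic zero
is an involution (Larson and Radford). -/
theorem antipode_antipode [CharZero F] [IsSemisimpleRing H] (a : H) :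
    antipode F (antipode F a) = a := by
  obtain ⟨Λ, hΛ⟩ := exists_isNormalizedIntegral F H
  refine hΛ.antipode_antipode_of_trace_ne_zero ?_ a
  let K := AlgebraicClosure F
  have : CharZero K := charZero_of_injective_algebraMap (algebraMap F K).injective
  have h := trace_antipodeSq_ne_zero_of_isAlgClosed (hΛ.baseChange K)
  have e : antipode K (A := K ⊗[F] H) ∘ₗ antipode K =
      (antipode F ∘ₗ antipode F : H →ₗ[F] H).baseChange K := by
    ext h
    simp
  rw [e, LinearMap.trace_baseChange] at h
  exact fun h0 => h (by rw [h0, map_zero])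

end Involutive

/-! ### Convolution models of `D(H)^*` and of the Heisenberg double -/

section ConvolutionModel

/-- The convolution algebra `Hom(H, H^{op})`. It is isomorphic to `D(H)^*` as an algebra. -/
def OpConv (F H : Type*) [Field F] [Ring H] [HopfAlgebra F H] := WithConv (H →ₗ[F] Hᵐᵒᵖ)

variable {F H : Type*} [Field F] [Ring H] [HopfAlgebra F H]

instance : Ring (OpConv F H) := inferInstanceAs (Ring (WithConv (H →ₗ[F] Hᵐᵒᵖ)))

instance : Algebra F (OpConv F H) := inferInstanceAs (Algebra F (WithConv (H →ₗ[F] Hᵐᵒᵖ)))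

namespace OpConv

/-- The value at `x` of an element of `Hom(H, H^{op})`, as an element of `H`. -/
def eval (f : OpConv F H) (x : H) : H := (WithConv.ofConv f x).unop

/-- The element of `Hom(H, H^{op})` given by a linear map `H → H`. -/
def mk : (H →ₗ[F] H) →ₗ[F] OpConv F H where
  toFun f := toConv ((MulOpposite.opLinearEquiv F).toLinearMap ∘ₗ f)
  map_add' _ _ := rfl
  map_smul' _ _ := rfl

theorem mk_eval (f : H →ₗ[F] H) (x : H) : (mk f).eval x = f x := rfl

theorem exists_mk (f : OpConv F H) : ∃ g : H →ₗ[F] H, mk g = f :=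
  ⟨(MulOpposite.opLinearEquiv F).symm.toLinearMap ∘ₗ WithConv.ofConv f, rfl⟩

theorem mk_injective : Function.Injective (mk (F := F) (H := H)) := fun f g h => by
  ext x
  exact congr(eval $h x)

theorem ext_eval {f g : OpConv F H} (h : ∀ x, f.eval x = g.eval x) : f = g :=
  WithConv.ext (LinearMap.ext fun x => MulOpposite.unop_injective (h x))

theorem one_eval (x : H) : (1 : OpConv F H).eval x = counit (R := F) x • 1 := by
  change MulOpposite.unop (algebraMap F Hᵐᵒᵖ (counit x)) = _
  rw [Algebra.algebraMap_eq_smul_one]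
  rfl

theorem mul_eval_repr (f g : OpConv F H) {x : H} {ι : Type*} (r : Repr F x ι) :
    (f * g).eval x = ∑ i ∈ r.index, g.eval (r.right i) * f.eval (r.left i) := by
  have : (f * g).eval x = MulOpposite.unop (∑ i ∈ r.index,
      WithConv.ofConv f (r.left i) * WithConv.ofConv g (r.right i)) :=
    congrArg MulOpposite.unop (r.convMul_apply f g)
  rw [this, Finset.unop_sum]
  rfl

theorem mk_mul_mk_eval (f g : H →ₗ[F] H) (x : H) :
    (mk f * mk g).eval x = LinearMap.mul' F H (TensorProduct.comm F H H
      (TensorProduct.map f g (comul x))) := by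
  rw [mul_eval_repr _ _ (ℛ F x)]
  simp only [mk_eval]
  rw [← (ℛ F x).eq]
  simp

/-- Conjugation with the antipode, an antiautomorphism of `Hom(H, H^{op})`. -/
def antipodeConj (f : OpConv F H) : OpConv F H :=
  mk (antipode F ∘ₗ (MulOpposite.opLinearEquiv F).symm.toLinearMap ∘ₗ WithConv.ofConv f ∘ₗ
    antipode F)

theorem antipodeConj_eval (f : OpConv F H) (x : H) :
    f.antipodeConj.eval x = antipode F (f.eval (antipode F x)) := rfl

theorem antipodeConj_mul (f g : OpConv F H) :
    (f * g).antipodeConj = g.antipodeConj * f.antipodeConj := by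
  obtain ⟨f, rfl⟩ := exists_mk f
  obtain ⟨g, rfl⟩ := exists_mk g
  refine ext_eval fun x => ?_
  rw [antipodeConj_eval, mk_mul_mk_eval]
  change _ = (mk (antipode F ∘ₗ g ∘ₗ antipode F) * mk (antipode F ∘ₗ f ∘ₗ antipode F)).eval x
  rw [mk_mul_mk_eval, comul_antipode]
  generalize comul (R := F) x = t
  induction t with
  | zero => simp
  | tmul a b => simp [antipode_mul_antidistrib]
  | add a b ha hb => simp only [map_add, ha, hb]

theorem antipodeConj_one : (1 : OpConv F H).antipodeConj = 1 := by
  refine ext_eval fun x => ?_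
  rw [antipodeConj_eval, one_eval, one_eval]
  simp

/-- The identity of `H`, as an element of `Hom(H, H^{op})`. -/
def idOp : OpConv F H := mk LinearMap.id

/-- The antipode of `H`, as an element of `Hom(H, H^{op})`. -/
def antipodeOp : OpConv F H := mk (antipode F)

theorem idOp_eval (x : H) : (idOp : OpConv F H).eval x = x := rfl

theorem antipodeOp_eval (x : H) : (antipodeOp : OpConv F H).eval x = antipode F x := rfl

variable [FiniteDimensional F H] [CharZero F] [IsSemisimpleRing H]

theorem idOp_mul_antipodeOp : (idOp : OpConv F H) * antipodeOp = 1 := by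
  refine ext_eval fun x => ?_
  rw [mul_eval_repr _ _ (ℛ F x), one_eval]
  simp only [idOp_eval, antipodeOp_eval]
  conv_lhs => enter [2, i, 2]; rw [← antipode_antipode (F := F) ((ℛ F x).left i)]
  simp only [← antipode_mul_antidistrib, ← map_sum]
  rw [sum_antipode_mul_eq_smul]
  simp

theorem antipodeOp_mul_idOp : (antipodeOp : OpConv F H) * idOp = 1 := by
  refine ext_eval fun x => ?_
  rw [mul_eval_repr _ _ (ℛ F x), one_eval]
  simp only [idOp_eval, antipodeOp_eval]
  conv_lhs => enter [2, i, 1]; rw [← antipode_antipode (F := F) ((ℛ F x).right i)]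
  simp only [← antipode_mul_antidistrib, ← map_sum]
  rw [sum_mul_antipode_eq_smul]
  simp

theorem antipodeConj_antipodeConj (f : OpConv F H) : f.antipodeConj.antipodeConj = f :=
  ext_eval fun x => by simp only [antipodeConj_eval, antipode_antipode]

theorem antipodeConj_idOp : (idOp : OpConv F H).antipodeConj = idOp :=
  ext_eval fun x => by simp only [antipodeConj_eval, idOp_eval, antipode_antipode]

theorem antipodeConj_antipodeOp : (antipodeOp : OpConv F H).antipodeConj = antipodeOp :=
  ext_eval fun x => by simp only [antipodeConj_eval, antipodeOp_eval, antipode_antipode]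

end OpConv

end ConvolutionModel

section DoubleDual

variable {F H : Type*} [Field F] [Ring H] [HopfAlgebra F H]

theorem dualMul_eq_convMul (α β : Module.Dual F H) :
    dualMul F H α β = (toConv α * toConv β).ofConv := rfl

theorem dualMul_apply_repr (α β : Module.Dual F H) {x : H} {ι : Type*} (r : Repr F x ι) :
    dualMul F H α β x = ∑ i ∈ r.index, α (r.left i) * β (r.right i) :=
  r.convMul_apply (toConv α) (toConv β)

theorem dualMul_assoc (α β γ : Module.Dual F H) :
    dualMul F H (dualMul F H α β) γ = dualMul F H α (dualMul F H β γ) :=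
  congrArg ofConv (mul_assoc (toConv α) (toConv β) (toConv γ))

@[simp] theorem counit_dualMul (α : Module.Dual F H) : dualMul F H counit α = α :=
  congrArg ofConv (one_mul (toConv α))

@[simp] theorem dualMul_counit (α : Module.Dual F H) : dualMul F H α counit = α :=
  congrArg ofConv (mul_one (toConv α))

@[simp] theorem ddMul_tmul (y z : H) (γ δ : Module.Dual F H) :
    ddMul F H (y ⊗ₜ γ) (z ⊗ₜ δ) = (z * y) ⊗ₜ dualMul F H γ δ := by
  simp [ddMul]

/-- The map `D(H)^* → Hom(H, H^{op})` that sends `y ⊗ γ` to `x ↦ γ(x) y`. It is a morphism of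
algebras, see `ddConv_ddMul`. -/
def ddConv (F H : Type*) [Field F] [Ring H] [HopfAlgebra F H] : HH F H →ₗ[F] OpConv F H :=
  OpConv.mk ∘ₗ dualTensorHom F H H ∘ₗ (TensorProduct.comm F H (Module.Dual F H)).toLinearMap

theorem ddConv_tmul_eval (y : H) (γ : Module.Dual F H) (x : H) :
    (ddConv F H (y ⊗ₜ γ)).eval x = γ x • y := by
  simp [ddConv, OpConv.mk_eval]

theorem ddConv_ddMul (a b : HH F H) : ddConv F H (ddMul F H a b) = ddConv F H a * ddConv F H b := by
  induction a using TensorProduct.induction_on with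
  | zero => simp
  | add a b ha hb => simp only [map_add, LinearMap.add_apply, add_mul, ha, hb]
  | tmul y γ =>
    induction b using TensorProduct.induction_on with
    | zero => simp
    | add a b ha hb => simp only [map_add, mul_add, ha, hb]
    | tmul z δ =>
      refine OpConv.ext_eval fun x => ?_
      rw [ddMul_tmul, OpConv.mul_eval_repr _ _ (ℛ F x), ddConv_tmul_eval,
        dualMul_apply_repr _ _ (ℛ F x), Finset.sum_smul]
      refine Finset.sum_congr rfl fun i _ => ?_
      rw [ddConv_tmul_eval, ddConv_tmul_eval, smul_mul_smul_comm, mul_comm]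

theorem ddConv_ddOne : ddConv F H (ddOne F H) = 1 :=
  OpConv.ext_eval fun x => by rw [ddOne, ddConv_tmul_eval, OpConv.one_eval]

theorem ddConv_injective [FiniteDimensional F H] : Function.Injective (ddConv F H) := by
  have h : Function.Injective (dualTensorHom F H H) := (dualTensorHomEquiv F H H).injective
  exact OpConv.mk_injective.comp (h.comp (TensorProduct.comm F H (Module.Dual F H)).injective)

end DoubleDual

section HeisenbergRep

variable {F H : Type*} [Field F] [Ring H] [HopfAlgebra F H]

/-- The representation `(y ⊗ γ) x = y x₁ γ(x₂)` of the Heisenberg double on `H`. -/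
def heisRep (F H : Type*) [Field F] [Ring H] [HopfAlgebra F H] : HH F H →ₗ[F] Module.End F H :=
  TensorProduct.lift ((LinearMap.llcomp F H H H).compl₁₂ (LinearMap.mul F H)
    ((contractRightₗ F H).compr₂ (LinearMap.id) |>.compl₂ (comul (R := F) (A := H))))

@[simp] theorem heisRep_tmul_apply (y : H) (γ : Module.Dual F H) (x : H) :
    heisRep F H (y ⊗ₜ γ) x = y * contractRight γ (comul (R := F) x) := by
  simp [heisRep]

/-- Convolution with the identity of `H` turns `Hom(H, H^{op})` into the representation of the
Heisenberg double. -/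
theorem idOp_mul_ddConv_eval (a : HH F H) (x : H) :
    (OpConv.idOp * ddConv F H a).eval x = heisRep F H a x := by
  have : OpConv.idOp * ddConv F H a = OpConv.mk (heisRep F H a) := by
    induction a using TensorProduct.induction_on with
    | zero => simp
    | add a b ha hb => simp only [map_add, mul_add, ha, hb]
    | tmul y γ =>
      refine OpConv.ext_eval fun x => ?_
      rw [OpConv.mul_eval_repr _ _ (ℛ F x), OpConv.mk_eval, heisRep_tmul_apply]
      simp only [ddConv_tmul_eval, OpConv.idOp_eval]
      conv_rhs => rw [← (ℛ F x).eq]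
      simp [Finset.mul_sum]
  rw [this, OpConv.mk_eval]

theorem heisMul_tmul_repr (h h' : H) (α α' : Module.Dual F H) {ι : Type*} (r : Repr F h' ι) :
    heisMul F H (h ⊗ₜ α) (h' ⊗ₜ α') =
      ∑ i ∈ r.index, (h * r.left i) ⊗ₜ dualMul F H (α ∘ₗ LinearMap.mulLeft F (r.right i)) α' := by
  simp only [heisMul, TensorProduct.lift.tmul, LinearMap.mk₂_apply, LinearMap.comp_apply,
    TensorProduct.map_tmul, LinearEquiv.coe_coe]
  rw [← r.eq]
  simp [TensorProduct.sum_tmul, dualReg]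

theorem heisRep_heisMul (a b : HH F H) :
    heisRep F H (heisMul F H a b) = heisRep F H a * heisRep F H b := by
  induction a using TensorProduct.induction_on with
  | zero => simp
  | add a b ha hb => simp only [map_add, LinearMap.add_apply, add_mul, ha, hb]
  | tmul h α =>
    induction b using TensorProduct.induction_on with
    | zero => simp
    | add a b ha hb => simp only [map_add, mul_add, ha, hb]
    | tmul h' α' =>
      ext x
      rw [heisMul_tmul_repr _ _ _ _ (ℛ F h'), Module.End.mul_apply, heisRep_tmul_apply,
        heisRep_tmul_apply, Bialgebra.comul_mul, map_sum, LinearMap.sum_apply]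
      conv_rhs => rw [← (ℛ F h').eq]
      rw [Finset.sum_mul, map_sum, Finset.mul_sum]
      refine Finset.sum_congr rfl fun i _ => ?_
      rw [heisRep_tmul_apply, dualMul_eq_convMul, contractRight_convMul,
        contractRight_comp_mulLeft, mul_assoc, ← contractRight_tmul_one_mul, ← mul_assoc]
      simp

end HeisenbergRep

/-! ### The antipode of `D(H)^*` -/

section DoubleAntipode

variable {F H : Type*} [Field F] [CharZero F] [Ring H] [HopfAlgebra F H] [FiniteDimensional F H]
  [IsSemisimpleRing H]

theorem antipodeInv_apply (y : H) : antipodeInv F H y = antipode F y := by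
  have h : (antipode F (A := H) : Module.End F H) * antipode F = 1 :=
    LinearMap.ext antipode_antipode
  have hu : IsUnit (antipode F (A := H) : Module.End F H) := ⟨⟨_, _, h, h⟩, rfl⟩
  have : antipodeInv F H = antipode F := by
    rw [antipodeInv]
    exact hu.mul_left_cancel ((Ring.mul_inverse_cancel _ hu).trans h.symm)
  rw [this]

theorem ddAntipode_tmul (y : H) (γ : Module.Dual F H) :
    ddAntipode F H (y ⊗ₜ γ) = ∑ i, ∑ j,
      (Module.finBasis F H i * (antipode F y * Module.finBasis F H j)) ⊗ₜ
        dualMul F H ((Module.finBasis F H).coord j ∘ₗ antipode F)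
          (dualMul F H (γ ∘ₗ antipode F) ((Module.finBasis F H).coord i)) := by
  simp [ddAntipode, antipodeInv_apply]
  rfl

/-- Under the isomorphism `D(H)^* ≅ Hom(H, H^{op})`, the antipode of `D(H)^*` is the composite of
conjugation with the antipode of `H` and an inner automorphism. -/
theorem ddConv_ddAntipode (a : HH F H) :
    ddConv F H (ddAntipode F H a) =
      OpConv.antipodeOp * ((ddConv F H a).antipodeConj * OpConv.idOp) := by
  induction a using TensorProduct.induction_on with
  | zero =>
    have : (0 : OpConv F H).antipodeConj = 0 := OpConv.ext_eval fun x => (antipode F (A := H)).map_zero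
    simp [this]
  | add a b ha hb =>
    have : (ddConv F H a + ddConv F H b).antipodeConj =
      (ddConv F H a).antipodeConj + (ddConv F H b).antipodeConj :=
      OpConv.ext_eval fun x => (antipode F (A := H)).map_add _ _
    simp only [map_add, ha, hb, this, add_mul, mul_add]
  | tmul y γ =>
    let x := Module.finBasis F H
    have h1 : ddConv F H (∑ i, x i ⊗ₜ x.coord i) = OpConv.idOp := OpConv.ext_eval fun z => by
      have : ddConv F H (∑ i, x i ⊗ₜ x.coord i) = OpConv.mk (∑ i, (x.coord i).smulRight (x i)) := by
        rw [map_sum, map_sum]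
        exact Finset.sum_congr rfl fun i _ => OpConv.ext_eval fun z => ddConv_tmul_eval _ _ _
      rw [this, OpConv.mk_eval, OpConv.idOp_eval]
      simp
    have h2 : ddConv F H (∑ j, x j ⊗ₜ (x.coord j ∘ₗ antipode F)) = OpConv.antipodeOp :=
      OpConv.ext_eval fun z => by
        have : ddConv F H (∑ j, x j ⊗ₜ (x.coord j ∘ₗ antipode F)) =
            OpConv.mk (∑ i, (x.coord i ∘ₗ antipode F).smulRight (x i)) := by
          rw [map_sum, map_sum]
          exact Finset.sum_congr rfl fun i _ => OpConv.ext_eval fun z => ddConv_tmul_eval _ _ _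
        rw [this, OpConv.mk_eval, OpConv.antipodeOp_eval]
        simp
    have h3 : ddConv F H (antipode F y ⊗ₜ (γ ∘ₗ antipode F)) =
        (ddConv F H (y ⊗ₜ γ)).antipodeConj := OpConv.ext_eval fun z => by
      rw [OpConv.antipodeConj_eval, ddConv_tmul_eval, ddConv_tmul_eval, map_smul]
      rfl
    rw [← h1, ← h2, ← h3, ← ddConv_ddMul, ← ddConv_ddMul, ddAntipode_tmul]
    congr 1
    simp only [map_sum, LinearMap.sum_apply, ddMul_tmul, mul_assoc]
    rw [Finset.sum_comm]

/-- By `ddConv_ddAntipode`: conjugation with the antipode of `H` is an involutive antiautomorphism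
that fixes the mutually inverse elements `antipodeOp` and `idOp`. -/
theorem ddAntipode_ddAntipode (a : HH F H) : ddAntipode F H (ddAntipode F H a) = a := by
  apply ddConv_injective
  rw [ddConv_ddAntipode, ddConv_ddAntipode, OpConv.antipodeConj_mul, OpConv.antipodeConj_mul,
    OpConv.antipodeConj_antipodeConj, OpConv.antipodeConj_idOp, OpConv.antipodeConj_antipodeOp,
    mul_assoc, mul_assoc, OpConv.antipodeOp_mul_idOp, mul_one,
    ← mul_assoc, OpConv.antipodeOp_mul_idOp, one_mul]

theorem ddAntipode_ddMul (a b : HH F H) :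
    ddAntipode F H (ddMul F H a b) = ddMul F H (ddAntipode F H b) (ddAntipode F H a) := by
  apply ddConv_injective
  simp only [ddConv_ddMul, ddConv_ddAntipode, OpConv.antipodeConj_mul, mul_assoc]
  rw [← mul_assoc OpConv.idOp, OpConv.idOp_mul_antipodeOp, one_mul]

@[simp] theorem ddAntipode_ddOne : ddAntipode F H (ddOne F H) = ddOne F H := by
  apply ddConv_injective
  rw [ddConv_ddAntipode, ddConv_ddOne, OpConv.antipodeConj_one, one_mul, OpConv.antipodeOp_mul_idOp]

/-- In the representation on `H`, the antipode `S_D` is conjugation with the antipode of `H`. -/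
theorem heisRep_ddAntipode (a : HH F H) (x : H) :
    heisRep F H (ddAntipode F H a) x = antipode F (heisRep F H a (antipode F x)) := by
  rw [← idOp_mul_ddConv_eval, ← idOp_mul_ddConv_eval, ddConv_ddAntipode, ← mul_assoc,
    OpConv.idOp_mul_antipodeOp, one_mul, ← OpConv.antipodeConj_eval, OpConv.antipodeConj_mul,
    OpConv.antipodeConj_idOp]

/-- The representation of the Heisenberg double on `H` is faithful, because the identity of `H` is
invertible in the convolution algebra. -/
theorem heisRep_injective : Function.Injective (heisRep F H) := by
  intro a b h
  apply ddConv_injective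
  have : OpConv.idOp * ddConv F H a = OpConv.idOp * ddConv F H b :=
    OpConv.ext_eval fun x => by rw [idOp_mul_ddConv_eval, idOp_mul_ddConv_eval, h]
  have := congr(OpConv.antipodeOp * $this)
  rwa [← mul_assoc, ← mul_assoc, OpConv.antipodeOp_mul_idOp, one_mul, one_mul] at this

/-- The antipode of `D(H)^*` is an automorphism of the Heisenberg double. -/
theorem ddAntipode_heisMul (a b : HH F H) :
    ddAntipode F H (heisMul F H a b) = heisMul F H (ddAntipode F H a) (ddAntipode F H b) := by
  apply heisRep_injective
  ext x
  simp only [heisRep_ddAntipode, heisRep_heisMul, Module.End.mul_apply, antipode_antipode]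

end DoubleAntipode

/-! ### The Heisenberg double and its tensor powers as rings -/

section Pow

variable {F H : Type*} [Field F] [Ring H] [HopfAlgebra F H]

theorem heisPowMul_tprod {n : ℕ} (f g : Fin n → HH F H) :
    heisPowMul F H n (PiTensorProduct.tprod F f) (PiTensorProduct.tprod F g) =
      PiTensorProduct.tprod F fun i => heisMul F H (f i) (g i) :=
  PiTensorProduct.map₂_tprod_tprod _ _ _

theorem tprod_cons_ddOne (n : ℕ) :
    (Fin.cons (ddOne F H) fun _ => ddOne F H : Fin (n + 1) → HH F H) = fun _ => ddOne F H := by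
  funext i
  refine Fin.cases ?_ (fun j => ?_) i <;> simp

theorem consEquiv_ddOne_powOne (n : ℕ) :
    consEquiv F H n (ddOne F H ⊗ₜ powOne F H n) = powOne F H (n + 1) := by
  rw [powOne, consEquiv_tmul_tprod, tprod_cons_ddOne]
  rfl

theorem heisPowMul_consEquiv {n : ℕ} (a b : HH F H) (t u : HHPow F H n) :
    heisPowMul F H (n + 1) (consEquiv F H n (a ⊗ₜ t)) (consEquiv F H n (b ⊗ₜ u)) =
      consEquiv F H n (heisMul F H a b ⊗ₜ heisPowMul F H n t u) := by
  induction t using PiTensorProduct.induction_on with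
  | add a b ha hb => simp only [map_add, LinearMap.add_apply, TensorProduct.tmul_add, ha, hb]
  | smul_tprod r f =>
    induction u using PiTensorProduct.induction_on with
    | add a b ha hb => simp only [map_add, TensorProduct.tmul_add, ha, hb]
    | smul_tprod s g =>
      simp only [map_smul, LinearMap.smul_apply, TensorProduct.tmul_smul, heisPowMul_tprod,
        consEquiv_tmul_tprod]
      congr 3
      funext i
      refine Fin.cases ?_ (fun j => ?_) i <;> simp

end Pow

section Heis

theorem heisRep_ddOne {F H : Type*} [Field F] [Ring H] [HopfAlgebra F H] :
    heisRep F H (ddOne F H) = 1 := by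
  ext x
  simp [ddOne, contractRight_counit_comul]

/-- The Heisenberg double `𝓗(H)` as a ring. -/
def Heis (F H : Type*) [Field F] [Ring H] [HopfAlgebra F H] := HH F H

/-- The tensor power `𝓗(H)^{⊗ n}` of the Heisenberg double as a ring. -/
def HeisPow (F H : Type*) [Field F] [Ring H] [HopfAlgebra F H] (n : ℕ) := HHPow F H n

variable {F H : Type*} [Field F] [CharZero F] [Ring H] [HopfAlgebra F H] [FiniteDimensional F H]
  [IsSemisimpleRing H]

theorem heisMul_assoc (a b c : HH F H) :
    heisMul F H (heisMul F H a b) c = heisMul F H a (heisMul F H b c) :=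
  heisRep_injective (by simp only [heisRep_heisMul, mul_assoc])

theorem ddOne_heisMul (a : HH F H) : heisMul F H (ddOne F H) a = a :=
  heisRep_injective (by rw [heisRep_heisMul, heisRep_ddOne, one_mul])

theorem heisMul_ddOne (a : HH F H) : heisMul F H a (ddOne F H) = a :=
  heisRep_injective (by rw [heisRep_heisMul, heisRep_ddOne, mul_one])

theorem heisPowMul_assoc {n : ℕ} (a b c : HHPow F H n) :
    heisPowMul F H n (heisPowMul F H n a b) c = heisPowMul F H n a (heisPowMul F H n b c) := by
  induction a using PiTensorProduct.induction_on with
  | add a b ha hb => simp only [map_add, LinearMap.add_apply, ha, hb]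
  | smul_tprod r f =>
    induction b using PiTensorProduct.induction_on with
    | add a b ha hb => simp only [map_add, LinearMap.add_apply, ha, hb]
    | smul_tprod r g =>
      induction c using PiTensorProduct.induction_on with
      | add a b ha hb => simp only [map_add, ha, hb]
      | smul_tprod r h =>
        simp only [map_smul, LinearMap.smul_apply, heisPowMul_tprod, heisMul_assoc]

theorem powOne_heisPowMul {n : ℕ} (a : HHPow F H n) : heisPowMul F H n (powOne F H n) a = a := by
  induction a using PiTensorProduct.induction_on with
  | add a b ha hb => simp only [map_add, ha, hb]
  | smul_tprod r f => simp only [map_smul, powOne, heisPowMul_tprod, ddOne_heisMul]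

theorem heisPowMul_powOne {n : ℕ} (a : HHPow F H n) : heisPowMul F H n a (powOne F H n) = a := by
  induction a using PiTensorProduct.induction_on with
  | add a b ha hb => simp only [map_add, LinearMap.add_apply, ha, hb]
  | smul_tprod r f =>
    simp only [map_smul, LinearMap.smul_apply, powOne, heisPowMul_tprod, heisMul_ddOne]

instance : AddCommGroup (Heis F H) := inferInstanceAs (AddCommGroup (HH F H))

instance : Ring (Heis F H) :=
  { (inferInstance : AddCommGroup (Heis F H)) with
    mul a b := heisMul F H a b
    one := ddOne F H
    mul_assoc := heisMul_assoc
    one_mul := ddOne_heisMul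
    mul_one := heisMul_ddOne
    left_distrib a b c := map_add (heisMul F H a) b c
    right_distrib a b c := LinearMap.map_add₂ (heisMul F H) a b c
    zero_mul a := LinearMap.map_zero₂ (heisMul F H) a
    mul_zero a := map_zero (heisMul F H a) }

instance : Algebra F (Heis F H) :=
  letI : Module F (Heis F H) := inferInstanceAs (Module F (HH F H))
  Algebra.ofModule (fun r a b => LinearMap.map_smul₂ (heisMul F H) r a b)
    (fun r a b => map_smul (heisMul F H a) r b)

instance (n : ℕ) : AddCommGroup (HeisPow F H n) :=
  inferInstanceAs (AddCommGroup (HHPow F H n))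

instance (n : ℕ) : Ring (HeisPow F H n) :=
  { (inferInstance : AddCommGroup (HeisPow F H n)) with
    mul a b := heisPowMul F H n a b
    one := powOne F H n
    mul_assoc := heisPowMul_assoc
    one_mul := powOne_heisPowMul
    mul_one := heisPowMul_powOne
    left_distrib a b c := map_add (heisPowMul F H n a) b c
    right_distrib a b c := LinearMap.map_add₂ (heisPowMul F H n) a b c
    zero_mul a := LinearMap.map_zero₂ (heisPowMul F H n) a
    mul_zero a := map_zero (heisPowMul F H n a) }

instance (n : ℕ) : Algebra F (HeisPow F H n) :=
  letI : Module F (HeisPow F H n) := inferInstanceAs (Module F (HHPow F H n))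
  Algebra.ofModule (fun r a b => LinearMap.map_smul₂ (heisPowMul F H n) r a b)
    (fun r a b => map_smul (heisPowMul F H n a) r b)

/-- The identity map `H ⊗ H^* → 𝓗(H)`. -/
def toHeis : HH F H ≃ₗ[F] Heis F H where
  toFun a := a
  invFun a := a
  map_add' _ _ := rfl
  map_smul' _ _ := rfl
  left_inv _ := rfl
  right_inv _ := rfl

/-- The identity map `(H ⊗ H^*)^{⊗ n} → 𝓗(H)^{⊗ n}`. -/
def toHeisPow (n : ℕ) : HHPow F H n ≃ₗ[F] HeisPow F H n where
  toFun a := a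
  invFun a := a
  map_add' _ _ := rfl
  map_smul' _ _ := rfl
  left_inv _ := rfl
  right_inv _ := rfl

theorem toHeisPow_heisPowMul {n : ℕ} (a b : HHPow F H n) :
    toHeisPow n (heisPowMul F H n a b) = toHeisPow n a * toHeisPow n b := rfl

theorem toHeisPow_powOne {n : ℕ} : toHeisPow n (powOne F H n) = 1 := rfl

/-- The algebra isomorphism `𝓗(H) ⊗ 𝓗(H)^{⊗ n} ≃ 𝓗(H)^{⊗ (n + 1)}`. -/
def consHeis (n : ℕ) : Heis F H ⊗[F] HeisPow F H n ≃ₐ[F] HeisPow F H (n + 1) :=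
  Algebra.TensorProduct.algEquivOfLinearEquivTensorProduct
    ((TensorProduct.congr toHeis.symm (toHeisPow n).symm).trans
      ((consEquiv F H n).trans (toHeisPow (n + 1))))
    (fun a b t u => (heisPowMul_consEquiv (toHeis.symm a) (toHeis.symm b)
      ((toHeisPow n).symm t) ((toHeisPow n).symm u)).symm)
    (consEquiv_ddOne_powOne n)

/-! ### The subalgebras of the Heisenberg double -/

/-- The algebra morphism `H → 𝓗(H)`, `y ↦ y ⊗ 1`. -/
def heisLeft : H →ₐ[F] Heis F H :=
  AlgHom.ofLinearMap (toHeis.toLinearMap ∘ₗ (TensorProduct.mk F H _).flip counit) rfl fun x y => by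
    refine heisRep_injective ?_
    change heisRep F H ((x * y) ⊗ₜ counit) =
      heisRep F H (heisMul F H (x ⊗ₜ counit) (y ⊗ₜ counit))
    rw [heisRep_heisMul]
    ext z
    simp [contractRight_counit_comul, mul_assoc, -Bialgebra.comul_mul]

theorem heisLeft_apply (y : H) : heisLeft y = toHeis (y ⊗ₜ[F] counit) := rfl

/-- The map `H^* → 𝓗(H)`, `γ ↦ 1 ⊗ γ`, which is multiplicative by `heisRight_dualMul`. -/
def heisRight : Module.Dual F H →ₗ[F] Heis F H := toHeis.toLinearMap ∘ₗ TensorProduct.mk F H _ 1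

theorem heisRight_dualMul (γ δ : Module.Dual F H) :
    heisRight (dualMul F H γ δ) = heisRight γ * heisRight δ := by
  refine heisRep_injective ?_
  change heisRep F H ((1 : H) ⊗ₜ dualMul F H γ δ) =
    heisRep F H (heisMul F H ((1 : H) ⊗ₜ γ) ((1 : H) ⊗ₜ δ))
  rw [heisRep_heisMul]
  ext z
  simp [dualMul_eq_convMul, contractRight_convMul]

theorem toHeis_tmul (y : H) (γ : Module.Dual F H) :
    toHeis (y ⊗ₜ γ) = heisLeft y * heisRight γ := by
  refine heisRep_injective ?_
  change heisRep F H (y ⊗ₜ γ) = heisRep F H (heisMul F H (y ⊗ₜ counit) ((1 : H) ⊗ₜ γ))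
  rw [heisRep_heisMul]
  ext z
  simp [contractRight_counit_comul]

/-- The cross relation of the Heisenberg double, `γ y = y₁ γ(y₂ ·)`. -/
theorem heisRight_mul_heisLeft (γ : Module.Dual F H) {y : H} {ι : Type*} (r : Repr F y ι) :
    heisRight γ * heisLeft y =
      ∑ i ∈ r.index, heisLeft (r.left i) * heisRight (γ ∘ₗ LinearMap.mulLeft F (r.right i)) := by
  change toHeis (heisMul F H ((1 : H) ⊗ₜ γ) (y ⊗ₜ counit)) = _
  rw [heisMul_tmul_repr _ _ _ _ r, map_sum]
  simp [toHeis_tmul]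

/-- The map `H^* → 𝓗(H)`, `γ ↦ S_D(1 ⊗ S(γ))`, which is antimultiplicative by
`heisDualLeft_dualMul`. On `H` these elements act by `x ↦ γ(x₁) x₂`. -/
def heisDualLeft : Module.Dual F H →ₗ[F] Heis F H :=
  toHeis.toLinearMap ∘ₗ ddAntipode F H ∘ₗ TensorProduct.mk F H _ 1 ∘ₗ dualAntipode F H

theorem heisDualLeft_apply (γ : Module.Dual F H) :
    heisDualLeft γ = toHeis (ddAntipode F H ((1 : H) ⊗ₜ (γ ∘ₗ antipode F))) := rfl

theorem heisRep_heisDualLeft (γ : Module.Dual F H) (x : H) :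
    heisRep F H (toHeis.symm (heisDualLeft γ)) x = contractLeft γ (comul (R := F) x) := by
  rw [heisDualLeft_apply, LinearEquiv.symm_apply_apply, heisRep_ddAntipode, heisRep_tmul_apply,
    one_mul, comul_antipode]
  generalize comul (R := F) x = t
  induction t with
  | zero => simp
  | add a b ha hb => simp only [map_add, ha, hb]
  | tmul a b => simp [antipode_antipode]

theorem heisDualLeft_dualMul (γ δ : Module.Dual F H) :
    heisDualLeft (dualMul F H γ δ) = heisDualLeft δ * heisDualLeft γ := by
  have h : dualMul F H γ δ ∘ₗ antipode F =
      dualMul F H (δ ∘ₗ antipode F) (γ ∘ₗ antipode F) := by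
    ext x
    change (toConv γ * toConv δ) (antipode F x) =
      (toConv (δ ∘ₗ antipode F) * toConv (γ ∘ₗ antipode F)) x
    rw [LinearMap.convMul_apply, LinearMap.convMul_apply, comul_antipode]
    generalize comul (R := F) x = t
    induction t with
    | zero => simp
    | add a b ha hb => simp only [map_add, ha, hb]
    | tmul a b => simp [mul_comm]
  have h2 := heisRight_dualMul (δ ∘ₗ antipode F) (γ ∘ₗ antipode F)
  have h3 : heisMul F H ((1 : H) ⊗ₜ (δ ∘ₗ antipode F)) ((1 : H) ⊗ₜ (γ ∘ₗ antipode F)) =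
      (1 : H) ⊗ₜ dualMul F H (δ ∘ₗ antipode F) (γ ∘ₗ antipode F) := h2.symm
  rw [heisDualLeft_apply, h, ← h3, ddAntipode_heisMul]
  rfl

theorem heisDualLeft_counit : heisDualLeft (counit : Module.Dual F H) = 1 := by
  rw [heisDualLeft_apply]
  have : (counit : Module.Dual F H) ∘ₗ antipode F = counit := by ext x; simp
  rw [this]
  exact congrArg toHeis ddAntipode_ddOne

/-- The mirror image of the cross relation of the Heisenberg double, `γ y = y₂ γ(y₁ ·)`. -/
theorem heisDualLeft_mul_heisLeft (γ : Module.Dual F H) {y : H} {ι : Type*} (r : Repr F y ι) :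
    heisDualLeft γ * heisLeft y =
      ∑ i ∈ r.index, heisLeft (r.right i) * heisDualLeft (γ ∘ₗ LinearMap.mulLeft F (r.left i)) := by
  refine toHeis.symm.injective (heisRep_injective (LinearMap.ext fun x => ?_))
  have h1 : ∀ a b : Heis F H, heisRep F H (toHeis.symm (a * b)) =
      heisRep F H (toHeis.symm a) * heisRep F H (toHeis.symm b) := fun a b =>
    heisRep_heisMul a b
  have h2 : ∀ y z : H, heisRep F H (toHeis.symm (heisLeft y)) z = y * z := fun y z => by
    rw [heisLeft_apply, LinearEquiv.symm_apply_apply]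
    simp [contractRight_counit_comul]
  simp only [map_sum, LinearMap.sum_apply, h1, Module.End.mul_apply, heisRep_heisDualLeft, h2,
    Bialgebra.comul_mul]
  conv_lhs => rw [← r.eq]
  rw [Finset.sum_mul, map_sum]
  refine Finset.sum_congr rfl fun i _ => ?_
  generalize comul (R := F) x = t
  induction t with
  | zero => simp
  | add a b ha hb => simp only [map_add, mul_add, ha, hb]
  | tmul a b => simp

end Heis

/-! ### The coaction of `H` on `D(H)^*` -/

section Coaction

variable {F H : Type*} [Field F] [Ring H] [HopfAlgebra F H]

/-- The map `D(H)^* → H`, `y ⊗ γ ↦ γ(1) y`. -/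
def rho (F H : Type*) [Field F] [Ring H] [HopfAlgebra F H] : HH F H →ₗ[F] H :=
  (TensorProduct.rid F H).toLinearMap ∘ₗ LinearMap.lTensor H (dualCounit F H)

@[simp] theorem rho_tmul (y : H) (γ : Module.Dual F H) : rho F H (y ⊗ₜ γ) = γ 1 • y := by
  simp [rho, dualCounit]

theorem dualMul_apply_one (γ δ : Module.Dual F H) : dualMul F H γ δ 1 = γ 1 * δ 1 := by
  rw [dualMul_eq_convMul, LinearMap.convMul_apply]
  simp [Algebra.TensorProduct.one_def]

theorem rho_ddMul (a b : HH F H) : rho F H (ddMul F H a b) = rho F H b * rho F H a := by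
  induction a using TensorProduct.induction_on with
  | zero => simp
  | add a b ha hb => simp only [map_add, LinearMap.add_apply, mul_add, ha, hb]
  | tmul y γ =>
    induction b using TensorProduct.induction_on with
    | zero => simp
    | add a b ha hb => simp only [map_add, add_mul, ha, hb]
    | tmul z δ => simp [dualMul_apply_one, smul_smul]

/-- The coaction `y ⊗ γ ↦ y₁ ⊗ (y₂ ⊗ γ)` of `H` on `D(H)^*`. -/
def leftCoact (F H : Type*) [Field F] [Ring H] [HopfAlgebra F H] : HH F H →ₗ[F] H ⊗[F] HH F H :=
  (TensorProduct.assoc F H H (Module.Dual F H)).toLinearMap ∘ₗ LinearMap.rTensor _ comul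

theorem leftCoact_tmul (y : H) (γ : Module.Dual F H) :
    leftCoact F H (y ⊗ₜ γ) = TensorProduct.assoc F H H (Module.Dual F H) (comul (R := F) y ⊗ₜ γ) :=
  rfl

theorem dualReg_apply (γ : Module.Dual F H) (h k : H) : dualReg F H γ h k = γ (h * k) := rfl

/-- Left multiplication of `H` on the first factor of `H ⊗ H^*`. -/
def lmul (F H : Type*) [Field F] [Ring H] [HopfAlgebra F H] : H →ₗ[F] HH F H →ₗ[F] HH F H :=
  LinearMap.rTensorHom (Module.Dual F H) ∘ₗ LinearMap.mul F H

@[simp] theorem lmul_tmul (h y : H) (γ : Module.Dual F H) :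
    lmul F H h (y ⊗ₜ γ) = (h * y) ⊗ₜ γ := rfl

theorem lmul_lmul (h k : H) (a : HH F H) : lmul F H h (lmul F H k a) = lmul F H (h * k) a := by
  induction a using TensorProduct.induction_on with
  | zero => simp
  | add a b ha hb => simp only [map_add, ha, hb]
  | tmul y γ => simp [mul_assoc]

theorem lmul_one (a : HH F H) : lmul F H 1 a = a := by
  induction a using TensorProduct.induction_on with
  | zero => simp
  | add a b ha hb => simp only [map_add, ha, hb]
  | tmul y γ => simp

/-- The map `y ↦ f(y₂) G(y₁)`. -/
def twistBy (f : H →ₗ[F] H) (G : H →ₗ[F] HH F H) : H →ₗ[F] HH F H :=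
  TensorProduct.lift ((lmul F H ∘ₗ f).flip ∘ₗ G) ∘ₗ comul

theorem twistBy_repr (f : H →ₗ[F] H) (G : H →ₗ[F] HH F H) {y : H} {ι : Type*} (r : Repr F y ι) :
    twistBy f G y = ∑ i ∈ r.index, lmul F H (f (r.right i)) (G (r.left i)) := by
  rw [twistBy, LinearMap.comp_apply, ← r.eq, map_sum]
  rfl

theorem twistBy_twistBy (f g : H →ₗ[F] H) (G : H →ₗ[F] HH F H) (y : H) :
    twistBy f (twistBy g G) y = TensorProduct.lift ((lmul F H ∘ₗ LinearMap.mul' F H ∘ₗ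
      (TensorProduct.comm F H H).toLinearMap ∘ₗ TensorProduct.map g f).flip ∘ₗ G)
        (LinearMap.lTensor H comul (comul (R := F) y)) := by
  rw [twistBy, LinearMap.comp_apply, ← coassoc_apply]
  generalize comul (R := F) y = t
  induction t with
  | zero => simp
  | add a b ha hb => simp only [map_add, ha, hb]
  | tmul a b =>
    simp only [TensorProduct.lift.tmul, LinearMap.comp_apply, LinearMap.flip_apply, twistBy,
      LinearMap.rTensor_tmul]
    generalize comul (R := F) a = s
    induction s with
    | zero => simp
    | add p q hp hq => simp only [map_add, TensorProduct.add_tmul, hp, hq]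
    | tmul p q => simp [lmul_lmul]

theorem heisMul_tmul_left (z y : H) (δ : Module.Dual F H) :
    heisMul F H (z ⊗ₜ δ) (y ⊗ₜ counit) =
      TensorProduct.map (LinearMap.mulLeft F z) (dualReg F H δ) (comul (R := F) y) := by
  rw [heisMul_tmul_repr _ _ _ _ (ℛ F y)]
  conv_rhs => rw [← (ℛ F y).eq]
  rw [map_sum]
  refine Finset.sum_congr rfl fun i _ => ?_
  rw [dualMul_counit]
  rfl

/-- The map `h ↦ b (h ⊗ 1)`, with the product of the Heisenberg double. -/
def heisMulLeft (F H : Type*) [Field F] [Ring H] [HopfAlgebra F H] (b : HH F H) :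
    H →ₗ[F] HH F H :=
  heisMul F H b ∘ₗ (TensorProduct.mk F H _).flip counit

theorem heisMulLeft_apply (b : HH F H) (y : H) :
    heisMulLeft F H b y = heisMul F H b (y ⊗ₜ counit) := rfl

/-- The map `p ⊗ q ⊗ r ↦ S(r) z p ⊗ N(q)`. -/
def conjMap (z : H) (N : H →ₗ[F] Module.Dual F H) : H ⊗[F] (H ⊗[F] H) →ₗ[F] HH F H :=
  TensorProduct.map (LinearMap.mul' F H ∘ₗ (TensorProduct.comm F H H).toLinearMap ∘ₗ
      TensorProduct.map (LinearMap.mulLeft F z) (antipode F)) N ∘ₗ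
    (TensorProduct.rightComm F H H H).toLinearMap ∘ₗ (TensorProduct.assoc F H H H).symm.toLinearMap

@[simp] theorem conjMap_tmul (z p q r : H) (N : H →ₗ[F] Module.Dual F H) :
    conjMap z N (p ⊗ₜ (q ⊗ₜ r)) = (antipode F r * (z * p)) ⊗ₜ N q := by
  simp [conjMap]

theorem conjMap_sum (z : H) {κ : Type*} (s : Finset κ) (N : κ → H →ₗ[F] Module.Dual F H)
    (u : H ⊗[F] (H ⊗[F] H)) : ∑ m ∈ s, conjMap z (N m) u = conjMap z (∑ m ∈ s, N m) u := by
  induction u with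
  | zero => simp
  | add a b ha hb => simp only [map_add, Finset.sum_add_distrib, ha, hb]
  | tmul p v =>
    induction v with
    | zero => simp
    | add a b ha hb => simp only [TensorProduct.tmul_add, map_add, Finset.sum_add_distrib, ha, hb]
    | tmul q r => simp [TensorProduct.tmul_sum]

theorem dualMul_dualMul_apply (α β γ : Module.Dual F H) (h : H) :
    dualMul F H α (dualMul F H β γ) h = TensorProduct.dualDistrib F H (H ⊗[F] H)
      (α ⊗ₜ TensorProduct.dualDistrib F H H (β ⊗ₜ γ))
        (LinearMap.lTensor H comul (comul (R := F) h)) := by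
  change TensorProduct.dualDistrib F H H (α ⊗ₜ dualMul F H β γ) (comul (R := F) h) = _
  generalize comul (R := F) h = t
  induction t with
  | zero => simp
  | add a b ha hb => simp only [map_add, ha, hb]
  | tmul a b => rfl

theorem sum_dualDistrib_smul_tmul {ι : Type*} [Fintype ι] (x : Module.Basis ι F H) (a b : H)
    (μ ν : Module.Dual F H) (u : H ⊗[F] (H ⊗[F] H)) :
    (∑ i, ∑ j, (TensorProduct.dualDistrib F H (H ⊗[F] H)
      (x.coord i ⊗ₜ TensorProduct.dualDistrib F H H (μ ⊗ₜ x.coord j)) u • a) ⊗ₜ[F]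
        ((antipode F (x j) * (b * x i)) ⊗ₜ[F] ν)) =
      a ⊗ₜ conjMap b (μ.smulRight ν) u := by
  induction u with
  | zero => simp
  | add s t hs ht =>
    simp only [map_add, add_smul, TensorProduct.add_tmul, Finset.sum_add_distrib, hs, ht,
      TensorProduct.tmul_add]
  | tmul p v =>
    induction v with
    | zero => simp
    | add s t hs ht =>
      simp only [TensorProduct.tmul_add, map_add, add_smul, TensorProduct.add_tmul,
        Finset.sum_add_distrib, hs, ht]
    | tmul q r =>
      have hp : ∑ i, x.coord i p • x i = p := x.sum_repr p
      have hr : ∑ j, x.coord j r • x j = r := x.sum_repr r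
      have h1 : ∀ i j, (TensorProduct.dualDistrib F H (H ⊗[F] H)
          (x.coord i ⊗ₜ TensorProduct.dualDistrib F H H (μ ⊗ₜ x.coord j)) (p ⊗ₜ (q ⊗ₜ r)) • a) ⊗ₜ[F]
            ((antipode F (x j) * (b * x i)) ⊗ₜ[F] ν) =
          a ⊗ₜ[F] ((antipode F (x.coord j r • x j) * (b * (x.coord i p • x i))) ⊗ₜ[F]
            (μ q • ν)) := by
        intro i j
        rw [TensorProduct.smul_tmul]
        simp only [TensorProduct.dualDistrib_apply, map_smul, mul_smul_comm, smul_mul_assoc,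
          TensorProduct.tmul_smul, TensorProduct.smul_tmul', smul_smul]
        congr 2
        rw [mul_left_comm]
      simp_rw [h1]
      rw [Finset.sum_comm]
      simp_rw [← TensorProduct.tmul_sum, ← TensorProduct.sum_tmul, ← Finset.mul_sum,
        ← Finset.sum_mul, ← map_sum]
      rw [hp, hr, conjMap_tmul, LinearMap.smulRight_apply]

variable [FiniteDimensional F H]

theorem dualDistrib_dualComul (δ : Module.Dual F H) (h k : H) :
    TensorProduct.dualDistrib F H H (dualComul F H δ) (h ⊗ₜ k) = δ (h * k) := by
  change TensorProduct.dualDistribEquiv F H H ((TensorProduct.dualDistribEquiv F H H).symm _) _ = _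
  rw [LinearEquiv.apply_symm_apply]
  simp

theorem lid_rTensor_eval_dualComul (δ : Module.Dual F H) (h : H) :
    TensorProduct.lid F _ (LinearMap.rTensor _ (Module.Dual.eval F H h) (dualComul F H δ)) =
      dualReg F H δ h := by
  ext k
  rw [dualReg_apply, ← dualDistrib_dualComul]
  generalize dualComul F H δ = t
  induction t using TensorProduct.induction_on with
  | zero => simp
  | add a b ha hb => simp only [map_add, LinearMap.add_apply, ha, hb]
  | tmul α β => simp

/-- Partial evaluation of the first factor of `D(H)^* ⊗ D(H)^*` at an element of `H`. -/
def evalFst (h : H) : HH F H ⊗[F] HH F H →ₗ[F] H ⊗[F] HH F H :=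
  LinearMap.rTensor _ ((TensorProduct.rid F H).toLinearMap ∘ₗ
    LinearMap.lTensor H (Module.Dual.eval F H h))

/-- The part of the comultiplication of `D(H)^*` that is dual to the right multiplication of `D(H)`
with elements of `H`. -/
theorem evalFst_ddComul (y : H) (γ : Module.Dual F H) (h : H) {ι : Type*} (r : Repr F y ι) :
    evalFst h (ddComul F H (y ⊗ₜ γ)) = ∑ k ∈ r.index, r.left k ⊗ₜ
      conjMap (r.right k) (dualReg F H γ) (LinearMap.lTensor H comul (comul (R := F) h)) := by
  let x := Module.finBasis F H
  obtain ⟨s, hs⟩ := TensorProduct.exists_finset (dualComul F H γ)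
  have hN : ∑ m ∈ s, m.1.smulRight m.2 = dualReg F H γ := by
    ext1 q
    rw [← lid_rTensor_eval_dualComul, hs]
    simp
  have h1 : ddComul F H (y ⊗ₜ γ) = ∑ m ∈ s, ∑ k ∈ r.index, ∑ i, ∑ j,
      (r.left k ⊗ₜ dualMul F H (x.coord i) (dualMul F H m.1 (x.coord j))) ⊗ₜ
        ((antipode F (x j) * (r.right k * x i)) ⊗ₜ m.2) := by
    simp only [ddComul, LinearMap.sum_apply, LinearMap.comp_apply, TensorProduct.map_tmul]
    rw [hs, ← r.eq]
    simp only [map_sum, TensorProduct.map_tmul, TensorProduct.sum_tmul, TensorProduct.tmul_sum]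
    simp_rw [Finset.sum_comm (s := Finset.univ) (t := s),
      Finset.sum_comm (s := Finset.univ) (t := r.index)]
    rfl
  rw [h1, map_sum]
  simp_rw [← hN, ← conjMap_sum, TensorProduct.tmul_sum, ← sum_dualDistrib_smul_tmul x]
  rw [Finset.sum_comm]
  simp only [map_sum]
  refine Finset.sum_congr rfl fun m _ => Finset.sum_congr rfl fun k _ =>
    Finset.sum_congr rfl fun i _ => Finset.sum_congr rfl fun j _ => ?_
  rw [← dualMul_dualMul_apply]
  simp [evalFst]

end Coaction

/-! ### The action of `H` and the multiplication laws of the vertex algebra -/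

section Action

variable {F H : Type*} [Field F] [Ring H] [HopfAlgebra F H]

/-- The action `b ◁ h = S(h₂) (b (h₁ ⊗ 1))`, with the product of the Heisenberg double. It is the
restriction to `H` of the right coregular action of the Drinfeld double on its dual. -/
def act (b : HH F H) : H →ₗ[F] HH F H := twistBy (antipode F) (heisMulLeft F H b)

theorem act_repr (b : HH F H) {h : H} {ι : Type*} (r : Repr F h ι) :
    act b h = ∑ i ∈ r.index, lmul F H (antipode F (r.right i))
      (heisMul F H b (r.left i ⊗ₜ counit)) :=
  twistBy_repr _ _ r

theorem act_zero (h : H) : act (0 : HH F H) h = 0 := by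
  rw [act_repr _ (ℛ F h)]
  simp

theorem act_add (b b' : HH F H) (h : H) : act (b + b') h = act b h + act b' h := by
  simp only [act_repr _ (ℛ F h), map_add, LinearMap.add_apply, Finset.sum_add_distrib]

theorem act_tmul (z : H) (δ : Module.Dual F H) (h : H) :
    act (z ⊗ₜ δ) h =
      conjMap z (dualReg F H δ) (LinearMap.lTensor H comul (comul (R := F) h)) := by
  rw [act, twistBy, LinearMap.comp_apply, ← coassoc_apply]
  generalize comul (R := F) h = t
  induction t with
  | zero => simp
  | add a b ha hb => simp only [map_add, ha, hb]
  | tmul a b =>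
    simp only [TensorProduct.lift.tmul, LinearMap.comp_apply, LinearMap.flip_apply,
      heisMulLeft_apply, heisMul_tmul_left, LinearMap.rTensor_tmul]
    generalize comul (R := F) a = s
    induction s with
    | zero => simp
    | add p q hp hq => simp only [map_add, TensorProduct.add_tmul, hp, hq]
    | tmul p q => simp

theorem sum_smul_conjMap {κ : Type*} (s : Finset κ) (c : κ → F) (z : κ → H)
    (N : H →ₗ[F] Module.Dual F H) (u : H ⊗[F] (H ⊗[F] H)) :
    ∑ k ∈ s, c k • conjMap (z k) N u = conjMap (∑ k ∈ s, c k • z k) N u := by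
  induction u with
  | zero => simp
  | add a b ha hb => simp only [map_add, smul_add, Finset.sum_add_distrib, ha, hb]
  | tmul p v =>
    induction v with
    | zero => simp
    | add a b ha hb =>
      simp only [TensorProduct.tmul_add, map_add, smul_add, Finset.sum_add_distrib, ha, hb]
    | tmul q r =>
      simp [Finset.sum_mul, Finset.mul_sum, TensorProduct.sum_tmul, TensorProduct.smul_tmul']

theorem ddMul_eq_heisMul_lmul (c : HH F H) (q : H) (γ : Module.Dual F H) :
    ddMul F H c (q ⊗ₜ γ) = heisMul F H (lmul F H q c) ((1 : H) ⊗ₜ γ) := by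
  induction c using TensorProduct.induction_on with
  | zero => simp
  | add a b ha hb => simp only [map_add, LinearMap.add_apply, ha, hb]
  | tmul u μ =>
    let r : Repr F (1 : H) Unit :=
      { index := {()}, left := fun _ => 1, right := fun _ => 1, eq := by
          simp [Algebra.TensorProduct.one_def] }
    rw [lmul_tmul, ddMul_tmul, heisMul_tmul_repr _ _ _ _ r]
    simp [r]

theorem rho_ddOne : rho F H (ddOne F H) = 1 := by simp [ddOne]

variable [FiniteDimensional F H]

/-- The coaction of `H` on `D(H)^*` is the corestriction of the comultiplication of `D(H)^*`. -/
theorem rTensor_rho_ddComul (a : HH F H) :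
    LinearMap.rTensor _ (rho F H) (ddComul F H a) = leftCoact F H a := by
  change evalFst 1 (ddComul F H a) = _
  induction a using TensorProduct.induction_on with
  | zero => simp
  | add a b ha hb => simp only [map_add, ha, hb]
  | tmul y γ =>
    have h1 : dualReg F H γ 1 = γ := by ext; simp [dualReg_apply]
    rw [evalFst_ddComul _ _ _ (ℛ F y), leftCoact_tmul]
    conv_rhs => rw [← (ℛ F y).eq]
    simp [Algebra.TensorProduct.one_def, TensorProduct.sum_tmul, h1]

/-- Only the value of `b₁` on `1 ⊗ H ⊆ D(H)` enters the `R`-matrix; it acts on `b₂` by `act`. -/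
theorem lid_counit_evalFst_ddComul (b : HH F H) (h : H) :
    TensorProduct.lid F _ (LinearMap.rTensor _ counit (evalFst h (ddComul F H b))) = act b h := by
  induction b using TensorProduct.induction_on with
  | zero => simp [act_zero]
  | add a b ha hb => simp only [map_add, act_add, ha, hb]
  | tmul z δ =>
    rw [evalFst_ddComul _ _ _ (ℛ F z), act_tmul]
    conv_rhs => rw [← sum_counit_smul (ℛ F z)]
    simp [sum_smul_conjMap]

/-- The form `⟨b ⊗ a, R⟩` depends on `a` through `rho` only. -/
theorem rForm_eq (b a : HH F H) :
    rForm F H b a = counit (R := F) (TensorProduct.rid F H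
      (LinearMap.lTensor H (Module.Dual.eval F H (rho F H a)) b)) := by
  induction a using TensorProduct.induction_on with
  | zero => simp
  | add a c ha hb => simp only [map_add, ha, hb, LinearMap.lTensor_add, LinearMap.add_apply]
  | tmul y γ =>
    induction b using TensorProduct.induction_on with
    | zero => simp
    | add a b ha hb => simp only [map_add, LinearMap.add_apply, ha, hb]
    | tmul z δ =>
      have h1 : ∑ i, (Module.finBasis F H).coord i y • Module.finBasis F H i = y :=
        (Module.finBasis F H).sum_repr y
      have h2 : ∑ i, δ (Module.finBasis F H i) * (Module.finBasis F H).coord i y = δ y := by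
        conv_rhs => rw [← h1, map_sum]
        exact Finset.sum_congr rfl fun i _ => by rw [map_smul, smul_eq_mul, mul_comm]
      simp only [rForm, doublePairing, doubleR, LinearMap.mk₂_apply, map_sum,
        TensorProduct.map_tmul, LinearMap.compr₂_apply, TensorProduct.map₂_apply_tmul,
        LinearMap.mul'_apply, Module.Dual.eval_apply, LinearMap.id_apply, rho_tmul,
        LinearMap.lTensor_tmul, TensorProduct.rid_tmul, map_smul, LinearMap.smul_apply, smul_eq_mul]
      rw [← h2, Finset.mul_sum, Finset.sum_mul]
      exact Finset.sum_congr rfl fun i _ => by ring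

/-- The product `⟨b₁ ⊗ a₁, R⟩ b₂ a₂` in terms of the coaction of `H` on `a` and the action of `H` on
`b`. -/
theorem localMul_zero_eq_lift (a b : HH F H) :
    localMul F H 0 a b = TensorProduct.lift (ddMul F H ∘ₗ act b) (leftCoact F H a) := by
  have h : localMul F H 0 a b = TensorProduct.lid F (HH F H) (TensorProduct.map
      (TensorProduct.lift (rForm F H).flip) (TensorProduct.lift (ddMul F H).flip)
        (TensorProduct.tensorTensorTensorComm F (HH F H) (HH F H) (HH F H) (HH F H)
          (ddComul F H a ⊗ₜ ddComul F H b))) := rfl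
  rw [h, ← rTensor_rho_ddComul]
  generalize ddComul F H a = s
  induction s using TensorProduct.induction_on with
  | zero => simp
  | add p q hp hq => simp only [map_add, TensorProduct.add_tmul, hp, hq]
  | tmul a₁ a₂ =>
    simp only [LinearMap.rTensor_tmul, TensorProduct.lift.tmul, LinearMap.comp_apply,
      ← lid_counit_evalFst_ddComul]
    generalize ddComul F H b = t
    induction t using TensorProduct.induction_on with
    | zero => simp
    | add p q hp hq => simp only [map_add, TensorProduct.tmul_add, LinearMap.add_apply, hp, hq]
    | tmul b₁ b₂ => simp [rForm_eq, evalFst]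

/-- The coaction `a¹ ⊗ ⋯ ⊗ aⁿ ↦ (yⁿ₁ ⋯ y¹₁) ⊗ (y¹₂ ⊗ γ¹) ⊗ ⋯ ⊗ (yⁿ₂ ⊗ γⁿ)`, for `aⁱ = yⁱ ⊗ γⁱ`. -/
def hcoact (n : ℕ) : HHPow F H n →ₗ[F] H ⊗[F] HHPow F H n :=
  LinearMap.rTensor _ (rho F H) ∘ₗ coaction F H n

/-- The braiding uses only the coaction of `H` on `t` and the action of `H` on `b`. -/
theorem braiding_tmul {n : ℕ} (t : HHPow F H n) (b : HH F H) :
    braiding F H n (t ⊗ₜ b) = TensorProduct.map (act b) LinearMap.id (hcoact n t) := by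
  have h : braiding F H n (t ⊗ₜ b) = TensorProduct.lid F _ (TensorProduct.map
      (TensorProduct.lift (rForm F H)) LinearMap.id
        (TensorProduct.tensorTensorTensorComm F (HH F H) (HH F H) (HH F H) (HHPow F H n)
          (ddComul F H b ⊗ₜ coaction F H n t))) := rfl
  rw [h, hcoact, LinearMap.comp_apply]
  generalize coaction F H n t = s
  induction s using TensorProduct.induction_on with
  | zero => simp
  | add p q hp hq => simp only [map_add, TensorProduct.tmul_add, hp, hq]
  | tmul c t' =>
    simp only [LinearMap.rTensor_tmul, TensorProduct.map_tmul, ← lid_counit_evalFst_ddComul]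
    generalize ddComul F H b = u
    induction u using TensorProduct.induction_on with
    | zero => simp
    | add p q hp hq => simp only [map_add, TensorProduct.add_tmul, hp, hq]
    | tmul b₁ b₂ => simp [rForm_eq, evalFst, TensorProduct.smul_tmul']

theorem hcoact_zero (t : HHPow F H 0) : hcoact 0 t = 1 ⊗ₜ t := by
  simp [hcoact, coaction, rho_ddOne]

theorem hcoact_consEquiv {n : ℕ} (a : HH F H) (t : HHPow F H n) :
    hcoact (n + 1) (consEquiv F H n (a ⊗ₜ t)) =
      TensorProduct.map (TensorProduct.lift (LinearMap.mul F H).flip) (consEquiv F H n).toLinearMap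
        (TensorProduct.tensorTensorTensorComm F H (HH F H) H (HHPow F H n)
          (leftCoact F H a ⊗ₜ hcoact n t)) := by
  simp only [hcoact, coaction, LinearMap.comp_apply, LinearEquiv.coe_coe,
    LinearEquiv.symm_apply_apply, TensorProduct.map_tmul, ← rTensor_rho_ddComul]
  generalize ddComul F H a = s
  generalize coaction F H n t = u
  induction s using TensorProduct.induction_on with
  | zero => simp
  | add p q hp hq => simp only [map_add, TensorProduct.add_tmul, hp, hq]
  | tmul a₁ a₂ =>
    induction u using TensorProduct.induction_on with
    | zero => simp
    | add p q hp hq => simp only [map_add, TensorProduct.tmul_add, hp, hq]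
    | tmul b₁ b₂ => simp [rho_ddMul]

end Action

section HeisenbergAction

variable {F H : Type*} [Field F] [CharZero F] [Ring H] [HopfAlgebra F H] [FiniteDimensional F H]
  [IsSemisimpleRing H]

theorem mul'_comm_antipode_comul (y : H) :
    LinearMap.mul' F H (TensorProduct.comm F H H (TensorProduct.map (antipode F) LinearMap.id
      (comul (R := F) y))) = counit (R := F) y • 1 := by
  have := congr(OpConv.eval $(OpConv.antipodeOp_mul_idOp (F := F) (H := H)) y)
  rwa [OpConv.antipodeOp, OpConv.idOp, OpConv.mk_mul_mk_eval, OpConv.one_eval] at this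

/-- `y₂ (b ◁ y₁) = b (y ⊗ 1)`. -/
theorem twistBy_act (b : HH F H) (y : H) :
    twistBy LinearMap.id (act b) y = heisMul F H b (y ⊗ₜ counit) := by
  have h : ∀ t : H ⊗[F] H, TensorProduct.lift ((lmul F H ∘ₗ LinearMap.mul' F H ∘ₗ
      (TensorProduct.comm F H H).toLinearMap ∘ₗ
        TensorProduct.map (antipode F) LinearMap.id).flip ∘ₗ heisMulLeft F H b)
        (LinearMap.lTensor H comul t) = heisMulLeft F H b (contractRight counit t) := by
    intro t
    induction t with
    | zero => simp
    | add p q hp hq => simp only [map_add, hp, hq]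
    | tmul p q => simp [mul'_comm_antipode_comul, lmul_one]
  rw [act, twistBy_twistBy, h, contractRight_counit_comul, heisMulLeft_apply]

theorem heisMul_tmul_counit_one_tmul (y : H) (γ : Module.Dual F H) :
    heisMul F H (y ⊗ₜ counit) ((1 : H) ⊗ₜ γ) = y ⊗ₜ γ :=
  (toHeis_tmul y γ).symm

/-- The multiplication law for `s = 0` is the opposite of that of the Heisenberg double. -/
theorem localMul_zero (a b : HH F H) : localMul F H 0 a b = heisMul F H b a := by
  induction a using TensorProduct.induction_on with
  | zero => simp
  | add p q hp hq => simp only [map_add, LinearMap.add_apply, hp, hq]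
  | tmul y γ =>
    rw [localMul_zero_eq_lift, leftCoact_tmul, ← heisMul_tmul_counit_one_tmul y, ← heisMul_assoc,
      ← twistBy_act, twistBy, LinearMap.comp_apply]
    generalize comul (R := F) y = t
    induction t with
    | zero => simp
    | add p q hp hq => simp only [map_add, TensorProduct.add_tmul, LinearMap.add_apply, hp, hq]
    | tmul p q => simp [ddMul_eq_heisMul_lmul]

end HeisenbergAction

/-! ### Coactions on tensor powers and exchange relations -/

section Comodule

variable {F H : Type*} [Field F] [Ring H] [HopfAlgebra F H]

theorem single_apply {n : ℕ} (i : Fin n) (a : HH F H) :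
    single F H i a = PiTensorProduct.tprod F (Function.update (fun _ => ddOne F H) i a) := rfl

theorem single_zero {n : ℕ} (a : HH F H) :
    single F H (0 : Fin (n + 1)) a = consEquiv F H n (a ⊗ₜ powOne F H n) := by
  rw [single_apply, powOne, consEquiv_tmul_tprod, ← tprod_cons_ddOne, Fin.update_cons_zero]

theorem single_succ {n : ℕ} (j : Fin n) (a : HH F H) :
    single F H j.succ a = consEquiv F H n (ddOne F H ⊗ₜ single F H j a) := by
  rw [single_apply, single_apply, consEquiv_tmul_tprod, ← tprod_cons_ddOne, ← Fin.cons_update]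

theorem leftCoact_ddOne : leftCoact F H (ddOne F H) = 1 ⊗ₜ ddOne F H := by
  simp [ddOne, leftCoact_tmul, Algebra.TensorProduct.one_def]

theorem leftCoact_coassoc (a : HH F H) :
    TensorProduct.assoc F H H (HH F H) (LinearMap.rTensor _ comul (leftCoact F H a)) =
      LinearMap.lTensor H (leftCoact F H) (leftCoact F H a) := by
  induction a using TensorProduct.induction_on with
  | zero => simp
  | add p q hp hq => simp only [map_add, hp, hq]
  | tmul y γ =>
    have h : LinearMap.lTensor H (leftCoact F H) (leftCoact F H (y ⊗ₜ γ)) =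
        LinearMap.lTensor H ((TensorProduct.assoc F H H _).toLinearMap ∘ₗ
          (TensorProduct.mk F (H ⊗[F] H) (Module.Dual F H)).flip γ)
            (LinearMap.lTensor H comul (comul (R := F) y)) := by
      rw [leftCoact_tmul]
      generalize comul (R := F) y = t
      induction t with
      | zero => simp
      | add p q hp hq => simp only [map_add, TensorProduct.add_tmul, hp, hq]
      | tmul p q => simp [leftCoact_tmul]
    rw [h, ← coassoc_apply, leftCoact_tmul]
    generalize comul (R := F) y = t
    induction t with
    | zero => simp
    | add p q hp hq => simp only [map_add, TensorProduct.add_tmul, hp, hq]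
    | tmul p q =>
      simp only [TensorProduct.assoc_tmul, LinearMap.rTensor_tmul]
      generalize comul (R := F) p = s
      induction s with
      | zero => simp
      | add p q hp hq => simp only [map_add, TensorProduct.add_tmul, hp, hq]
      | tmul p q => simp

theorem lid_counit_leftCoact (a : HH F H) :
    TensorProduct.lid F _ (LinearMap.rTensor _ counit (leftCoact F H a)) = a := by
  induction a using TensorProduct.induction_on with
  | zero => simp
  | add p q hp hq => simp only [map_add, hp, hq]
  | tmul y γ =>
    have h : ∀ t : H ⊗[F] H, TensorProduct.lid F _ (LinearMap.rTensor _ counit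
        (TensorProduct.assoc F H H (Module.Dual F H) (t ⊗ₜ γ))) = contractLeft counit t ⊗ₜ γ := by
      intro t
      induction t with
      | zero => simp
      | add p q hp hq => simp only [map_add, TensorProduct.add_tmul, hp, hq]
      | tmul p q => simp [TensorProduct.smul_tmul']
    have h2 : contractLeft counit (comul (R := F) y) = y := by
      rw [contractLeft, LinearMap.comp_apply, rTensor_counit_comul]
      simp
    rw [leftCoact_tmul, h, h2]

variable [FiniteDimensional F H]

theorem hcoact_powOne (n : ℕ) : hcoact n (powOne F H n) = 1 ⊗ₜ powOne F H n := by
  induction n with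
  | zero => exact hcoact_zero _
  | succ n ih =>
    rw [← consEquiv_ddOne_powOne, hcoact_consEquiv, ih, leftCoact_ddOne]
    simp

theorem hcoact_coassoc {n : ℕ} (t : HHPow F H n) :
    TensorProduct.assoc F H H (HHPow F H n) (LinearMap.rTensor _ comul (hcoact n t)) =
      LinearMap.lTensor H (hcoact n) (hcoact n t) := by
  induction n with
  | zero => simp [hcoact_zero, Algebra.TensorProduct.one_def]
  | succ n ih =>
    obtain ⟨v, rfl⟩ := (consEquiv F H n).surjective t
    induction v using TensorProduct.induction_on with
    | zero => simp
    | add p q hp hq => simp only [map_add, hp, hq]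
    | tmul a t =>
      rw [hcoact_consEquiv]
      -- Both sides are bilinear in the iterated coactions of `a` and `t`.
      let Φ : (H ⊗[F] (H ⊗[F] HH F H)) ⊗[F] (H ⊗[F] (H ⊗[F] HHPow F H n)) →ₗ[F]
          H ⊗[F] (H ⊗[F] HHPow F H (n + 1)) :=
        TensorProduct.map (TensorProduct.lift (LinearMap.mul F H).flip)
          (TensorProduct.map (TensorProduct.lift (LinearMap.mul F H).flip)
              (consEquiv F H n).toLinearMap ∘ₗ
            (TensorProduct.tensorTensorTensorComm F H (HH F H) H (HHPow F H n)).toLinearMap) ∘ₗ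
          (TensorProduct.tensorTensorTensorComm F H (H ⊗[F] HH F H) H
            (H ⊗[F] HHPow F H n)).toLinearMap
      have h1 : ∀ (s : H ⊗[F] HH F H) (u : H ⊗[F] HHPow F H n),
          TensorProduct.assoc F H H (HHPow F H (n + 1)) (LinearMap.rTensor _ comul
            (TensorProduct.map (TensorProduct.lift (LinearMap.mul F H).flip)
              (consEquiv F H n).toLinearMap
              (TensorProduct.tensorTensorTensorComm F H (HH F H) H (HHPow F H n) (s ⊗ₜ u)))) =
          Φ (TensorProduct.assoc F H H _ (LinearMap.rTensor _ comul s) ⊗ₜ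
            TensorProduct.assoc F H H _ (LinearMap.rTensor _ comul u)) := by
        intro s u
        induction s with
        | zero => simp
        | add p q hp hq => simp only [map_add, TensorProduct.add_tmul, hp, hq]
        | tmul h a =>
          induction u with
          | zero => simp
          | add p q hp hq => simp only [map_add, TensorProduct.tmul_add, hp, hq]
          | tmul k t =>
            simp only [TensorProduct.tensorTensorTensorComm_tmul, TensorProduct.map_tmul,
              TensorProduct.lift.tmul, LinearMap.flip_apply, LinearMap.mul_apply',
              LinearMap.rTensor_tmul, Bialgebra.comul_mul, LinearEquiv.coe_coe]
            generalize comul (R := F) h = x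
            generalize comul (R := F) k = y
            induction x with
            | zero => simp
            | add p q hp hq => simp only [map_add, TensorProduct.add_tmul, mul_add, hp, hq]
            | tmul p q =>
              induction y with
              | zero => simp
              | add p q hp hq =>
                simp only [map_add, TensorProduct.add_tmul, TensorProduct.tmul_add, add_mul, hp, hq]
              | tmul p' q' => simp [Φ]
      have h2 : ∀ (s : H ⊗[F] HH F H) (u : H ⊗[F] HHPow F H n),
          LinearMap.lTensor H (hcoact (n + 1))
            (TensorProduct.map (TensorProduct.lift (LinearMap.mul F H).flip)
              (consEquiv F H n).toLinearMap
              (TensorProduct.tensorTensorTensorComm F H (HH F H) H (HHPow F H n) (s ⊗ₜ u))) =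
          Φ (LinearMap.lTensor H (leftCoact F H) s ⊗ₜ LinearMap.lTensor H (hcoact n) u) := by
        intro s u
        induction s with
        | zero => simp
        | add p q hp hq => simp only [map_add, TensorProduct.add_tmul, hp, hq]
        | tmul h a =>
          induction u with
          | zero => simp
          | add p q hp hq => simp only [map_add, TensorProduct.tmul_add, hp, hq]
          | tmul k t => simp [Φ, hcoact_consEquiv]
      rw [h1, h2, leftCoact_coassoc, ih]

theorem lid_counit_hcoact {n : ℕ} (t : HHPow F H n) :
    TensorProduct.lid F _ (LinearMap.rTensor _ counit (hcoact n t)) = t := by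
  induction n with
  | zero => simp [hcoact_zero]
  | succ n ih =>
    obtain ⟨v, rfl⟩ := (consEquiv F H n).surjective t
    induction v using TensorProduct.induction_on with
    | zero => simp
    | add p q hp hq => simp only [map_add, hp, hq]
    | tmul a t =>
      have h : ∀ (s : H ⊗[F] HH F H) (u : H ⊗[F] HHPow F H n),
          TensorProduct.lid F _ (LinearMap.rTensor _ counit
            (TensorProduct.map (TensorProduct.lift (LinearMap.mul F H).flip)
              (consEquiv F H n).toLinearMap
              (TensorProduct.tensorTensorTensorComm F H (HH F H) H (HHPow F H n) (s ⊗ₜ u)))) =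
          consEquiv F H n (TensorProduct.lid F _ (LinearMap.rTensor _ counit s) ⊗ₜ
            TensorProduct.lid F _ (LinearMap.rTensor _ counit u)) := by
        intro s u
        induction s with
        | zero => simp
        | add p q hp hq => simp only [map_add, TensorProduct.add_tmul, hp, hq]
        | tmul h a =>
          induction u with
          | zero => simp
          | add p q hp hq => simp only [map_add, TensorProduct.tmul_add, hp, hq]
          | tmul k t => simp [TensorProduct.smul_tmul, smul_smul, mul_comm]
      rw [hcoact_consEquiv, h, lid_counit_leftCoact, ih]

end Comodule

section Exchange

variable {F H A B : Type*} [Field F] [Ring H] [HopfAlgebra F H] [Ring A] [Algebra F A] [Ring B]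
  [Algebra F B]

/-- The algebra morphism `h ⊗ b ↦ δ(h) ⊗ b`. -/
def spread (δ : H →ₐ[F] H ⊗[F] A) : H ⊗[F] B →ₐ[F] H ⊗[F] (A ⊗[F] B) :=
  (Algebra.TensorProduct.assoc F F F H A B).toAlgHom.comp
    (Algebra.TensorProduct.map δ (AlgHom.id F B))

/-- The algebra morphism `h ⊗ a ↦ h ⊗ (a ⊗ 1)`. -/
def extend : H ⊗[F] A →ₐ[F] H ⊗[F] (A ⊗[F] B) :=
  Algebra.TensorProduct.map (AlgHom.id F H) Algebra.TensorProduct.includeLeft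

@[simp] theorem extend_tmul (h : H) (a : A) :
    extend (B := B) (h ⊗ₜ[F] a) = h ⊗ₜ (a ⊗ₜ 1) := rfl

theorem spread_tmul (δ : H →ₐ[F] H ⊗[F] A) (h : H) (b : B) :
    spread δ (h ⊗ₜ[F] b) = TensorProduct.assoc F H A B (δ h ⊗ₜ b) := rfl

theorem spread_tmul_eq (δ : H →ₐ[F] H ⊗[F] A) (h : H) (b : B) :
    spread δ (h ⊗ₜ[F] b) = extend (δ h) * (1 ⊗ₜ (1 ⊗ₜ b)) := by
  rw [spread_tmul]
  generalize δ h = t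
  induction t with
  | zero => simp
  | add p q hp hq => simp only [map_add, TensorProduct.add_tmul, add_mul, hp, hq]
  | tmul p q => simp

theorem commute_extend (x : H ⊗[F] A) (b : B) :
    extend (B := B) x * (1 ⊗ₜ[F] (1 ⊗ₜ b)) = (1 ⊗ₜ (1 ⊗ₜ b)) * extend x := by
  induction x with
  | zero => simp
  | add p q hp hq => simp only [map_add, add_mul, mul_add, hp, hq]
  | tmul p q => simp

/-- The map `k ⊗ y ↦ y P(k)`, for a linear map `P` into an algebra. -/
def mulBy {R : Type*} [Ring R] [Algebra F R] (P : H →ₗ[F] R) : H ⊗[F] R →ₗ[F] R :=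
  TensorProduct.lift ((LinearMap.mul F R).flip ∘ₗ P)

@[simp] theorem mulBy_tmul {R : Type*} [Ring R] [Algebra F R] (P : H →ₗ[F] R) (k : H) (y : R) :
    mulBy P (k ⊗ₜ y) = y * P k := rfl

/-- An exchange relation `x δ(y) = δ(y₂) P(y₁)` propagates to `H ⊗ B`. -/
theorem extend_mul_spread (δ : H →ₐ[F] H ⊗[F] A) (P : H →ₗ[F] H ⊗[F] A) (x : H ⊗[F] A)
    (hx : ∀ y, x * δ y = mulBy P (LinearMap.lTensor H δ.toLinearMap (comul (R := F) y)))
    (X : H ⊗[F] B) :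
    extend x * spread δ X = mulBy ((extend (B := B)).toLinearMap ∘ₗ P)
      (LinearMap.lTensor H (spread δ).toLinearMap
        (TensorProduct.assoc F H H B (LinearMap.rTensor B comul X))) := by
  induction X with
  | zero => simp
  | add p q hp hq => simp only [map_add, mul_add, hp, hq]
  | tmul y b =>
    rw [spread_tmul_eq, ← mul_assoc, ← map_mul, hx, LinearMap.rTensor_tmul]
    generalize comul (R := F) y = t
    induction t with
    | zero => simp
    | add p q hp hq => simp only [map_add, add_mul, TensorProduct.add_tmul, hp, hq]
    | tmul p q =>
      simp only [LinearMap.lTensor_tmul, mulBy_tmul, TensorProduct.assoc_tmul,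
        AlgHom.toLinearMap_apply, spread_tmul_eq, map_mul, LinearMap.comp_apply]
      rw [mul_assoc, mul_assoc, ← commute_extend]

end Exchange

/-! ### A single edge end -/

section Site

variable {F H : Type*} [Field F] [CharZero F] [Ring H] [HopfAlgebra F H] [FiniteDimensional F H]
  [IsSemisimpleRing H]

/-- The algebra morphism `y ↦ y₁ ⊗ (y₂ ⊗ 1)` from `H` to `H ⊗ 𝓗(H)`. -/
def delta : H →ₐ[F] H ⊗[F] Heis F H :=
  (Algebra.TensorProduct.map (AlgHom.id F H) heisLeft).comp (Bialgebra.comulAlgHom F H)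

theorem delta_apply (y : H) :
    delta y = LinearMap.lTensor H (heisLeft (F := F)).toLinearMap (comul (R := F) y) := rfl

/-- The holonomy of the path that crosses a single incoming edge end: it is the identity for `s = 0`
and `y ⊗ γ ↦ ε(y) S_D(1 ⊗ S(γ))` for `s = 1`. -/
def siteMap (s : Fin 2) : HH F H →ₗ[F] Heis F H :=
  if s = 0 then toHeis.toLinearMap
  else (TensorProduct.lid F (Heis F H)).toLinearMap ∘ₗ TensorProduct.map counit heisDualLeft

theorem siteMap_zero (a : HH F H) : siteMap 0 a = toHeis a := rfl

theorem siteMap_one_tmul (y : H) (γ : Module.Dual F H) :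
    siteMap 1 (y ⊗ₜ γ) = counit (R := F) y • heisDualLeft γ := rfl

theorem siteMap_ddOne (s : Fin 2) : siteMap s (ddOne F H) = 1 := by
  fin_cases s
  · rfl
  · change siteMap 1 (ddOne F H) = 1
    rw [ddOne, siteMap_one_tmul, heisDualLeft_counit]
    simp

/-- The map `a ↦ a₋₁ ⊗ φ(a₀)` for `φ = siteMap s`. -/
def siteCo (s : Fin 2) : HH F H →ₗ[F] H ⊗[F] Heis F H :=
  LinearMap.lTensor H (siteMap s) ∘ₗ leftCoact F H

theorem siteCo_ddOne (s : Fin 2) : siteCo s (ddOne F H) = 1 := by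
  rw [siteCo, LinearMap.comp_apply, leftCoact_ddOne, LinearMap.lTensor_tmul, siteMap_ddOne]
  rfl

theorem siteCo_zero_tmul (y : H) (γ : Module.Dual F H) :
    siteCo 0 (y ⊗ₜ γ) = delta y * (1 ⊗ₜ heisRight γ) := by
  rw [siteCo, LinearMap.comp_apply, leftCoact_tmul, delta_apply]
  generalize comul (R := F) y = t
  induction t with
  | zero => simp
  | add p q hp hq => simp only [map_add, TensorProduct.add_tmul, add_mul, hp, hq]
  | tmul p q => simp [siteMap_zero, toHeis_tmul]

theorem siteCo_one_tmul (y : H) (γ : Module.Dual F H) :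
    siteCo 1 (y ⊗ₜ γ) = y ⊗ₜ heisDualLeft γ := by
  have h : ∀ t : H ⊗[F] H, LinearMap.lTensor H (siteMap 1)
      (TensorProduct.assoc F H H (Module.Dual F H) (t ⊗ₜ γ)) =
        contractRight counit t ⊗ₜ heisDualLeft γ := by
    intro t
    induction t with
    | zero => simp
    | add p q hp hq => simp only [map_add, TensorProduct.add_tmul, hp, hq]
    | tmul p q => simp [siteMap_one_tmul, TensorProduct.smul_tmul']
  rw [siteCo, LinearMap.comp_apply, leftCoact_tmul, h, contractRight_counit_comul]

theorem siteCo_zero_tmul_counit (y : H) : siteCo 0 (y ⊗ₜ (counit : Module.Dual F H)) = delta y := by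
  rw [siteCo_zero_tmul]
  exact mul_one (delta y)

theorem siteCo_zero_lmul (h : H) (a : HH F H) :
    siteCo 0 (lmul F H h a) = delta h * siteCo 0 a := by
  induction a using TensorProduct.induction_on with
  | zero => simp
  | add p q hp hq => simp only [map_add, mul_add, hp, hq]
  | tmul y γ => rw [lmul_tmul, siteCo_zero_tmul, siteCo_zero_tmul, map_mul, mul_assoc]

theorem siteCo_one_lmul (h : H) (a : HH F H) :
    siteCo 1 (lmul F H h a) = (h ⊗ₜ 1) * siteCo 1 a := by
  induction a using TensorProduct.induction_on with
  | zero => simp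
  | add p q hp hq => simp only [map_add, mul_add, hp, hq]
  | tmul y γ => simp [siteCo_one_tmul]

theorem tmul_heisRight_mul_delta (δ : Module.Dual F H) {y : H} {ι : Type*} (r : Repr F y ι) :
    ((1 : H) ⊗ₜ heisRight δ) * delta y = ∑ i ∈ r.index,
      delta (r.left i) * (1 ⊗ₜ heisRight (δ ∘ₗ LinearMap.mulLeft F (r.right i))) := by
  let Φ : H ⊗[F] (H ⊗[F] H) →ₗ[F] H ⊗[F] Heis F H :=
    LinearMap.lTensor H (LinearMap.mul' F (Heis F H) ∘ₗ
      TensorProduct.map heisLeft.toLinearMap (heisRight ∘ₗ dualReg F H δ))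
  have h1 : ((1 : H) ⊗ₜ heisRight δ) * delta y =
      Φ (LinearMap.lTensor H comul (comul (R := F) y)) := by
    rw [delta_apply]
    generalize comul (R := F) y = t
    induction t with
    | zero => simp
    | add p q hp hq => simp only [map_add, mul_add, hp, hq]
    | tmul p q =>
      simp only [LinearMap.lTensor_tmul, AlgHom.toLinearMap_apply,
        Algebra.TensorProduct.tmul_mul_tmul, one_mul, heisRight_mul_heisLeft δ (ℛ F q), Φ]
      congr 1
      conv_rhs => rw [← (ℛ F q).eq]
      simp
      rfl
  rw [h1, ← coassoc_apply]
  conv_lhs => rw [← r.eq]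
  simp only [map_sum]
  refine Finset.sum_congr rfl fun i _ => ?_
  rw [LinearMap.rTensor_tmul, delta_apply]
  generalize comul (R := F) (r.left i) = t
  induction t with
  | zero => simp
  | add p q hp hq => simp only [map_add, TensorProduct.add_tmul, add_mul, hp, hq]
  | tmul p q =>
    simp [Φ]
    rfl

theorem siteCo_zero_heisMul (b a : HH F H) :
    siteCo 0 (heisMul F H b a) = siteCo 0 b * siteCo 0 a := by
  induction b using TensorProduct.induction_on with
  | zero => simp
  | add p q hp hq => simp only [map_add, LinearMap.add_apply, add_mul, hp, hq]
  | tmul z δ =>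
    induction a using TensorProduct.induction_on with
    | zero => simp
    | add p q hp hq => simp only [map_add, mul_add, hp, hq]
    | tmul y γ =>
      rw [heisMul_tmul_repr _ _ _ _ (ℛ F y), map_sum, siteCo_zero_tmul z, siteCo_zero_tmul y,
        mul_assoc, ← mul_assoc _ (delta y), tmul_heisRight_mul_delta _ (ℛ F y), Finset.sum_mul,
        Finset.mul_sum]
      refine Finset.sum_congr rfl fun i _ => ?_
      rw [siteCo_zero_tmul, map_mul, heisRight_dualMul]
      simp [mul_assoc]

theorem siteCo_one_ddMul (a b : HH F H) :
    siteCo 1 (ddMul F H a b) = siteCo 1 b * siteCo 1 a := by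
  induction b using TensorProduct.induction_on with
  | zero => simp
  | add p q hp hq => simp only [map_add, add_mul, hp, hq]
  | tmul z δ =>
    induction a using TensorProduct.induction_on with
    | zero => simp
    | add p q hp hq => simp only [map_add, LinearMap.add_apply, mul_add, hp, hq]
    | tmul y γ =>
      rw [ddMul_tmul, siteCo_one_tmul, siteCo_one_tmul, siteCo_one_tmul, heisDualLeft_dualMul]
      simp

/-- The map `a ↦ a₋₁ ⊗ φ(a₀)` reverses the multiplication law on a single edge end. -/
theorem siteCo_localMul (s : Fin 2) (a b : HH F H) :
    siteCo s (localMul F H s a b) = siteCo s b * siteCo s a := by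
  fin_cases s
  · change siteCo 0 (localMul F H 0 a b) = siteCo 0 b * siteCo 0 a
    rw [localMul_zero, siteCo_zero_heisMul]
  · exact siteCo_one_ddMul a b

theorem siteCo_zero_mul_delta (b : HH F H) (y : H) :
    siteCo 0 b * delta y =
      mulBy (siteCo 0 ∘ₗ act b) (LinearMap.lTensor H delta.toLinearMap (comul (R := F) y)) := by
  rw [← siteCo_zero_tmul_counit y, ← siteCo_zero_heisMul, ← twistBy_act, twistBy,
    LinearMap.comp_apply]
  generalize comul (R := F) y = t
  induction t with
  | zero => simp
  | add p q hp hq => simp only [map_add, hp, hq]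
  | tmul p q => simp [siteCo_zero_lmul]

theorem siteCo_one_mul_delta (b : HH F H) (y : H) :
    siteCo 1 b * delta y =
      mulBy (siteCo 1 ∘ₗ act b) (LinearMap.lTensor H delta.toLinearMap (comul (R := F) y)) := by
  -- Both sides are compared with `(1 ⊗ y₂) φ(b (y₁ ⊗ 1))`.
  let Ψ : (H →ₗ[F] H ⊗[F] Heis F H) → (H ⊗[F] H →ₗ[F] H ⊗[F] Heis F H) := fun G =>
    TensorProduct.lift ((LinearMap.mul F _).flip.compl₂
      (TensorProduct.mk F H (Heis F H) 1 ∘ₗ heisLeft.toLinearMap) ∘ₗ G)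
  have hΨ : ∀ G p q, Ψ G (p ⊗ₜ q) = (1 ⊗ₜ heisLeft q) * G p := fun G p q => rfl
  have h1 : mulBy (siteCo 1 ∘ₗ act b)
      (LinearMap.lTensor H delta.toLinearMap (comul (R := F) y)) =
        Ψ (siteCo 1 ∘ₗ heisMulLeft F H b) (comul y) := by
    let Φ : (H ⊗[F] H) ⊗[F] H →ₗ[F] H ⊗[F] Heis F H :=
      TensorProduct.lift ((LinearMap.mul F _).flip.compl₂
        (TensorProduct.mk F H (Heis F H) 1 ∘ₗ heisLeft.toLinearMap) ∘ₗ siteCo 1 ∘ₗ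
          TensorProduct.lift ((lmul F H ∘ₗ LinearMap.id).flip ∘ₗ act b))
    have hΦ : ∀ t r, Φ (t ⊗ₜ r) = (1 ⊗ₜ heisLeft r) *
      siteCo 1 (TensorProduct.lift ((lmul F H ∘ₗ LinearMap.id).flip ∘ₗ act b) t) := fun t r => rfl
    have h2 : mulBy (siteCo 1 ∘ₗ act b)
        (LinearMap.lTensor H delta.toLinearMap (comul (R := F) y)) =
          Φ ((TensorProduct.assoc F H H H).symm (LinearMap.lTensor H comul (comul y))) := by
      generalize comul (R := F) y = t
      induction t with
      | zero => simp
      | add p q hp hq => simp only [map_add, hp, hq]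
      | tmul p q =>
        simp only [LinearMap.lTensor_tmul, AlgHom.toLinearMap_apply, delta_apply, mulBy_tmul]
        generalize comul (R := F) q = t
        induction t with
        | zero => simp
        | add p q hp hq => simp only [map_add, TensorProduct.tmul_add, add_mul, hp, hq]
        | tmul q r =>
          rw [TensorProduct.assoc_symm_tmul, hΦ]
          simp only [TensorProduct.lift.tmul, LinearMap.comp_apply, LinearMap.flip_apply,
            LinearMap.id_apply, siteCo_one_lmul, ← mul_assoc, LinearMap.lTensor_tmul,
            AlgHom.toLinearMap_apply, Algebra.TensorProduct.tmul_mul_tmul, one_mul, mul_one]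
    rw [h2, ← coassoc_apply, LinearEquiv.symm_apply_apply]
    generalize comul (R := F) y = t
    induction t with
    | zero => simp
    | add p q hp hq => simp only [map_add, hp, hq]
    | tmul p q =>
      rw [LinearMap.rTensor_tmul, hΦ, hΨ, LinearMap.comp_apply, heisMulLeft_apply, ← twistBy_act]
      rfl
  rw [h1]
  clear h1
  induction b using TensorProduct.induction_on with
  | zero =>
    generalize comul (R := F) y = t
    induction t with
    | zero => simp
    | add p q hp hq => rw [map_add, ← hp, ← hq]; simp
    | tmul p q => simp [hΨ, heisMulLeft_apply]
  | add b b' hb hb' =>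
    rw [map_add, add_mul, hb, hb']
    clear hb hb'
    generalize comul (R := F) y = t
    induction t with
    | zero => simp
    | add p q hp hq => simp only [map_add, ← hp, ← hq]; abel
    | tmul p q => simp [hΨ, heisMulLeft_apply, mul_add]
  | tmul z δ =>
    let Ξ : H ⊗[F] (H ⊗[F] H) →ₗ[F] H ⊗[F] Heis F H :=
      TensorProduct.map (LinearMap.mulLeft F z) (LinearMap.mul' F (Heis F H) ∘ₗ
        (TensorProduct.comm F _ _).toLinearMap ∘ₗ
          TensorProduct.map (heisDualLeft ∘ₗ dualReg F H δ) heisLeft.toLinearMap)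
    have h3 : siteCo 1 (z ⊗ₜ δ) * delta y =
        Ξ (LinearMap.lTensor H comul (comul (R := F) y)) := by
      rw [siteCo_one_tmul, delta_apply]
      generalize comul (R := F) y = t
      induction t with
      | zero => simp
      | add p q hp hq => simp only [map_add, mul_add, hp, hq]
      | tmul p q =>
        simp only [LinearMap.lTensor_tmul, AlgHom.toLinearMap_apply,
          Algebra.TensorProduct.tmul_mul_tmul, heisDualLeft_mul_heisLeft δ (ℛ F q), Ξ,
          TensorProduct.map_tmul, LinearMap.mulLeft_apply]
        congr 1
        conv_rhs => rw [← (ℛ F q).eq]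
        simp
        rfl
    rw [h3, ← coassoc_apply]
    generalize comul (R := F) y = t
    induction t with
    | zero => simp
    | add p q hp hq => simp only [map_add, hp, hq]
    | tmul p r =>
      rw [LinearMap.rTensor_tmul, hΨ, LinearMap.comp_apply, heisMulLeft_apply, heisMul_tmul_left]
      generalize comul (R := F) p = t
      induction t with
      | zero => simp
      | add p q hp hq => simp only [map_add, TensorProduct.add_tmul, mul_add, hp, hq]
      | tmul p q => simp [Ξ, siteCo_one_tmul]

/-- The exchange relation for moving the contribution of the first edge end past an element `y` of
`H` that comes from a later edge end: it costs an action of `y₁` on `b`, as prescribed by the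
braiding. -/
theorem siteCo_mul_delta (s : Fin 2) (b : HH F H) (y : H) :
    siteCo s b * delta y =
      mulBy (siteCo s ∘ₗ act b) (LinearMap.lTensor H delta.toLinearMap (comul (R := F) y)) := by
  fin_cases s
  · exact siteCo_zero_mul_delta b y
  · exact siteCo_one_mul_delta b y

end Site

/-! ### The map `χ` for incoming edge ends -/

section IncomingMul

variable {F H : Type*} [Field F] [Ring H] [HopfAlgebra F H] [FiniteDimensional F H]

/-- The braided tensor product structure of the multiplication, in terms of `act` and `hcoact`. -/
theorem incomingMul_consEquiv {n : ℕ} (σ : Fin (n + 1) → Fin 2) (a b : HH F H)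
    (t u : HHPow F H n) :
    incomingMul F H (n + 1) σ (consEquiv F H n (a ⊗ₜ t)) (consEquiv F H n (b ⊗ₜ u)) =
      consEquiv F H n (TensorProduct.map (localMul F H (σ 0) a ∘ₗ act b)
        ((incomingMul F H n (Fin.tail σ)).flip u) (hcoact n t)) := by
  simp only [incomingMul, LinearMap.compl₁₂_apply, LinearEquiv.coe_coe,
    LinearEquiv.symm_apply_apply, TensorProduct.curry_apply, LinearMap.comp_apply,
    TensorProduct.assoc_tmul, TensorProduct.map_tmul, LinearMap.id_apply,
    TensorProduct.assoc_symm_tmul, braiding_tmul]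
  congr 1
  generalize hcoact n t = s
  induction s with
  | zero => simp
  | add p q hp hq => simp only [map_add, TensorProduct.add_tmul, TensorProduct.tmul_add, hp, hq]
  | tmul p q => simp

end IncomingMul

section Chi

variable {F H : Type*} [Field F] [CharZero F] [Ring H] [HopfAlgebra F H] [FiniteDimensional F H]
  [IsSemisimpleRing H]

/-- The map `a ⊗ t ↦ (f(t₋₁) ⊗ 1) a ⊗ t₀` of `𝓗(H) ⊗ (H ⊗ H^*)^{⊗ n}`. -/
def twistAlong (n : ℕ) (f : H →ₗ[F] H) :
    Heis F H ⊗[F] HHPow F H n →ₗ[F] Heis F H ⊗[F] HHPow F H n :=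
  TensorProduct.lift ((LinearMap.rTensorHom _ ∘ₗ (LinearMap.mul F (Heis F H)).flip).flip ∘ₗ
      TensorProduct.map (heisLeft.toLinearMap ∘ₗ f) LinearMap.id ∘ₗ hcoact n).flip

theorem twistAlong_tmul {n : ℕ} (f : H →ₗ[F] H) (a : Heis F H) (t : HHPow F H n) :
    twistAlong n f (a ⊗ₜ t) = LinearMap.rTensor _ (LinearMap.mulRight F a)
      (TensorProduct.map (heisLeft.toLinearMap ∘ₗ f) LinearMap.id (hcoact n t)) := rfl

/-- The map `χ` for a vertex with incoming edge ends only, `a ⊗ t ↦ (t₋₁ ⊗ 1) φ(a) ⊗ χ(t₀)` with `φ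
= siteMap (σ 0)`: the paths from the later edge ends cross the first one, which contributes the
factor `t₋₁`. -/
def chi : (n : ℕ) → (Fin n → Fin 2) → (HHPow F H n →ₗ[F] HeisPow F H n)
  | 0, _ => (toHeisPow 0).toLinearMap
  | n + 1, σ => (consHeis n).toLinearMap ∘ₗ LinearMap.lTensor _ (chi n (Fin.tail σ)) ∘ₗ
      twistAlong n LinearMap.id ∘ₗ LinearMap.rTensor _ (siteMap (σ 0)) ∘ₗ (consEquiv F H n).symm.toLinearMap

theorem chi_consEquiv {n : ℕ} (σ : Fin (n + 1) → Fin 2) (a : HH F H) (t : HHPow F H n) :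
    chi (n + 1) σ (consEquiv F H n (a ⊗ₜ t)) = consHeis n
      (TensorProduct.map heisLeft.toLinearMap (chi n (Fin.tail σ)) (hcoact n t) *
        (siteMap (σ 0) a ⊗ₜ 1)) := by
  simp only [chi, LinearMap.comp_apply, LinearEquiv.coe_coe, LinearEquiv.symm_apply_apply,
    LinearMap.rTensor_tmul, twistAlong_tmul]
  generalize hcoact n t = u
  change consHeis n _ = _
  congr 1
  induction u with
  | zero => simp
  | add p q hp hq => simp only [map_add, add_mul, hp, hq]
  | tmul p q => simp

/-- The map `t ↦ t₋₁ ⊗ χ(t₀)`. -/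
def chiCo (n : ℕ) (σ : Fin n → Fin 2) : HHPow F H n →ₗ[F] H ⊗[F] HeisPow F H n :=
  LinearMap.lTensor H (chi n σ) ∘ₗ hcoact n

theorem assoc_rTensor_comul_chiCo {n : ℕ} (σ : Fin n → Fin 2) (t : HHPow F H n) :
    TensorProduct.assoc F H H _ (LinearMap.rTensor _ comul (chiCo n σ t)) =
      LinearMap.lTensor H (chiCo n σ) (hcoact n t) := by
  have h : ∀ u : H ⊗[F] HHPow F H n,
      TensorProduct.assoc F H H _ (LinearMap.rTensor _ comul (LinearMap.lTensor H (chi n σ) u)) =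
        LinearMap.lTensor H (LinearMap.lTensor H (chi n σ))
          (TensorProduct.assoc F H H _ (LinearMap.rTensor _ comul u)) := by
    intro u
    induction u with
    | zero => simp
    | add p q hp hq => simp only [map_add, hp, hq]
    | tmul p q =>
      simp only [LinearMap.lTensor_tmul, LinearMap.rTensor_tmul]
      generalize comul (R := F) p = s
      induction s with
      | zero => simp
      | add p q hp hq => simp only [map_add, TensorProduct.add_tmul, hp, hq]
      | tmul p q => simp
  rw [chiCo, LinearMap.comp_apply, h, hcoact_coassoc, ← LinearMap.comp_apply,
    ← LinearMap.lTensor_comp]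

theorem spread_chiCo {n : ℕ} (σ : Fin n → Fin 2) (t : HHPow F H n) :
    spread delta (chiCo n σ t) = LinearMap.lTensor H
      (TensorProduct.map heisLeft.toLinearMap (chi n σ) ∘ₗ hcoact n) (hcoact n t) := by
  have h : ∀ u : H ⊗[F] HHPow F H n, spread delta (LinearMap.lTensor H (chi n σ) u) =
      LinearMap.lTensor H (TensorProduct.map heisLeft.toLinearMap (chi n σ))
        (TensorProduct.assoc F H H _ (LinearMap.rTensor _ comul u)) := by
    intro u
    induction u with
    | zero => simp
    | add p q hp hq => simp only [map_add, hp, hq]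
    | tmul p q =>
      simp only [LinearMap.lTensor_tmul, LinearMap.rTensor_tmul, spread_tmul, delta_apply]
      generalize comul (R := F) p = s
      induction s with
      | zero => simp
      | add p q hp hq => simp only [map_add, TensorProduct.add_tmul, hp, hq]
      | tmul p q => simp
  rw [chiCo, LinearMap.comp_apply, h, hcoact_coassoc, ← LinearMap.comp_apply,
    ← LinearMap.lTensor_comp]

/-- The algebra morphism `H ⊗ (𝓗(H) ⊗ 𝓗(H)^{⊗ n}) → H ⊗ 𝓗(H)^{⊗ (n + 1)}` induced by `consHeis`. -/
def consCo (n : ℕ) : H ⊗[F] (Heis F H ⊗[F] HeisPow F H n) →ₐ[F] H ⊗[F] HeisPow F H (n + 1) :=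
  Algebra.TensorProduct.map (AlgHom.id F H) (consHeis n).toAlgHom

theorem consCo_tmul {n : ℕ} (h : H) (u : Heis F H ⊗[F] HeisPow F H n) :
    consCo n (h ⊗ₜ u) = h ⊗ₜ consHeis n u := rfl

/-- Recursion for `χ` together with the coaction of `H`. All factors are algebra morphisms applied
to the corresponding maps for the first edge end and the remaining edge ends. -/
theorem chiCo_consEquiv {n : ℕ} (σ : Fin (n + 1) → Fin 2) (a : HH F H) (t : HHPow F H n) :
    chiCo (n + 1) σ (consEquiv F H n (a ⊗ₜ t)) = consCo n
      (spread delta (chiCo n (Fin.tail σ) t) * extend (siteCo (σ 0) a)) := by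
  rw [chiCo, LinearMap.comp_apply, hcoact_consEquiv, spread_chiCo, siteCo, LinearMap.comp_apply]
  generalize leftCoact F H a = s
  generalize hcoact n t = u
  induction s with
  | zero => simp
  | add p q hp hq => simp only [map_add, TensorProduct.add_tmul, mul_add, hp, hq]
  | tmul h a =>
    induction u with
    | zero => simp
    | add p q hp hq => simp only [map_add, TensorProduct.tmul_add, add_mul, hp, hq]
    | tmul k t =>
      simp only [TensorProduct.tensorTensorTensorComm_tmul, TensorProduct.map_tmul,
        TensorProduct.lift.tmul, LinearMap.flip_apply, LinearMap.mul_apply', LinearEquiv.coe_coe,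
        LinearMap.lTensor_tmul, chi_consEquiv, LinearMap.comp_apply, extend_tmul,
        Algebra.TensorProduct.tmul_mul_tmul, consCo_tmul]

theorem lid_counit_chiCo {n : ℕ} (σ : Fin n → Fin 2) (t : HHPow F H n) :
    TensorProduct.lid F _ (LinearMap.rTensor _ counit (chiCo n σ t)) = chi n σ t := by
  have h : ∀ u : H ⊗[F] HHPow F H n,
      TensorProduct.lid F _ (LinearMap.rTensor _ counit (LinearMap.lTensor H (chi n σ) u)) =
        chi n σ (TensorProduct.lid F _ (LinearMap.rTensor _ counit u)) := by
    intro u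
    induction u with
    | zero => simp
    | add p q hp hq => simp only [map_add, hp, hq]
    | tmul p q => simp
  rw [chiCo, LinearMap.comp_apply, h, lid_counit_hcoact]

/-- The algebra morphism `h ⊗ x ↦ ε(h) x`. -/
def counitLeft (n : ℕ) : H ⊗[F] HeisPow F H n →ₐ[F] HeisPow F H n :=
  (Algebra.TensorProduct.lid F (HeisPow F H n)).toAlgHom.comp
    (Algebra.TensorProduct.map (Bialgebra.counitAlgHom F H) (AlgHom.id F _))

theorem counitLeft_chiCo {n : ℕ} (σ : Fin n → Fin 2) (t : HHPow F H n) :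
    counitLeft n (chiCo n σ t) = chi n σ t := lid_counit_chiCo σ t

theorem chi_powOne {n : ℕ} (σ : Fin n → Fin 2) : chi n σ (powOne F H n) = 1 := by
  induction n with
  | zero => rfl
  | succ n ih =>
    rw [← consEquiv_ddOne_powOne, chi_consEquiv, hcoact_powOne, TensorProduct.map_tmul, ih,
      siteMap_ddOne, AlgHom.toLinearMap_apply, map_one, ← Algebra.TensorProduct.one_def, mul_one,
      map_one]

theorem chiCo_powOne {n : ℕ} (σ : Fin n → Fin 2) : chiCo n σ (powOne F H n) = 1 := by
  rw [chiCo, LinearMap.comp_apply, hcoact_powOne, LinearMap.lTensor_tmul, chi_powOne]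
  rfl

/-- The map `t ↦ t₋₁ ⊗ χ(t₀)` is antimultiplicative. The induction over `n` needs the statement with
the coaction: the exchange relation `siteCo_mul_delta` reorders the factors of two neighbouring
products in the same way as the braiding does. -/
theorem chiCo_incomingMul {n : ℕ} (σ : Fin n → Fin 2) (t u : HHPow F H n) :
    chiCo n σ (incomingMul F H n σ t u) = chiCo n σ u * chiCo n σ t := by
  induction n with
  | zero =>
    have h : ∀ v : HHPow F H 0, ∃ c : F, v = c • powOne F H 0 := by
      intro v
      induction v using PiTensorProduct.induction_on with
      | smul_tprod r f => exact ⟨r, by rw [powOne, Subsingleton.elim f]⟩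
      | add v w hv hw =>
        obtain ⟨c, rfl⟩ := hv
        obtain ⟨d, rfl⟩ := hw
        exact ⟨c + d, (add_smul c d _).symm⟩
    obtain ⟨c, rfl⟩ := h t
    obtain ⟨d, rfl⟩ := h u
    have h1 : incomingMul F H 0 σ (powOne F H 0) (powOne F H 0) = powOne F H 0 := by
      rw [incomingMul, ddPowMul, powOne, PiTensorProduct.map₂_tprod_tprod]
      exact congrArg _ (Subsingleton.elim _ _)
    simp only [map_smul, LinearMap.smul_apply, h1, chiCo_powOne, smul_mul_smul_comm, mul_one,
      smul_smul, mul_comm]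
  | succ n ih =>
    obtain ⟨v, rfl⟩ := (consEquiv F H n).surjective t
    obtain ⟨w, rfl⟩ := (consEquiv F H n).surjective u
    induction v using TensorProduct.induction_on with
    | zero => simp
    | add p q hp hq => simp only [map_add, LinearMap.add_apply, mul_add, hp, hq]
    | tmul a t =>
      induction w using TensorProduct.induction_on with
      | zero => simp
      | add p q hp hq => simp only [map_add, add_mul, hp, hq]
      | tmul b u =>
        rw [incomingMul_consEquiv, chiCo_consEquiv, chiCo_consEquiv, ← map_mul, mul_assoc,
          ← mul_assoc (extend _), extend_mul_spread delta (siteCo (σ 0) ∘ₗ act b) _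
            (siteCo_mul_delta (σ 0) b), assoc_rTensor_comul_chiCo]
        generalize hcoact n t = s
        induction s with
        | zero => simp
        | add p q hp hq => simp only [map_add, mul_add, add_mul, hp, hq]
        | tmul k t =>
          simp only [TensorProduct.map_tmul, LinearMap.comp_apply, LinearMap.flip_apply,
            chiCo_consEquiv, ih, map_mul, siteCo_localMul, LinearMap.lTensor_tmul, mulBy_tmul,
            AlgHom.toLinearMap_apply, mul_assoc]

theorem chi_incomingMul {n : ℕ} (σ : Fin n → Fin 2) (t u : HHPow F H n) :
    chi n σ (incomingMul F H n σ t u) = chi n σ u * chi n σ t := by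
  rw [← counitLeft_chiCo, chiCo_incomingMul, map_mul, counitLeft_chiCo, counitLeft_chiCo]

theorem chiCo_tprod {n : ℕ} (σ : Fin n → Fin 2) (f : Fin n → HH F H) :
    chiCo n σ (PiTensorProduct.tprod F f) =
      ((List.finRange n).map fun i => chiCo n σ (single F H i (f i))).reverse.prod := by
  induction n with
  | zero =>
    rw [Subsingleton.elim f fun _ => ddOne F H]
    exact chiCo_powOne σ
  | succ n ih =>
    have h0 : chiCo (n + 1) σ (single F H 0 (f 0)) = consCo n (extend (siteCo (σ 0) (f 0))) := by
      rw [single_zero, chiCo_consEquiv, chiCo_powOne, map_one, one_mul]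
    have h1 : ∀ j : Fin n, chiCo (n + 1) σ (single F H j.succ (f j.succ)) =
        (consCo n).comp (spread delta) (chiCo n (Fin.tail σ) (single F H j (Fin.tail f j))) := by
      intro j
      rw [single_succ, chiCo_consEquiv, siteCo_ddOne, map_one, mul_one]
      rfl
    have h2 : (PiTensorProduct.tprod F f : HHPow F H (n + 1)) =
        consEquiv F H n (f 0 ⊗ₜ PiTensorProduct.tprod F (Fin.tail f)) := by
      rw [consEquiv_tmul_tprod, Fin.cons_self_tail]
    rw [h2, chiCo_consEquiv, ih, List.finRange_succ, List.map_cons, List.reverse_cons,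
      List.prod_append, List.prod_singleton, h0, map_mul, List.map_map]
    congr 1
    simp only [Function.comp_def, h1]
    rw [← AlgHom.comp_apply, map_list_prod, List.map_reverse, List.map_map]
    rfl

theorem chi_tprod {n : ℕ} (σ : Fin n → Fin 2) (f : Fin n → HH F H) :
    chi n σ (PiTensorProduct.tprod F f) =
      ((List.finRange n).map fun i => chi n σ (single F H i (f i))).reverse.prod := by
  rw [← counitLeft_chiCo, chiCo_tprod, map_list_prod, List.map_reverse, List.map_map]
  simp only [Function.comp_def, counitLeft_chiCo]

theorem chi_single_zero {n : ℕ} (σ : Fin (n + 1) → Fin 2) (a : HH F H) :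
    chi (n + 1) σ (single F H 0 a) = consHeis n (siteMap (σ 0) a ⊗ₜ 1) := by
  rw [single_zero, chi_consEquiv, hcoact_powOne, TensorProduct.map_tmul, chi_powOne,
    AlgHom.toLinearMap_apply, map_one, ← Algebra.TensorProduct.one_def, one_mul]

end Chi

/-! ### Bijectivity of `χ` -/

section Functionals

variable {F H : Type*} [Field F] [Ring H] [HopfAlgebra F H]

theorem ddCounit_ddOne : ddCounit F H (ddOne F H) = 1 := by
  simp [ddCounit, ddOne, dualCounit]

theorem exists_powOne_eq_one (n : ℕ) : ∃ κ : Module.Dual F (HHPow F H n), κ (powOne F H n) = 1 := by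
  refine ⟨PiTensorProduct.lift ((MultilinearMap.mkPiAlgebra F (Fin n) F).compLinearMap
    fun _ => ddCounit F H), ?_⟩
  rw [powOne, PiTensorProduct.lift.tprod]
  simp [ddCounit_ddOne]

theorem injective_of_rTensor {A B C : Type*} [AddCommMonoid A] [Module F A] [AddCommMonoid B]
    [Module F B] [AddCommMonoid C] [Module F C] {f : A →ₗ[F] B} (h : Function.Injective (f.rTensor C))
    {c : C} {κ : Module.Dual F C} (hc : κ c = 1) : Function.Injective f := by
  intro a b hab
  have h1 : a ⊗ₜ[F] c = b ⊗ₜ c := h (by simp [hab])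
  simpa [hc] using congr(TensorProduct.rid F A (LinearMap.lTensor A κ $h1))

theorem surjective_of_rTensor {A B C : Type*} [AddCommMonoid A] [Module F A] [AddCommMonoid B]
    [Module F B] [AddCommMonoid C] [Module F C] {f : A →ₗ[F] B} (h : Function.Surjective (f.rTensor C))
    {c : C} {κ : Module.Dual F C} (hc : κ c = 1) : Function.Surjective f := by
  intro b
  obtain ⟨z, hz⟩ := h (b ⊗ₜ c)
  refine ⟨TensorProduct.rid F A (LinearMap.lTensor A κ z), ?_⟩
  have h1 : f (TensorProduct.rid F A (LinearMap.lTensor A κ z)) =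
      TensorProduct.rid F B (LinearMap.lTensor B κ (f.rTensor C z)) := by
    clear hz
    induction z with
    | zero => simp
    | add p q hp hq => simp only [map_add, hp, hq]
    | tmul p q => simp
  rw [h1, hz]
  simp [hc]

theorem bijective_rTensor_iff {A B C : Type*} [AddCommMonoid A] [Module F A] [AddCommMonoid B]
    [Module F B] [AddCommMonoid C] [Module F C] {f : A →ₗ[F] B} {c : C} {κ : Module.Dual F C}
    (hc : κ c = 1) : Function.Bijective (f.rTensor C) ↔ Function.Bijective f :=
  ⟨fun h => ⟨injective_of_rTensor h.1 hc, surjective_of_rTensor h.2 hc⟩,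
    fun h => ((LinearEquiv.ofBijective f h).rTensor C).bijective⟩

theorem bijective_lTensor_iff {A B C : Type*} [AddCommMonoid A] [Module F A] [AddCommMonoid B]
    [Module F B] [AddCommMonoid C] [Module F C] {f : A →ₗ[F] B} {c : C} {κ : Module.Dual F C}
    (hc : κ c = 1) : Function.Bijective (f.lTensor C) ↔ Function.Bijective f := by
  have h : (f.lTensor C : _ → _) = TensorProduct.comm F _ _ ∘ f.rTensor C ∘
      TensorProduct.comm F _ _ := by
    funext z
    rw [← LinearMap.comm_comp_rTensor_comp_comm_eq]
    rfl
  rw [h, EquivLike.comp_bijective, EquivLike.bijective_comp, bijective_rTensor_iff hc]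

end Functionals

section Bijective

variable {F H : Type*} [Field F] [CharZero F] [Ring H] [HopfAlgebra F H] [FiniteDimensional F H]
  [IsSemisimpleRing H]

theorem twistAlong_twistAlong {n : ℕ} {f g : H →ₗ[F] H}
    (hfg : ∀ h : H, LinearMap.mul' F H (TensorProduct.comm F H H
      (TensorProduct.map g f (comul (R := F) h))) = counit (R := F) h • 1)
    (v : Heis F H ⊗[F] HHPow F H n) : twistAlong n f (twistAlong n g v) = v := by
  induction v using TensorProduct.induction_on with
  | zero => simp
  | add p q hp hq => simp only [map_add, hp, hq]
  | tmul a t =>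
    let Φ : H ⊗[F] (H ⊗[F] HHPow F H n) →ₗ[F] Heis F H ⊗[F] HHPow F H n :=
      LinearMap.rTensor _ (LinearMap.mulRight F a ∘ₗ heisLeft.toLinearMap ∘ₗ LinearMap.mul' F H ∘ₗ
        (TensorProduct.comm F H H).toLinearMap ∘ₗ TensorProduct.map g f) ∘ₗ
          (TensorProduct.assoc F H H _).symm.toLinearMap
    have h1 : twistAlong n f (twistAlong n g (a ⊗ₜ t)) =
        Φ (LinearMap.lTensor H (hcoact n) (hcoact n t)) := by
      rw [twistAlong_tmul]
      generalize hcoact n t = u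
      induction u with
      | zero => simp
      | add p q hp hq => simp only [map_add, hp, hq]
      | tmul h t =>
        simp only [TensorProduct.map_tmul, LinearMap.rTensor_tmul, LinearMap.lTensor_tmul,
          twistAlong_tmul, LinearMap.id_apply]
        generalize hcoact n t = u
        induction u with
        | zero => simp
        | add p q hp hq => simp only [map_add, TensorProduct.tmul_add, hp, hq]
        | tmul k t => simp [Φ, mul_assoc]
    have h2 : ∀ u : H ⊗[F] HHPow F H n,
        Φ (TensorProduct.assoc F H H _ (LinearMap.rTensor _ comul u)) =
          a ⊗ₜ TensorProduct.lid F _ (LinearMap.rTensor _ counit u) := by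
      intro u
      induction u with
      | zero => simp
      | add p q hp hq => simp only [map_add, TensorProduct.tmul_add, hp, hq]
      | tmul h t =>
        rw [LinearMap.rTensor_tmul]
        simp only [Φ, LinearMap.comp_apply, LinearEquiv.coe_coe, LinearEquiv.symm_apply_apply,
          LinearMap.rTensor_tmul, hfg]
        simp [TensorProduct.smul_tmul]
    rw [h1, ← hcoact_coassoc, h2, lid_counit_hcoact]

theorem bijective_twistAlong_id (n : ℕ) :
    Function.Bijective (twistAlong (F := F) (H := H) n LinearMap.id) := by
  refine Function.bijective_iff_has_inverse.mpr ⟨twistAlong n (antipode F), fun v => ?_, fun v => ?_⟩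
  · refine twistAlong_twistAlong (f := antipode F) (g := LinearMap.id) (fun h => ?_) v
    rw [← OpConv.mk_mul_mk_eval, ← OpConv.one_eval]
    exact congr(OpConv.eval $(OpConv.idOp_mul_antipodeOp (F := F) (H := H)) h)
  · exact twistAlong_twistAlong (f := LinearMap.id) (g := antipode F) mul'_comm_antipode_comul v

/-- The twist in the recursion for `χ` is invertible, so that bijectivity of `χ` can be tested on
the first edge end and the remaining edge ends separately. -/
theorem bijective_chi_succ {n : ℕ} (σ : Fin (n + 1) → Fin 2) :
    Function.Bijective (chi (F := F) (H := H) (n + 1) σ) ↔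
      Function.Bijective (siteMap (F := F) (H := H) (σ 0)) ∧
        Function.Bijective (chi (F := F) (H := H) n (Fin.tail σ)) := by
  have hcomp : (chi (F := F) (H := H) (n + 1) σ : _ → _) = consHeis n ∘
      LinearMap.lTensor _ (chi n (Fin.tail σ)) ∘ twistAlong n LinearMap.id ∘
        LinearMap.rTensor _ (siteMap (σ 0)) ∘ (consEquiv F H n).symm := rfl
  rw [hcomp, EquivLike.comp_bijective]
  simp only [← Function.comp_assoc]
  rw [EquivLike.bijective_comp]
  let κ₁ : Module.Dual F (Heis F H) := ddCounit F H ∘ₗ toHeis.symm.toLinearMap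
  have hκ₁ : κ₁ 1 = 1 := ddCounit_ddOne
  have hchi := bijective_lTensor_iff (f := chi (F := F) (H := H) n (Fin.tail σ)) hκ₁
  obtain ⟨κ, hκ⟩ := exists_powOne_eq_one (F := F) (H := H) n
  have hsite := bijective_rTensor_iff (f := siteMap (F := F) (H := H) (σ 0)) hκ
  constructor
  · intro h
    have h1 : Function.Bijective (siteMap (F := F) (H := H) (σ 0)) := by
      have hi := injective_of_rTensor (Function.Injective.of_comp h.1) hκ
      have hi' : Function.Injective (toHeis.symm.toLinearMap ∘ₗ siteMap (F := F) (H := H) (σ 0)) :=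
        toHeis.symm.injective.comp hi
      have hs := LinearMap.injective_iff_surjective.mp hi'
      refine ⟨hi, ?_⟩
      exact (EquivLike.comp_surjective _ toHeis.symm).mp hs
    refine ⟨h1, ?_⟩
    rw [← hchi]
    exact (Function.Bijective.of_comp_iff _ (bijective_twistAlong_id n)).mp
      ((Function.Bijective.of_comp_iff _ (hsite.mpr h1)).mp h)
  · rintro ⟨h1, h2⟩
    exact ((hchi.mpr h2).comp (bijective_twistAlong_id n)).comp (hsite.mpr h1)

theorem bijective_siteMap_zero : Function.Bijective (siteMap (F := F) (H := H) 0) :=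
  toHeis.bijective

/-- For `s = 1` the factor `y` of `y ⊗ γ` is replaced by `ε(y)`, so that bijectivity forces `H = F`.
-/
theorem bijective_siteMap_one :
    Function.Bijective (siteMap (F := F) (H := H) 1) ↔ Module.finrank F H = 1 := by
  constructor
  · intro h
    have h1 : (1 : H) ≠ 0 := fun h1 => by simpa using congr(counit (R := F) $h1)
    refine finrank_eq_one 1 h1 fun y => ⟨counit (R := F) y, ?_⟩
    -- `siteMap 1` annihilates `z ⊗ 1` for `z` in the kernel of the counit.
    have h2 : (y - counit (R := F) y • 1) ⊗ₜ[F] (counit : Module.Dual F H) = 0 :=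
      h.1 (by rw [siteMap_one_tmul]; simp)
    have h3 := congr(rho F H $h2)
    rw [rho_tmul] at h3
    rw [Bialgebra.counit_one, one_smul, map_zero, sub_eq_zero] at h3
    exact h3.symm
  · intro h
    have h1 : Module.finrank F (HH F H) = 1 := by
      rw [Module.finrank_tensorProduct, Subspace.dual_finrank_eq, h]
    have h2 : ddOne F H ≠ 0 := fun h2 => by simpa [ddCounit_ddOne] using congr(ddCounit F H $h2)
    have h3 : siteMap (F := F) (H := H) 1 = siteMap 0 := by
      refine LinearMap.ext fun a => ?_
      obtain ⟨c, rfl⟩ := exists_smul_eq_of_finrank_eq_one h1 h2 a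
      rw [map_smul, map_smul, siteMap_ddOne, siteMap_ddOne]
    rw [h3]
    exact bijective_siteMap_zero

theorem bijective_chi {n : ℕ} (σ : Fin n → Fin 2) :
    Function.Bijective (chi (F := F) (H := H) n σ) ↔ (∀ i, σ i = 0) ∨ Module.finrank F H = 1 := by
  have h : ∀ {n : ℕ} (σ : Fin n → Fin 2), Function.Bijective (chi (F := F) (H := H) n σ) ↔
      ∀ i, Function.Bijective (siteMap (F := F) (H := H) (σ i)) := by
    intro n
    induction n with
    | zero => exact fun σ => ⟨fun _ i => i.elim0, fun _ => (toHeisPow 0).bijective⟩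
    | succ n ih => exact fun σ => by rw [bijective_chi_succ, ih, Fin.forall_fin_succ]; rfl
  have h2 : ∀ s : Fin 2, Function.Bijective (siteMap (F := F) (H := H) s) ↔
      s = 0 ∨ Module.finrank F H = 1 := by
    intro s
    fin_cases s
    · exact ⟨fun _ => Or.inl rfl, fun _ => bijective_siteMap_zero⟩
    · refine bijective_siteMap_one.trans ⟨Or.inr, fun h => h.resolve_left (by decide)⟩
  rw [h]
  simp only [h2]
  by_cases hd : Module.finrank F H = 1 <;> simp [hd]

end Bijective

/-! ### Convolution products along lists of edge ends -/

section Convolution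

variable {F H : Type*} [Field F] [Ring H] [HopfAlgebra F H]

theorem ddMul_assoc (a b c : HH F H) :
    ddMul F H (ddMul F H a b) c = ddMul F H a (ddMul F H b c) := by
  induction a using TensorProduct.induction_on with
  | zero => simp
  | add p q hp hq => simp only [map_add, LinearMap.add_apply, hp, hq]
  | tmul x α =>
    induction b using TensorProduct.induction_on with
    | zero => simp
    | add p q hp hq => simp only [map_add, LinearMap.add_apply, hp, hq]
    | tmul y β =>
      induction c using TensorProduct.induction_on with
      | zero => simp
      | add p q hp hq => simp only [map_add, hp, hq]
      | tmul z γ => simp only [ddMul_tmul, mul_assoc, dualMul_assoc]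

theorem ddOne_ddMul (a : HH F H) : ddMul F H (ddOne F H) a = a := by
  induction a using TensorProduct.induction_on with
  | zero => simp
  | add p q hp hq => simp only [map_add, hp, hq]
  | tmul x α => rw [ddOne, ddMul_tmul, counit_dualMul, mul_one]

theorem ddMul_ddOne (a : HH F H) : ddMul F H a (ddOne F H) = a := by
  induction a using TensorProduct.induction_on with
  | zero => simp
  | add p q hp hq => simp only [map_add, LinearMap.add_apply, hp, hq]
  | tmul x α => rw [ddOne, ddMul_tmul, dualMul_counit, one_mul]

theorem ddPowMul_tprod {n : ℕ} (f g : Fin n → HH F H) :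
    ddPowMul F H n (PiTensorProduct.tprod F f) (PiTensorProduct.tprod F g) =
      PiTensorProduct.tprod F fun i => ddMul F H (f i) (g i) :=
  PiTensorProduct.map₂_tprod_tprod _ _ _

theorem ddPowMul_consEquiv {n : ℕ} (a b : HH F H) (t u : HHPow F H n) :
    ddPowMul F H (n + 1) (consEquiv F H n (a ⊗ₜ t)) (consEquiv F H n (b ⊗ₜ u)) =
      consEquiv F H n (ddMul F H a b ⊗ₜ ddPowMul F H n t u) := by
  induction t using PiTensorProduct.induction_on with
  | add a b ha hb => simp only [map_add, LinearMap.add_apply, TensorProduct.tmul_add, ha, hb]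
  | smul_tprod r f =>
    induction u using PiTensorProduct.induction_on with
    | add a b ha hb => simp only [map_add, TensorProduct.tmul_add, ha, hb]
    | smul_tprod s g =>
      simp only [map_smul, LinearMap.smul_apply, TensorProduct.tmul_smul, consEquiv_tmul_tprod,
        ddPowMul_tprod]
      congr 3
      funext i
      refine Fin.cases ?_ (fun j => ?_) i <;> simp

theorem ddPowMul_assoc {n : ℕ} (a b c : HHPow F H n) :
    ddPowMul F H n (ddPowMul F H n a b) c = ddPowMul F H n a (ddPowMul F H n b c) := by
  induction a using PiTensorProduct.induction_on with
  | add a b ha hb => simp only [map_add, LinearMap.add_apply, ha, hb]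
  | smul_tprod r f =>
    induction b using PiTensorProduct.induction_on with
    | add a b ha hb => simp only [map_add, LinearMap.add_apply, ha, hb]
    | smul_tprod r g =>
      induction c using PiTensorProduct.induction_on with
      | add a b ha hb => simp only [map_add, ha, hb]
      | smul_tprod r h =>
        simp only [map_smul, LinearMap.smul_apply, ddPowMul_tprod, ddMul_assoc]

theorem powOne_ddPowMul {n : ℕ} (a : HHPow F H n) : ddPowMul F H n (powOne F H n) a = a := by
  induction a using PiTensorProduct.induction_on with
  | add a b ha hb => simp only [map_add, ha, hb]
  | smul_tprod r f => simp only [map_smul, powOne, ddPowMul_tprod, ddOne_ddMul]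

theorem ddPowMul_powOne {n : ℕ} (a : HHPow F H n) : ddPowMul F H n a (powOne F H n) = a := by
  induction a using PiTensorProduct.induction_on with
  | add a b ha hb => simp only [map_add, LinearMap.add_apply, ha, hb]
  | smul_tprod r f =>
    simp only [map_smul, LinearMap.smul_apply, powOne, ddPowMul_tprod, ddMul_ddOne]

theorem single_ddPowMul_single {n : ℕ} (i : Fin n) (a b : HH F H) :
    ddPowMul F H n (single F H i a) (single F H i b) = single F H i (ddMul F H a b) := by
  rw [single_apply, single_apply, single_apply, ddPowMul_tprod]
  congr 1
  funext j
  by_cases h : j = i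
  · subst h
    simp
  · simp [Function.update_of_ne h, ddMul_ddOne]

/-- The convolution `v ↦ m(v₋₁) g(v₀)` of linear maps `m : H → (D(H)^*)^{⊗ n}` and
`g : V → (D(H)^*)^{⊗ n}`, with respect to a coaction `v ↦ v₋₁ ⊗ v₀` of `H` on `V`. -/
def convAlong {V : Type*} [AddCommGroup V] [Module F V] {n : ℕ} (κ : V →ₗ[F] H ⊗[F] V)
    (m : H →ₗ[F] HHPow F H n) (g : V →ₗ[F] HHPow F H n) : V →ₗ[F] HHPow F H n :=
  TensorProduct.lift ((ddPowMul F H n).compl₁₂ m g) ∘ₗ κ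

theorem convAlong_apply {V : Type*} [AddCommGroup V] [Module F V] {n : ℕ} (κ : V →ₗ[F] H ⊗[F] V)
    (m : H →ₗ[F] HHPow F H n) (g : V →ₗ[F] HHPow F H n) (v : V) :
    convAlong κ m g v = TensorProduct.lift ((ddPowMul F H n).compl₁₂ m g) (κ v) := rfl

theorem convAlong_convAlong {V : Type*} [AddCommGroup V] [Module F V] {n : ℕ}
    {κ : V →ₗ[F] H ⊗[F] V} (hκ : ∀ v, TensorProduct.assoc F H H V (LinearMap.rTensor V comul (κ v)) =
      LinearMap.lTensor H κ (κ v))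
    (m m' : H →ₗ[F] HHPow F H n) (g : V →ₗ[F] HHPow F H n) :
    convAlong κ m (convAlong κ m' g) = convAlong κ (convAlong comul m m') g := by
  let Φ : H ⊗[F] (H ⊗[F] V) →ₗ[F] HHPow F H n := TensorProduct.lift
    ((ddPowMul F H n).compl₁₂ m (TensorProduct.lift ((ddPowMul F H n).compl₁₂ m' g)))
  have h1 : ∀ u : H ⊗[F] V, TensorProduct.lift ((ddPowMul F H n).compl₁₂ m (convAlong κ m' g)) u =
      Φ (LinearMap.lTensor H κ u) := by
    intro u
    induction u with
    | zero => simp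
    | add p q hp hq => simp only [map_add, hp, hq]
    | tmul p q => simp [Φ, convAlong]
  have h2 : ∀ u : H ⊗[F] V, TensorProduct.lift
      ((ddPowMul F H n).compl₁₂ (convAlong comul m m') g) u =
        Φ (TensorProduct.assoc F H H V (LinearMap.rTensor V comul u)) := by
    intro u
    induction u with
    | zero => simp
    | add p q hp hq => simp only [map_add, hp, hq]
    | tmul p v =>
      simp only [TensorProduct.lift.tmul, LinearMap.compl₁₂_apply, convAlong_apply,
        LinearMap.rTensor_tmul]
      generalize comul (R := F) p = s
      induction s with
      | zero => simp
      | add p q hp hq => simp only [map_add, LinearMap.add_apply, TensorProduct.add_tmul, hp, hq]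
      | tmul p q => simp [Φ, ddPowMul_assoc]
  refine LinearMap.ext fun v => ?_
  rw [convAlong_apply, convAlong_apply, h1, h2, hκ]

theorem convAlong_comul_assoc {n : ℕ} (m m' m'' : H →ₗ[F] HHPow F H n) :
    convAlong comul m (convAlong comul m' m'') = convAlong comul (convAlong comul m m') m'' :=
  convAlong_convAlong (V := H) (κ := comul) (fun v => coassoc_apply v) m m' m''

/-- The unit `y ↦ ε(y) 1` of the convolution product. -/
def convUnit (F H : Type*) [Field F] [Ring H] [HopfAlgebra F H] (n : ℕ) : H →ₗ[F] HHPow F H n :=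
  LinearMap.toSpanSingleton F _ (powOne F H n) ∘ₗ counit

theorem convUnit_apply (n : ℕ) (y : H) : convUnit F H n y = counit (R := F) y • powOne F H n := rfl

theorem convUnit_convAlong {V : Type*} [AddCommGroup V] [Module F V] {n : ℕ}
    {κ : V →ₗ[F] H ⊗[F] V} (hκ : ∀ v, TensorProduct.lid F V (LinearMap.rTensor V counit (κ v)) = v)
    (g : V →ₗ[F] HHPow F H n) : convAlong κ (convUnit F H n) g = g := by
  have h : ∀ u : H ⊗[F] V, TensorProduct.lift ((ddPowMul F H n).compl₁₂ (convUnit F H n) g) u =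
      g (TensorProduct.lid F V (LinearMap.rTensor V counit u)) := by
    intro u
    induction u with
    | zero => simp
    | add p q hp hq => simp only [map_add, hp, hq]
    | tmul p q => simp [convUnit_apply, powOne_ddPowMul]
  refine LinearMap.ext fun v => ?_
  rw [convAlong_apply, h, hκ]

theorem convUnit_convAlong_comul {n : ℕ} (m : H →ₗ[F] HHPow F H n) :
    convAlong comul (convUnit F H n) m = m :=
  convUnit_convAlong (fun v => by rw [rTensor_counit_comul]; simp) m

theorem convAlong_comul_convUnit {n : ℕ} (m : H →ₗ[F] HHPow F H n) :
    convAlong comul m (convUnit F H n) = m := by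
  have h : ∀ u : H ⊗[F] H, TensorProduct.lift ((ddPowMul F H n).compl₁₂ m (convUnit F H n)) u =
      m (contractRight counit u) := by
    intro u
    induction u with
    | zero => simp
    | add p q hp hq => simp only [map_add, hp, hq]
    | tmul p q => simp [convUnit_apply, ddPowMul_powOne]
  refine LinearMap.ext fun v => ?_
  rw [convAlong_apply, h, contractRight_counit_comul]

/-- The map `t ↦ 1 ⊗ t`. -/
def consOne (F H : Type*) [Field F] [Ring H] [HopfAlgebra F H] (n : ℕ) :
    HHPow F H n →ₗ[F] HHPow F H (n + 1) :=
  (consEquiv F H n).toLinearMap ∘ₗ TensorProduct.mk F _ _ (ddOne F H)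

theorem consOne_apply {n : ℕ} (t : HHPow F H n) :
    consOne F H n t = consEquiv F H n (ddOne F H ⊗ₜ t) := rfl

theorem convAlong_consOne {V : Type*} [AddCommGroup V] [Module F V] {n : ℕ} (κ : V →ₗ[F] H ⊗[F] V)
    (m : H →ₗ[F] HHPow F H n) (g : V →ₗ[F] HHPow F H n) :
    convAlong κ (consOne F H n ∘ₗ m) (consOne F H n ∘ₗ g) = consOne F H n ∘ₗ convAlong κ m g := by
  refine LinearMap.ext fun v => ?_
  rw [LinearMap.comp_apply, convAlong_apply, convAlong_apply]
  generalize κ v = u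
  induction u with
  | zero => simp
  | add p q hp hq => simp only [map_add, hp, hq]
  | tmul p q => simp [consOne_apply, ddPowMul_consEquiv, ddOne_ddMul]

theorem convAlong_single_zero {V : Type*} [AddCommGroup V] [Module F V] {n : ℕ}
    (κ : V →ₗ[F] H ⊗[F] V) (f : H →ₗ[F] HH F H) (g : V →ₗ[F] HHPow F H n) (v : V) :
    convAlong κ (single F H 0 ∘ₗ f) (consOne F H n ∘ₗ g) v =
      consEquiv F H n (TensorProduct.map f g (κ v)) := by
  rw [convAlong_apply]
  generalize κ v = u
  induction u with
  | zero => simp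
  | add p q hp hq => simp only [map_add, hp, hq]
  | tmul p q =>
    simp [consOne_apply, single_zero, ddPowMul_consEquiv, ddMul_ddOne, powOne_ddPowMul]

/-- The convolution product of the maps `y ↦ (l_j(y))_j`, for `j` in a list. -/
def listConv {n : ℕ} (l : Fin n → H →ₗ[F] HH F H) : List (Fin n) → (H →ₗ[F] HHPow F H n)
  | [] => convUnit F H n
  | j :: L => convAlong comul (single F H j ∘ₗ l j) (listConv l L)

theorem listConv_append_singleton {n : ℕ} (l : Fin n → H →ₗ[F] HH F H) (L : List (Fin n))
    (j : Fin n) :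
    listConv l (L ++ [j]) = convAlong comul (listConv l L) (single F H j ∘ₗ l j) := by
  induction L with
  | nil => exact (convAlong_comul_convUnit _).trans (convUnit_convAlong_comul _).symm
  | cons k L ih => rw [List.cons_append, listConv, ih, listConv, convAlong_comul_assoc]

theorem consOne_comp_convUnit (n : ℕ) : consOne F H n ∘ₗ convUnit F H n = convUnit F H (n + 1) := by
  refine LinearMap.ext fun y => ?_
  rw [LinearMap.comp_apply, convUnit_apply, convUnit_apply, map_smul, consOne_apply,
    consEquiv_ddOne_powOne]

theorem listConv_map_succ {n : ℕ} (l : Fin (n + 1) → H →ₗ[F] HH F H) (L : List (Fin n)) :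
    listConv l (L.map Fin.succ) = consOne F H n ∘ₗ listConv (fun j => l j.succ) L := by
  induction L with
  | nil => exact (consOne_comp_convUnit n).symm
  | cons k L ih =>
    have h : single F H k.succ ∘ₗ l k.succ = consOne F H n ∘ₗ single F H k ∘ₗ l k.succ :=
      LinearMap.ext fun y => single_succ _ _
    rw [List.map_cons, listConv, ih, h, convAlong_consOne, listConv]

/-- The list of the indices smaller than `i`, in increasing order. -/
def below {n : ℕ} (i : Fin n) : List (Fin n) := (List.finRange n).filter (· < i)

theorem below_zero {n : ℕ} : below (0 : Fin (n + 1)) = [] := by simp [below]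

theorem below_succ {n : ℕ} (j : Fin n) : below j.succ = 0 :: (below j).map Fin.succ := by
  simp [below, List.finRange_succ, List.filter_map, Function.comp_def]

theorem listConv_below_succ {n : ℕ} (l : Fin (n + 1) → H →ₗ[F] HH F H) (j : Fin n) (y : H) :
    listConv l (below j.succ) y = consEquiv F H n
      (TensorProduct.map (l 0) (listConv (fun j => l j.succ) (below j)) (comul y)) := by
  rw [below_succ, listConv, listConv_map_succ, convAlong_single_zero]

/-- Components at different edge ends commute. -/
theorem single_ddPowMul_listConv_below {n : ℕ} (l : Fin n → H →ₗ[F] HH F H) (i : Fin n)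
    (x : HH F H) (y : H) :
    ddPowMul F H n (single F H i x) (listConv l (below i) y) =
      ddPowMul F H n (listConv l (below i) y) (single F H i x) := by
  induction n generalizing y with
  | zero => exact i.elim0
  | succ n ih =>
    refine Fin.cases ?_ (fun j => ?_) i
    · rw [below_zero, listConv, convUnit_apply, map_smul, map_smul, LinearMap.smul_apply,
        powOne_ddPowMul, ddPowMul_powOne]
    · rw [listConv_below_succ, single_succ]
      generalize comul (R := F) y = u
      induction u with
      | zero => simp
      | add p q hp hq => simp only [map_add, LinearMap.add_apply, hp, hq]
      | tmul p q =>
        rw [TensorProduct.map_tmul, ddPowMul_consEquiv, ddPowMul_consEquiv, ih, ddOne_ddMul,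
          ddMul_ddOne]

end Convolution

section Reverse

variable {F H : Type*} [Field F] [CharZero F] [Ring H] [HopfAlgebra F H] [FiniteDimensional F H]
  [IsSemisimpleRing H]

/-- The reversed path: the antipode reverses the comultiplication, and components at different edge
ends commute. -/
theorem listConv_reverse {n : ℕ} (l : Fin n → H →ₗ[F] HH F H) (i : Fin n) (y : H) :
    listConv (fun j => l j ∘ₗ antipode F) (below i).reverse (antipode F y) =
      listConv l (below i) y := by
  induction n generalizing y with
  | zero => exact i.elim0
  | succ n ih =>
    refine Fin.cases ?_ (fun j => ?_) i
    · rw [below_zero, List.reverse_nil, listConv, listConv, convUnit_apply, convUnit_apply,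
        counit_antipode]
    · rw [listConv_below_succ, below_succ, List.reverse_cons, ← List.map_reverse,
        listConv_append_singleton, listConv_map_succ, convAlong_apply, comul_antipode]
      generalize comul (R := F) y = u
      induction u with
      | zero => simp
      | add p q hp hq => simp only [map_add, hp, hq]
      | tmul p q =>
        have := ih (fun j => l j.succ) j q
        simp [consOne_apply, single_zero, ddPowMul_consEquiv, ddOne_ddMul, ddPowMul_powOne,
          antipode_antipode, this]

end Reverse

/-! ### Holonomies of words and the comultiplication of `D(H)^*` -/

section Letters

variable {F H : Type*} [Field F] [Ring H] [HopfAlgebra F H]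

/-- The map `y ⊗ γ ↦ ε(y) γ`. -/
def epsLeft (F H : Type*) [Field F] [Ring H] [HopfAlgebra F H] : HH F H →ₗ[F] Module.Dual F H :=
  (TensorProduct.lid F _).toLinearMap ∘ₗ LinearMap.rTensor _ counit

@[simp] theorem epsLeft_tmul (y : H) (γ : Module.Dual F H) :
    epsLeft F H (y ⊗ₜ γ) = counit (R := F) y • γ := rfl

theorem holR_apply (a : HH F H) : holR F H a = (1 : H) ⊗ₜ epsLeft F H a := by
  induction a using TensorProduct.induction_on with
  | zero => simp
  | add p q hp hq => simp only [map_add, TensorProduct.tmul_add, hp, hq]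
  | tmul y γ => simp [holR, Algebra.algebraMap_eq_smul_one, TensorProduct.smul_tmul]

theorem holRbar_apply (a : HH F H) : holRbar F H a = rho F H a ⊗ₜ (counit : Module.Dual F H) := by
  induction a using TensorProduct.induction_on with
  | zero => simp
  | add p q hp hq => simp only [map_add, TensorProduct.add_tmul, hp, hq]
  | tmul y γ => simp [holRbar, dualCounit, TensorProduct.smul_tmul]

theorem ddCounit_eq_counit_rho (a : HH F H) : ddCounit F H a = counit (R := F) (rho F H a) := by
  induction a using TensorProduct.induction_on with
  | zero => simp
  | add p q hp hq => simp only [map_add, hp, hq]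
  | tmul y γ => simp [ddCounit, dualCounit, mul_comm]

theorem lTensor_rho_leftCoact (a : HH F H) :
    LinearMap.lTensor H (rho F H) (leftCoact F H a) = comul (rho F H a) := by
  induction a using TensorProduct.induction_on with
  | zero => simp
  | add p q hp hq => simp only [map_add, hp, hq]
  | tmul y γ =>
    rw [leftCoact_tmul, rho_tmul, map_smul]
    generalize comul (R := F) y = t
    induction t with
    | zero => simp
    | add p q hp hq => simp only [map_add, TensorProduct.add_tmul, smul_add, hp, hq]
    | tmul p q => simp

theorem rho_eq_ddConv_eval (a : HH F H) : rho F H a = (ddConv F H a).eval 1 := by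
  induction a using TensorProduct.induction_on with
  | zero => simp [OpConv.eval]; rfl
  | add p q hp hq => rw [map_add, hp, hq, map_add]; rfl
  | tmul y γ => rw [rho_tmul, ddConv_tmul_eval]

theorem epsLeft_eq_ddConv_eval (a : HH F H) (x : H) :
    epsLeft F H a x = counit (R := F) ((ddConv F H a).eval x) := by
  induction a using TensorProduct.induction_on with
  | zero => rw [map_zero, map_zero]; exact (map_zero (counit (R := F) (A := H))).symm
  | add p q hp hq =>
    rw [map_add, LinearMap.add_apply, hp, hq, map_add, ← map_add]; rfl
  | tmul y γ => rw [epsLeft_tmul, ddConv_tmul_eval]; simp [mul_comm]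

variable [FiniteDimensional F H]

/-- Right counit law of `D(H)^*`. -/
theorem rid_lTensor_ddCounit_ddComul (a : HH F H) :
    TensorProduct.rid F _ (LinearMap.lTensor _ (ddCounit F H) (ddComul F H a)) = a := by
  induction a using TensorProduct.induction_on with
  | zero => simp
  | add p q hp hq => simp only [map_add, hp, hq]
  | tmul z γ =>
    apply ddConv_injective
    refine OpConv.ext_eval fun h => ?_
    have h1 : ∀ u : HH F H ⊗[F] HH F H, (ddConv F H (TensorProduct.rid F _
        (LinearMap.lTensor _ (ddCounit F H) u))).eval h =
          TensorProduct.rid F H (LinearMap.lTensor H (ddCounit F H) (evalFst h u)) := by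
      intro u
      induction u using TensorProduct.induction_on with
      | zero => simp; rfl
      | add p q hp hq => simp only [map_add, ← hp, ← hq]; rfl
      | tmul a b =>
        have h2 : (ddConv F H a).eval h =
            TensorProduct.rid F H (LinearMap.lTensor H (Module.Dual.eval F H h) a) := by
          induction a using TensorProduct.induction_on with
          | zero => simp; rfl
          | add p q hp hq => simp only [map_add, ← hp, ← hq]; rfl
          | tmul y γ => simp [ddConv_tmul_eval]
        rw [LinearMap.lTensor_tmul, TensorProduct.rid_tmul, map_smul]
        change ddCounit F H b • (ddConv F H a).eval h = _
        rw [h2]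
        simp [evalFst]
    have h3 : ∀ (x : H) (t : H ⊗[F] H), ddCounit F H (conjMap x (dualReg F H γ)
        (LinearMap.lTensor H comul t)) = counit (R := F) x * γ (contractLeft counit t) := by
      intro x t
      induction t with
      | zero => simp
      | add p q hp hq => simp only [map_add, mul_add, hp, hq]
      | tmul p q =>
        rw [LinearMap.lTensor_tmul]
        have h4 : ∀ s : H ⊗[F] H, ddCounit F H (conjMap x (dualReg F H γ) (p ⊗ₜ s)) =
            counit (R := F) x * counit (R := F) p * γ (contractRight counit s) := by
          intro s
          induction s with
          | zero => simp
          | add p q hp hq => simp only [TensorProduct.tmul_add, map_add, mul_add, hp, hq]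
          | tmul q r =>
            simp [ddCounit, dualCounit, dualReg_apply]
            ring
        rw [h4, contractRight_counit_comul]
        simp [mul_assoc]
    have h5 : contractLeft counit (comul (R := F) h) = h := by
      rw [contractLeft, LinearMap.comp_apply, rTensor_counit_comul]
      simp
    rw [h1, evalFst_ddComul _ _ _ (ℛ F z), ddConv_tmul_eval]
    simp only [map_sum, LinearMap.lTensor_tmul, TensorProduct.rid_tmul, h3, h5]
    conv_rhs => rw [← contractRight_counit_comul (F := F) z, ← (ℛ F z).eq]
    simp [Finset.smul_sum, smul_smul, mul_comm]

theorem hol_singleton {n : ℕ} (p : ThickEdge n × Bool) (a : HH F H) :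
    hol F H [p] a = letterHol F H p a := by
  have h : ∀ u : HH F H ⊗[F] HH F H, TensorProduct.lift (ddPowMul F H n)
      (TensorProduct.map (letterHol F H p) (hol F H []) u) =
        letterHol F H p (TensorProduct.rid F _ (LinearMap.lTensor _ (ddCounit F H) u)) := by
    intro u
    induction u using TensorProduct.induction_on with
    | zero => simp
    | add p q hp hq => simp only [map_add, hp, hq]
    | tmul a b => simp [hol, ddPowMul_powOne]
  exact (h _).trans (congrArg _ (rid_lTensor_ddCounit_ddComul a))

/-- A letter whose holonomy factors through `rho` contributes to a holonomy only through the
coaction of `H`. -/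
theorem hol_cons_of_rho {n : ℕ} {p : ThickEdge n × Bool} {m : H →ₗ[F] HHPow F H n}
    (hp : letterHol F H p = m ∘ₗ rho F H) (w : ThickWord n) :
    hol F H (p :: w) = convAlong (leftCoact F H) m (hol F H w) := by
  refine LinearMap.ext fun a => ?_
  rw [convAlong_apply, ← rTensor_rho_ddComul]
  change TensorProduct.lift (ddPowMul F H n)
    (TensorProduct.map (letterHol F H p) (hol F H w) (ddComul F H a)) = _
  rw [hp]
  generalize ddComul F H a = u
  induction u using TensorProduct.induction_on with
  | zero => simp
  | add p q hp hq => simp only [map_add, hp, hq]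
  | tmul a b => simp

end Letters

section Transport

variable {F H : Type*} [Field F] [CharZero F] [Ring H] [HopfAlgebra F H] [FiniteDimensional F H]
  [IsSemisimpleRing H]

theorem ddConv_ddAntipode_eval_antipode (a : HH F H) (h : H) :
    antipode F ((ddConv F H (ddAntipode F H a)).eval (antipode F h)) =
      (OpConv.idOp * (ddConv F H a * OpConv.antipodeOp)).eval h := by
  rw [← OpConv.antipodeConj_eval, ddConv_ddAntipode, OpConv.antipodeConj_mul,
    OpConv.antipodeConj_mul, OpConv.antipodeConj_antipodeConj, OpConv.antipodeConj_idOp,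
    OpConv.antipodeConj_antipodeOp, mul_assoc]

theorem rho_ddAntipode (a : HH F H) : rho F H (ddAntipode F H a) = antipode F (rho F H a) := by
  have h1 : ∀ f g : OpConv F H, (f * g).eval 1 = g.eval 1 * f.eval 1 := fun f g => by
    let r : Repr F (1 : H) Unit :=
      { index := {()}, left := fun _ => 1, right := fun _ => 1, eq := by
          simp [Algebra.TensorProduct.one_def] }
    rw [OpConv.mul_eval_repr f g r]
    simp [r]
  rw [rho_eq_ddConv_eval, rho_eq_ddConv_eval, ddConv_ddAntipode, h1, h1, OpConv.idOp_eval,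
    OpConv.antipodeOp_eval, OpConv.antipodeConj_eval]
  simp

theorem epsLeft_ddAntipode (a : HH F H) :
    epsLeft F H (ddAntipode F H a) = epsLeft F H a ∘ₗ antipode F := by
  ext x
  have h1 : ∀ (f g : OpConv F H) (x : H), counit (R := F) ((f * g).eval x) =
      ∑ i ∈ (ℛ F x).index, counit (R := F) (g.eval ((ℛ F x).right i)) *
        counit (R := F) (f.eval ((ℛ F x).left i)) := fun f g x => by
    rw [OpConv.mul_eval_repr f g (ℛ F x)]
    simp
  have h2 : ∀ (f : OpConv F H) (x : H),
      counit (R := F) ((f * OpConv.idOp).eval x) = counit (R := F) (f.eval x) := fun f x => by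
    obtain ⟨g, rfl⟩ := OpConv.exists_mk f
    rw [h1]
    simp only [OpConv.mk_eval, OpConv.idOp_eval, ← smul_eq_mul, ← map_smul, ← map_sum]
    conv_rhs => rw [← contractRight_counit_comul (F := F) x, ← (ℛ F x).eq]
    simp
  have h3 : ∀ (f : OpConv F H) (x : H),
      counit (R := F) ((OpConv.antipodeOp * f).eval x) = counit (R := F) (f.eval x) := fun f x => by
    obtain ⟨g, rfl⟩ := OpConv.exists_mk f
    rw [h1]
    simp only [OpConv.mk_eval, OpConv.antipodeOp_eval, counit_antipode, mul_comm, ← smul_eq_mul,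
      ← map_smul, ← map_sum, sum_counit_smul]
  rw [LinearMap.comp_apply, epsLeft_eq_ddConv_eval, epsLeft_eq_ddConv_eval, ddConv_ddAntipode, h3,
    h2, OpConv.antipodeConj_eval, counit_antipode]

/-- A shadow of the fact that `S_D` reverses the comultiplication of `D(H)^*`. -/
theorem map_epsLeft_rho_ddComul (a : HH F H) :
    TensorProduct.map (epsLeft F H) (rho F H) (ddComul F H a) =
      TensorProduct.comm F _ _ (TensorProduct.map (antipode F) (dualAntipode F H)
        (ddAntipode F H a)) := by
  have hinj : Function.Injective (dualTensorHom F H H) := (dualTensorHomEquiv F H H).injective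
  apply hinj
  ext h
  have h1 : ∀ u : HH F H ⊗[F] HH F H,
      dualTensorHom F H H (TensorProduct.map (epsLeft F H) (rho F H) u) h =
        rho F H (TensorProduct.lid F _ (LinearMap.rTensor _ counit (evalFst h u))) := by
    intro u
    induction u using TensorProduct.induction_on with
    | zero => simp
    | add p q hp hq => simp only [map_add, LinearMap.add_apply, hp, hq]
    | tmul a b =>
      induction a using TensorProduct.induction_on with
      | zero => simp
      | add p q hp hq =>
        simp only [map_add, LinearMap.add_apply, TensorProduct.add_tmul, hp, hq]
      | tmul y γ => simp [evalFst, mul_comm]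
  have h2 : ∀ b : HH F H, dualTensorHom F H H (TensorProduct.comm F _ _
      (TensorProduct.map (antipode F) (dualAntipode F H) b)) h =
        antipode F ((ddConv F H b).eval (antipode F h)) := by
    intro b
    induction b using TensorProduct.induction_on with
    | zero => simp; exact (map_zero (antipode F (A := H))).symm
    | add p q hp hq => simp only [map_add, LinearMap.add_apply, hp, hq]; rw [← map_add]; rfl
    | tmul y γ => simp [ddConv_tmul_eval, dualAntipode]
  rw [h1, lid_counit_evalFst_ddComul, h2, ddConv_ddAntipode_eval_antipode]
  induction a using TensorProduct.induction_on with
  | zero => rw [act_zero, map_zero, map_zero, zero_mul, mul_zero]; rfl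
  | add p q hp hq => rw [act_add, map_add, map_add, add_mul, mul_add, hp, hq]; rfl
  | tmul z δ =>
    obtain ⟨f, hf⟩ := OpConv.exists_mk (ddConv F H (z ⊗ₜ δ))
    have hf' : ∀ x, f x = δ x • z := fun x => by
      rw [← ddConv_tmul_eval, ← hf, OpConv.mk_eval]
    have h3 : (ddConv F H (z ⊗ₜ δ) * OpConv.antipodeOp) =
        OpConv.mk (LinearMap.mul' F H ∘ₗ (TensorProduct.comm F H H).toLinearMap ∘ₗ
          TensorProduct.map f (antipode F) ∘ₗ comul) :=
      OpConv.ext_eval fun x => by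
        rw [← hf, OpConv.antipodeOp, OpConv.mk_mul_mk_eval, OpConv.mk_eval]
        rfl
    rw [h3, OpConv.idOp, OpConv.mk_mul_mk_eval, act_tmul]
    generalize comul (R := F) h = t
    induction t with
    | zero => simp
    | add p q hp hq => simp only [map_add, hp, hq]
    | tmul p q =>
      simp only [LinearMap.lTensor_tmul, TensorProduct.map_tmul, LinearMap.comp_apply]
      generalize comul (R := F) q = t
      induction t with
      | zero => simp
      | add p q hp hq => simp only [TensorProduct.tmul_add, map_add, hp, hq]
      | tmul q r => simp [hf', dualReg_apply, mul_assoc]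

end Transport

/-! ### Holonomies of the paths at a vertex -/

section Flip

variable {F H : Type*} [Field F] [Ring H] [HopfAlgebra F H]

theorem convAlong_leftCoact_assoc {n : ℕ} (m m' : H →ₗ[F] HHPow F H n)
    (g : HH F H →ₗ[F] HHPow F H n) :
    convAlong (leftCoact F H) m (convAlong (leftCoact F H) m' g) =
      convAlong (leftCoact F H) (convAlong comul m m') g :=
  convAlong_convAlong (V := HH F H) (κ := leftCoact F H) (fun a => leftCoact_coassoc a) m m' g

theorem convUnit_convAlong_leftCoact {n : ℕ} (g : HH F H →ₗ[F] HHPow F H n) :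
    convAlong (leftCoact F H) (convUnit F H n) g = g :=
  convUnit_convAlong (V := HH F H) (κ := leftCoact F H) (fun a => lid_counit_leftCoact a) g

variable [FiniteDimensional F H]

/-- The power `S_D^s` of the antipode of `D(H)^*`. -/
def flipAt (F H : Type*) [Field F] [Ring H] [HopfAlgebra F H] [FiniteDimensional F H] (s : Fin 2) :
    HH F H →ₗ[F] HH F H :=
  (ddAntipode F H : Module.End F (HH F H)) ^ (s : ℕ)

theorem flipAt_one (a : HH F H) : flipAt F H 1 a = ddAntipode F H a := by
  simp [flipAt]

theorem orientationFlip_tprod {n : ℕ} (τ : Fin n → Fin 2) (f : Fin n → HH F H) :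
    orientationFlip F H τ (PiTensorProduct.tprod F f) =
      PiTensorProduct.tprod F fun i => flipAt F H (τ i) (f i) :=
  PiTensorProduct.map_tprod _ _

theorem orientationFlip_consEquiv {n : ℕ} (τ : Fin (n + 1) → Fin 2) (a : HH F H)
    (t : HHPow F H n) :
    orientationFlip F H τ (consEquiv F H n (a ⊗ₜ t)) =
      consEquiv F H n (flipAt F H (τ 0) a ⊗ₜ orientationFlip F H (Fin.tail τ) t) := by
  induction t using PiTensorProduct.induction_on with
  | add a b ha hb => simp only [map_add, TensorProduct.tmul_add, ha, hb]
  | smul_tprod r f =>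
    simp only [map_smul, TensorProduct.tmul_smul, consEquiv_tmul_tprod, orientationFlip_tprod]
    congr 2
    funext i
    refine Fin.cases ?_ (fun j => ?_) i <;> simp [Fin.tail]

/-- The holonomy `y ↦ S_D^{τ_j}(y ⊗ 1)` of the path that crosses the `j`th edge end. -/
def crossMap {n : ℕ} (τ : Fin n → Fin 2) (j : Fin n) : H →ₗ[F] HH F H :=
  flipAt F H (τ j) ∘ₗ (TensorProduct.mk F H _).flip counit

theorem crossMap_apply {n : ℕ} (τ : Fin n → Fin 2) (j : Fin n) (y : H) :
    crossMap τ j y = flipAt F H (τ j) (y ⊗ₜ counit) := rfl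

theorem hcoact_single {n : ℕ} (i : Fin n) (a : HH F H) :
    hcoact n (single F H i a) = LinearMap.lTensor H (single F H i) (leftCoact F H a) := by
  induction n with
  | zero => exact i.elim0
  | succ n ih =>
    refine Fin.cases ?_ (fun j => ?_) i
    · rw [single_zero, hcoact_consEquiv, hcoact_powOne]
      generalize leftCoact F H a = u
      induction u with
      | zero => simp
      | add p q hp hq => simp only [map_add, TensorProduct.add_tmul, hp, hq]
      | tmul p q => simp [single_zero]
    · rw [single_succ, hcoact_consEquiv, ih, leftCoact_ddOne]
      generalize leftCoact F H a = u
      induction u with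
      | zero => simp
      | add p q hp hq => simp only [map_add, TensorProduct.tmul_add, hp, hq]
      | tmul p q => simp [single_succ]

variable [CharZero F] [IsSemisimpleRing H]

theorem flipAt_flipAt (s : Fin 2) (a : HH F H) : flipAt F H s (flipAt F H s a) = a := by
  fin_cases s
  · rfl
  · change flipAt F H 1 (flipAt F H 1 a) = a
    rw [flipAt_one, flipAt_one, ddAntipode_ddAntipode]

theorem flipAt_ddOne (s : Fin 2) : flipAt F H s (ddOne F H) = ddOne F H := by
  fin_cases s
  · rfl
  · exact (flipAt_one _).trans ddAntipode_ddOne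

theorem flipAt_heisMul (s : Fin 2) (a b : HH F H) :
    flipAt F H s (heisMul F H a b) = heisMul F H (flipAt F H s a) (flipAt F H s b) := by
  fin_cases s
  · rfl
  · change flipAt F H 1 _ = heisMul F H (flipAt F H 1 a) (flipAt F H 1 b)
    rw [flipAt_one, flipAt_one, flipAt_one, ddAntipode_heisMul]

theorem orientationFlip_orientationFlip {n : ℕ} (τ : Fin n → Fin 2) (t : HHPow F H n) :
    orientationFlip F H τ (orientationFlip F H τ t) = t := by
  induction t using PiTensorProduct.induction_on with
  | add a b ha hb => simp only [map_add, ha, hb]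
  | smul_tprod r f => simp only [map_smul, orientationFlip_tprod, flipAt_flipAt]

theorem orientationFlip_powOne {n : ℕ} (τ : Fin n → Fin 2) :
    orientationFlip F H τ (powOne F H n) = powOne F H n := by
  simp only [powOne, orientationFlip_tprod, flipAt_ddOne]

theorem orientationFlip_heisPowMul {n : ℕ} (τ : Fin n → Fin 2) (t u : HHPow F H n) :
    orientationFlip F H τ (heisPowMul F H n t u) =
      heisPowMul F H n (orientationFlip F H τ t) (orientationFlip F H τ u) := by
  induction t using PiTensorProduct.induction_on with
  | add a b ha hb => simp only [map_add, LinearMap.add_apply, ha, hb]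
  | smul_tprod r f =>
    induction u using PiTensorProduct.induction_on with
    | add a b ha hb => simp only [map_add, ha, hb]
    | smul_tprod s g =>
      simp only [map_smul, LinearMap.smul_apply, heisPowMul_tprod, orientationFlip_tprod,
        flipAt_heisMul]

theorem orientationFlip_single {n : ℕ} (τ : Fin n → Fin 2) (i : Fin n) (a : HH F H) :
    orientationFlip F H τ (single F H i a) = single F H i (flipAt F H (τ i) a) := by
  rw [single_apply, single_apply, orientationFlip_tprod]
  congr 1
  funext j
  by_cases h : j = i
  · subst h
    simp
  · simp [Function.update_of_ne h, flipAt_ddOne]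

theorem chi_single_succ {n : ℕ} (σ : Fin (n + 1) → Fin 2) (j : Fin n) (a : HH F H) :
    chi (n + 1) σ (single F H j.succ a) = consHeis n (TensorProduct.map heisLeft.toLinearMap
      (chi n (Fin.tail σ) ∘ₗ single F H j) (leftCoact F H a)) := by
  rw [single_succ, chi_consEquiv, siteMap_ddOne, hcoact_single, ← Algebra.TensorProduct.one_def,
    mul_one, ← LinearMap.comp_apply, LinearMap.lTensor, ← TensorProduct.map_comp,
    LinearMap.comp_id]

/-- The holonomy of the path from the `i`th edge end to the cilium, in terms of `χ`. -/
theorem orientationFlip_chi_single {n : ℕ} (τ σ : Fin n → Fin 2) (i : Fin n) (a : HH F H) :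
    orientationFlip F H τ ((toHeisPow n).symm (chi n σ (single F H i a))) =
      convAlong (leftCoact F H) (listConv (crossMap τ) (below i))
        (single F H i ∘ₗ flipAt F H (τ i) ∘ₗ toHeis.symm.toLinearMap ∘ₗ siteMap (σ i)) a := by
  induction n generalizing a with
  | zero => exact i.elim0
  | succ n ih =>
    refine Fin.cases ?_ (fun j => ?_) i
    · have h : (toHeisPow (n + 1)).symm (chi (n + 1) σ (single F H 0 a)) =
          single F H 0 (toHeis.symm (siteMap (σ 0) a)) := by
        rw [chi_single_zero, single_zero]
        rfl
      rw [h, orientationFlip_single, below_zero, listConv, convUnit_convAlong_leftCoact]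
      rfl
    · have h1 : single F H j.succ ∘ₗ flipAt F H (τ j.succ) ∘ₗ toHeis.symm.toLinearMap ∘ₗ
          siteMap (σ j.succ) = consOne F H n ∘ₗ single F H j ∘ₗ flipAt F H (Fin.tail τ j) ∘ₗ
            toHeis.symm.toLinearMap ∘ₗ siteMap (Fin.tail σ j) :=
        LinearMap.ext fun a => single_succ _ _
      have h2 : (fun j => crossMap (F := F) (H := H) τ j.succ) = crossMap (Fin.tail τ) := rfl
      rw [below_succ, listConv, listConv_map_succ, h1, ← convAlong_leftCoact_assoc,
        convAlong_consOne, convAlong_single_zero, chi_single_succ, h2]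
      generalize leftCoact F H a = u
      induction u with
      | zero => simp
      | add p q hp hq => simp only [map_add, hp, hq]
      | tmul p q =>
        rw [TensorProduct.map_tmul, TensorProduct.map_tmul, ← ih (Fin.tail τ) (Fin.tail σ) j q]
        exact orientationFlip_consEquiv τ (toHeis.symm (heisLeft p)) _

end Flip

section Paths

variable {F H : Type*} [Field F] [CharZero F] [Ring H] [HopfAlgebra F H] [FiniteDimensional F H]
  [IsSemisimpleRing H]

theorem letterHol_rbarStep {n : ℕ} (τ : Fin n → Fin 2) (j : Fin n) :
    letterHol F H (rbarStep τ j) = (single F H j ∘ₗ crossMap τ j) ∘ₗ rho F H := by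
  refine LinearMap.ext fun a => ?_
  simp only [LinearMap.comp_apply, crossMap_apply, ← holRbar_apply]
  rcases Fin.exists_fin_two.mp ⟨τ j, rfl⟩ with h | h
  · rw [rbarStep, if_pos h, h]
    rfl
  · rw [rbarStep, if_neg (by rw [h]; decide), h, flipAt_one]
    change single F H j (ddAntipode F H (holRbar F H (ddAntipode F H (ddAntipode F H a)))) = _
    rw [ddAntipode_ddAntipode]

theorem letterHol_rbarStep_inv {n : ℕ} (τ : Fin n → Fin 2) (j : Fin n) :
    letterHol F H ((rbarStep τ j).1, !(rbarStep τ j).2) =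
      (single F H j ∘ₗ crossMap τ j ∘ₗ antipode F) ∘ₗ rho F H := by
  refine LinearMap.ext fun a => ?_
  simp only [LinearMap.comp_apply, crossMap_apply, ← rho_ddAntipode, ← holRbar_apply]
  rcases Fin.exists_fin_two.mp ⟨τ j, rfl⟩ with h | h
  · rw [rbarStep, if_pos h, h]
    rfl
  · rw [rbarStep, if_neg (by rw [h]; decide), h, flipAt_one]
    rfl

theorem letterHol_rStep {n : ℕ} (τ : Fin n → Fin 2) (i : Fin n) (a : HH F H) :
    letterHol F H (rStep τ i) a = single F H i (flipAt F H (τ i) (holR F H a)) := by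
  rcases Fin.exists_fin_two.mp ⟨τ i, rfl⟩ with h | h
  · rw [rStep, if_pos h, h]
    rfl
  · rw [rStep, if_neg (by rw [h]; decide), h, flipAt_one]
    change single F H i (ddAntipode F H (holR F H (ddAntipode F H (ddAntipode F H a)))) = _
    rw [ddAntipode_ddAntipode]

/-- The map `siteMap 1` is the holonomy of `l(e)` for an incoming edge `e`. -/
theorem siteMap_one_eq (a : HH F H) :
    toHeis.symm (siteMap 1 a) = ddAntipode F H (holR F H (ddAntipode F H a)) := by
  rw [holR_apply, epsLeft_ddAntipode]
  induction a using TensorProduct.induction_on with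
  | zero => simp
  | add p q hp hq =>
    simp only [map_add, LinearMap.add_comp, TensorProduct.tmul_add, hp, hq]
  | tmul y γ =>
    rw [siteMap_one_tmul, heisDualLeft_apply, epsLeft_tmul, LinearMap.smul_comp,
      TensorProduct.tmul_smul, map_smul, map_smul]
    rfl

theorem letterHol_lStep {n : ℕ} (τ : Fin n → Fin 2) (i : Fin n) (a : HH F H) :
    letterHol F H (lStep τ i) a =
      single F H i (flipAt F H (τ i) (toHeis.symm (siteMap 1 a))) := by
  rw [siteMap_one_eq]
  rcases Fin.exists_fin_two.mp ⟨τ i, rfl⟩ with h | h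
  · rw [lStep, if_pos h, h]
    rfl
  · rw [lStep, if_neg (by rw [h]; decide), h, flipAt_one, ddAntipode_ddAntipode]
    rfl

theorem hol_map_rbarStep_append {n : ℕ} (τ : Fin n → Fin 2) (L : List (Fin n)) (w : ThickWord n) :
    hol F H (L.map (rbarStep τ) ++ w) =
      convAlong (leftCoact F H) (listConv (crossMap τ) L) (hol F H w) := by
  induction L with
  | nil => exact (convUnit_convAlong_leftCoact _).symm
  | cons j L ih =>
    rw [List.map_cons, List.cons_append, hol_cons_of_rho (letterHol_rbarStep τ j), ih,
      convAlong_leftCoact_assoc, listConv]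

theorem hol_map_rbarStep_inv {n : ℕ} (τ : Fin n → Fin 2) (L : List (Fin n)) :
    hol F H (L.map fun j => ((rbarStep τ j).1, !(rbarStep τ j).2)) =
      listConv (fun j => crossMap τ j ∘ₗ antipode F) L ∘ₗ rho F H := by
  induction L with
  | nil =>
    refine LinearMap.ext fun a => ?_
    change ddCounit F H a • powOne F H n = _
    rw [ddCounit_eq_counit_rho]
    rfl
  | cons j L ih =>
    rw [List.map_cons, hol_cons_of_rho (letterHol_rbarStep_inv τ j), ih, listConv]
    refine LinearMap.ext fun a => ?_
    rw [LinearMap.comp_apply, convAlong_apply, convAlong_apply, ← lTensor_rho_leftCoact]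
    generalize leftCoact F H a = u
    induction u with
    | zero => simp
    | add p q hp hq => simp only [map_add, hp, hq]
    | tmul p q => simp

/-- The path `r(ē) ∘ r(e)` across a single edge end has holonomy `S_D^τ`, as `(y ⊗ 1) (1 ⊗ γ)` in
`D(H)^*` is `y ⊗ γ`. -/
theorem hol_rbarStep_rStep {n : ℕ} (τ : Fin n → Fin 2) (i : Fin n) (a : HH F H) :
    hol F H [rbarStep τ i, rStep τ i] a = single F H i (flipAt F H (τ i) a) := by
  have h1 : hol F H [rStep τ i] = single F H i ∘ₗ flipAt F H (τ i) ∘ₗ holR F H :=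
    LinearMap.ext fun a => (hol_singleton _ a).trans (letterHol_rStep τ i a)
  have h2 : ∀ (s : Fin 2) (y : H) (γ : Module.Dual F H), ddMul F H (flipAt F H s (y ⊗ₜ counit))
      (flipAt F H s ((1 : H) ⊗ₜ γ)) = flipAt F H s (y ⊗ₜ γ) := by
    intro s y γ
    fin_cases s
    · change ddMul F H (y ⊗ₜ counit) ((1 : H) ⊗ₜ γ) = y ⊗ₜ γ
      rw [ddMul_tmul, one_mul, counit_dualMul]
    · change ddMul F H (flipAt F H 1 (y ⊗ₜ counit)) (flipAt F H 1 ((1 : H) ⊗ₜ γ)) =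
        flipAt F H 1 (y ⊗ₜ γ)
      rw [flipAt_one, flipAt_one, flipAt_one, ← ddAntipode_ddMul, ddMul_tmul, mul_one,
        dualMul_counit]
  rw [hol_cons_of_rho (letterHol_rbarStep τ i), convAlong_apply, h1]
  have h3 : ∀ u : H ⊗[F] HH F H, TensorProduct.lift ((ddPowMul F H n).compl₁₂
      (single F H i ∘ₗ crossMap τ i) (single F H i ∘ₗ flipAt F H (τ i) ∘ₗ holR F H)) u =
        single F H i (flipAt F H (τ i) (LinearMap.lTensor H (epsLeft F H) u)) := by
    intro u
    induction u with
    | zero => simp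
    | add p q hp hq => simp only [map_add, hp, hq]
    | tmul p q =>
      simp [crossMap_apply, single_ddPowMul_single, holR_apply, h2]
  rw [h3]
  congr 2
  induction a using TensorProduct.induction_on with
  | zero => simp
  | add p q hp hq => simp only [map_add, hp, hq]
  | tmul y γ =>
    conv_rhs => rw [← contractRight_counit_comul (F := F) y]
    rw [leftCoact_tmul]
    generalize comul (R := F) y = u
    induction u with
    | zero => simp
    | add p q hp hq => simp only [map_add, TensorProduct.add_tmul, hp, hq]
    | tmul p q => simp [TensorProduct.smul_tmul]

/-- The paths to the cilium have the holonomies that `orientationFlip_chi_single` computes for `χ`.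
-/
theorem hol_incomingPath {n : ℕ} (τ : Fin n → Fin 2) (s : Fin 2) (i : Fin n) :
    hol F H (incomingPath τ s i) = convAlong (leftCoact F H) (listConv (crossMap τ) (below i))
      (single F H i ∘ₗ flipAt F H (τ i) ∘ₗ toHeis.symm.toLinearMap ∘ₗ siteMap s) := by
  rw [incomingPath, hol_map_rbarStep_append]
  change convAlong _ (listConv _ (below i)) _ = _
  congr 1
  refine LinearMap.ext fun a => ?_
  fin_cases s
  · exact hol_rbarStep_rStep τ i a
  · exact (hol_singleton _ a).trans (letterHol_lStep τ i a)

/-- For an outgoing edge the reversed path has the holonomy of the path composed with `S_D`. For the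
last edge of the path this needs `map_epsLeft_rho_ddComul`; the edges that cross other edge ends are
reversed with `listConv_reverse`. -/
theorem hol_incomingPath_inv {n : ℕ} (τ : Fin n → Fin 2) (s : Fin 2) (i : Fin n) (hi : τ i = 1)
    (a : HH F H) :
    hol F H (incomingPath τ s i).inv a = hol F H (incomingPath τ s i) (ddAntipode F H a) := by
  -- The holonomy of a word whose first letter factors through `epsLeft` and whose remaining letters
  -- factor through `rho`.
  have key : ∀ (m : Module.Dual F H →ₗ[F] HHPow F H n) (m' : H →ₗ[F] HHPow F H n),
      TensorProduct.lift (ddPowMul F H n) (TensorProduct.map (m ∘ₗ epsLeft F H) (m' ∘ₗ rho F H)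
        (ddComul F H a)) =
      TensorProduct.lift ((ddPowMul F H n).flip.compl₁₂ (m' ∘ₗ antipode F) (m ∘ₗ dualAntipode F H))
        (ddAntipode F H a) := by
    intro m m'
    rw [TensorProduct.map_comp, LinearMap.comp_apply, map_epsLeft_rho_ddComul]
    generalize ddAntipode F H a = b
    induction b using TensorProduct.induction_on with
    | zero => simp
    | add p q hp hq => simp only [map_add, hp, hq]
    | tmul y γ => simp
  have hcross : ∀ y : H, crossMap τ i y = ddAntipode F H (y ⊗ₜ counit) := fun y => by
    rw [crossMap_apply, hi, flipAt_one]
  have hγ : ∀ γ : Module.Dual F H, dualAntipode F H (dualAntipode F H γ) = γ := fun γ => by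
    ext x
    simp [dualAntipode, antipode_antipode]
  rw [hol_incomingPath]
  fin_cases s
  · have hw : (incomingPath τ 0 i).inv = (ThickEdge.l i, false) ::
        (i :: (below i).reverse).map fun j => ((rbarStep τ j).1, !(rbarStep τ j).2) := by
      simp [incomingPath, ThickWord.inv, rStep, hi, below, List.map_reverse, Function.comp_def]
    have hl : letterHol F H (ThickEdge.l i, false) = (single F H i ∘ₗ ddAntipode F H ∘ₗ
        TensorProduct.mk F H _ 1 ∘ₗ dualAntipode F H) ∘ₗ epsLeft F H :=
      LinearMap.ext fun b => by
        change single F H i (ddAntipode F H (holR F H (ddAntipode F H b))) = _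
        rw [holR_apply, epsLeft_ddAntipode]
        rfl
    change hol F H (incomingPath τ 0 i).inv a = _
    rw [hw]
    change TensorProduct.lift (ddPowMul F H n) (TensorProduct.map (letterHol F H _) (hol F H _)
        (ddComul F H a)) = _
    rw [hol_map_rbarStep_inv, hl, key]
    generalize ddAntipode F H a = b
    induction b using TensorProduct.induction_on with
    | zero => simp
    | add p q hp hq => simp only [map_add, hp, hq]
    | tmul y γ =>
      rw [TensorProduct.lift.tmul, LinearMap.compl₁₂_apply, LinearMap.flip_apply, convAlong_apply,
        leftCoact_tmul, LinearMap.comp_apply _ (antipode F), listConv, convAlong_apply,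
        comul_antipode]
      generalize comul (R := F) y = u
      induction u with
      | zero => simp
      | add p q hp hq => simp only [map_add, TensorProduct.add_tmul, hp, hq]
      | tmul p q =>
        simp only [TensorProduct.comm_tmul, TensorProduct.map_tmul, TensorProduct.lift.tmul,
          LinearMap.compl₁₂_apply, LinearMap.comp_apply, TensorProduct.assoc_tmul,
          LinearEquiv.coe_coe, antipode_antipode, hcross, hγ, TensorProduct.mk_apply,
          listConv_reverse, hi, flipAt_one, ← ddPowMul_assoc, single_ddPowMul_single,
          ← ddAntipode_ddMul, ddMul_tmul, one_mul, counit_dualMul]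
        rw [single_ddPowMul_listConv_below]
        rfl
  · have hw : (incomingPath τ 1 i).inv = (ThickEdge.r i, false) ::
        (below i).reverse.map fun j => ((rbarStep τ j).1, !(rbarStep τ j).2) := by
      simp [incomingPath, ThickWord.inv, lStep, hi, below, List.map_reverse, Function.comp_def]
    have hl : letterHol F H (ThickEdge.r i, false) = (single F H i ∘ₗ
        TensorProduct.mk F H _ 1) ∘ₗ epsLeft F H :=
      LinearMap.ext fun b => congrArg (single F H i) (holR_apply b)
    change hol F H (incomingPath τ 1 i).inv a = convAlong (leftCoact F H) _ (single F H i ∘ₗ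
      flipAt F H (τ i) ∘ₗ toHeis.symm.toLinearMap ∘ₗ siteMap 1) _
    rw [hw]
    change TensorProduct.lift (ddPowMul F H n) (TensorProduct.map (letterHol F H _) (hol F H _)
        (ddComul F H a)) = _
    rw [hol_map_rbarStep_inv, hl, key]
    generalize ddAntipode F H a = b
    induction b using TensorProduct.induction_on with
    | zero => simp
    | add p q hp hq => simp only [map_add, hp, hq]
    | tmul y γ =>
      rw [TensorProduct.lift.tmul, LinearMap.compl₁₂_apply, LinearMap.flip_apply, convAlong_apply,
        leftCoact_tmul, LinearMap.comp_apply _ (antipode F), listConv_reverse,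
        LinearMap.comp_apply, LinearMap.comp_apply, single_ddPowMul_listConv_below]
      conv_lhs => rw [← contractRight_counit_comul (F := F) y]
      generalize comul (R := F) y = u
      induction u with
      | zero => simp
      | add p q hp hq => simp only [map_add, LinearMap.add_apply, TensorProduct.add_tmul, hp, hq]
      | tmul p q =>
        simp only [TensorProduct.lift.tmul, LinearMap.compl₁₂_apply, LinearMap.comp_apply,
          TensorProduct.assoc_tmul, LinearEquiv.coe_coe, hi, flipAt_one, siteMap_one_tmul,
          heisDualLeft_apply, map_smul, LinearEquiv.symm_apply_apply, ddAntipode_ddAntipode,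
          contractRight_tmul, LinearMap.smul_apply]
        rfl

theorem hol_nbPath {n : ℕ} (τ : Fin n → Fin 2) (s : Fin 2) (i : Fin n) (a : HH F H) :
    hol F H (nbPath τ s i) a = hol F H (incomingPath τ s i) (flipAt F H (τ i) a) := by
  rcases Fin.exists_fin_two.mp ⟨τ i, rfl⟩ with h | h
  · rw [nbPath, if_pos h, h]
    rfl
  · rw [nbPath, if_neg (by rw [h]; decide), h, flipAt_one, hol_incomingPath_inv τ s i h]

end Paths

/-! ### Arbitrary orientations -/

/-- The two defining conditions determine the map on pure tensors. -/
theorem IsChi.eq {F H : Type*} [Field F] [Ring H] [HopfAlgebra F H] [FiniteDimensional F H]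
    {n : ℕ} {τ σ : Fin n → Fin 2} {χ χ' : HHPow F H n →ₗ[F] HHPow F H n}
    (h : IsChi τ σ χ) (h' : IsChi τ σ χ') : χ = χ' := by
  refine PiTensorProduct.ext (MultilinearMap.ext fun f => ?_)
  simp only [LinearMap.compMultilinearMap_apply, h.map_tprod, h'.map_tprod, h.map_single,
    h'.map_single]

section ChiFlip

variable {F H : Type*} [Field F] [CharZero F] [Ring H] [HopfAlgebra F H] [FiniteDimensional F H]
  [IsSemisimpleRing H]

/-- The map `χ_{τ,σ}`: the map `chi` for incoming edge ends, conjugated by the involution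
`S_D^{τ_1} ⊗ ⋯ ⊗ S_D^{τ_n}`. -/
def chiFlip {n : ℕ} (τ σ : Fin n → Fin 2) : HHPow F H n →ₗ[F] HHPow F H n :=
  orientationFlip F H τ ∘ₗ (toHeisPow n).symm.toLinearMap ∘ₗ chi n σ ∘ₗ orientationFlip F H τ

theorem chiFlip_apply {n : ℕ} (τ σ : Fin n → Fin 2) (t : HHPow F H n) :
    chiFlip τ σ t =
      orientationFlip F H τ ((toHeisPow n).symm (chi n σ (orientationFlip F H τ t))) := rfl

theorem chiFlip_single {n : ℕ} (τ σ : Fin n → Fin 2) (i : Fin n) (a : HH F H) :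
    chiFlip τ σ (single F H i a) = hol F H (nbPath τ (σ i) i) a := by
  rw [chiFlip_apply, orientationFlip_single, orientationFlip_chi_single, hol_nbPath,
    hol_incomingPath]

theorem chiFlip_powOne {n : ℕ} (τ σ : Fin n → Fin 2) :
    chiFlip τ σ (powOne F H n) = powOne F H n := by
  rw [chiFlip_apply, orientationFlip_powOne, chi_powOne]
  exact orientationFlip_powOne τ

theorem chiFlip_vertexMul {n : ℕ} (τ σ : Fin n → Fin 2) (t u : HHPow F H n) :
    chiFlip τ σ (vertexMul F H τ σ t u) = heisPowMul F H n (chiFlip τ σ u) (chiFlip τ σ t) := by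
  rw [chiFlip_apply, chiFlip_apply, chiFlip_apply, ← orientationFlip_heisPowMul]
  change orientationFlip F H τ ((toHeisPow n).symm (chi n σ (orientationFlip F H τ
    (orientationFlip F H τ (incomingMul F H n σ (orientationFlip F H τ t)
      (orientationFlip F H τ u)))))) = _
  rw [orientationFlip_orientationFlip, chi_incomingMul]
  rfl

theorem foldl_heisPowMul {n : ℕ} (L : List (HHPow F H n)) (t : HHPow F H n) :
    toHeisPow n (L.foldl (fun x y => heisPowMul F H n y x) t) =
      (L.map (toHeisPow n)).reverse.prod * toHeisPow n t := by
  induction L generalizing t with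
  | nil => simp
  | cons a L ih =>
    rw [List.foldl_cons, ih, toHeisPow_heisPowMul, List.map_cons, List.reverse_cons,
      List.prod_append, List.prod_singleton, mul_assoc]

/-- The involution `S_D^{τ_1} ⊗ ⋯ ⊗ S_D^{τ_n}` as an endomorphism of the algebra `𝓗(H)^{⊗ n}`. -/
def flipHom {n : ℕ} (τ : Fin n → Fin 2) : HeisPow F H n →ₐ[F] HeisPow F H n :=
  AlgHom.ofLinearMap ((toHeisPow n).toLinearMap ∘ₗ orientationFlip F H τ ∘ₗ
    (toHeisPow n).symm.toLinearMap) (orientationFlip_powOne τ) (orientationFlip_heisPowMul τ)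

theorem toHeisPow_chiFlip {n : ℕ} (τ σ : Fin n → Fin 2) (t : HHPow F H n) :
    toHeisPow n (chiFlip τ σ t) = flipHom τ (chi n σ (orientationFlip F H τ t)) := rfl

theorem chiFlip_tprod {n : ℕ} (τ σ : Fin n → Fin 2) (f : Fin n → HH F H) :
    chiFlip τ σ (PiTensorProduct.tprod F f) =
      ((List.finRange n).map fun i => chiFlip τ σ (single F H i (f i))).foldl
        (fun x y => heisPowMul F H n y x) (powOne F H n) := by
  apply (toHeisPow n).injective
  rw [foldl_heisPowMul, toHeisPow_powOne, mul_one, toHeisPow_chiFlip, orientationFlip_tprod,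
    chi_tprod, map_list_prod, List.map_reverse, List.map_map, List.map_map]
  congr 2
  refine List.map_congr_left fun i _ => ?_
  simp only [Function.comp_apply, toHeisPow_chiFlip, orientationFlip_single]

theorem isChi_chiFlip {n : ℕ} (τ σ : Fin n → Fin 2) :
    IsChi τ σ (chiFlip (F := F) (H := H) τ σ) :=
  ⟨chiFlip_single τ σ, chiFlip_tprod τ σ⟩

theorem bijective_chiFlip {n : ℕ} (τ σ : Fin n → Fin 2) :
    Function.Bijective (chiFlip (F := F) (H := H) τ σ) ↔
      (∀ i, σ i = 0) ∨ Module.finrank F H = 1 := by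
  have hτ : Function.Bijective (orientationFlip F H τ) :=
    Function.Involutive.bijective (orientationFlip_orientationFlip τ)
  have h : (chiFlip (F := F) (H := H) τ σ : _ → _) =
      (orientationFlip F H τ ∘ (toHeisPow n).symm) ∘ chi n σ ∘ orientationFlip F H τ := rfl
  rw [h, Function.Bijective.of_comp_iff' (hτ.comp (toHeisPow n).symm.bijective),
    Function.Bijective.of_comp_iff _ hτ, bijective_chi]

end ChiFlip

end HopfGauge
end

theorem lemma7p5 {F H : Type*} [Field F] [CharZero F] [Ring H] [HopfAlgebra F H]
    [FiniteDimensional F H] [IsSemisimpleRing H] {n : ℕ} (τ σ : Fin n → Fin 2) :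
    ∃ χ : HopfGauge.HHPow F H n →ₗ[F] HopfGauge.HHPow F H n,
      HopfGauge.IsChi τ σ χ ∧
      (∀ χ' : HopfGauge.HHPow F H n →ₗ[F] HopfGauge.HHPow F H n,
        HopfGauge.IsChi τ σ χ' → χ' = χ) ∧
      χ (HopfGauge.powOne F H n) = HopfGauge.powOne F H n ∧
      (∀ a b : HopfGauge.HHPow F H n,
        χ (HopfGauge.vertexMul F H τ σ a b) = HopfGauge.heisPowMul F H n (χ b) (χ a)) ∧
      (Function.Bijective χ ↔ (∀ i, σ i = 0) ∨ Module.finrank F H = 1) :=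
  ⟨HopfGauge.chiFlip τ σ, HopfGauge.isChi_chiFlip τ σ,
    fun _ h => h.eq (HopfGauge.isChi_chiFlip τ σ), HopfGauge.chiFlip_powOne τ σ,
    HopfGauge.chiFlip_vertexMul τ σ, HopfGauge.bijective_chiFlip τ σ⟩
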